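/- Let $K$ be a field and let $(H,\mu_H,\Delta_H)$ be a bialgebra over $K$: $\mu_H$ is associative, $\Delta_H$ is coassociative and multiplicative (no unit or counit is needed). All $\otimes$ and $\mathrm{Hom}$ are over $K$, and $\tau$ denotes twist isomorphisms. Let $A$ be an $H$-comodule-coalgebra: a coassociative coalgebra $(A,\Delta_A)$ with a coassociative coaction $\rho\colon A\to H\otimes A$, $(\mathrm{Id}_H\otimes\rho)\rho=(\Delta_H\otimes \mathrm{Id}_A)\rho$, such that $(\mathrm{Id}_H\otimes\Delta_A)\rho=(\mu_H\otimes \mathrm{Id}_{A^{\otimes 2}})(\mathrm{Id}_H\otimes\tau\otimes \mathrm{Id}_A)\rho^{\otimes 2}\Delta_A$. *The bicomplex.* A coderivation of $A$ is a linear map $\varphi\colon A\to A$ with $\Delta_A\varphi=(\mathrm{Id}_A\otimes\varphi+\varphi\otimes \mathrm{Id}_A)\Delta_A$; these form $\mathrm{Coder}(A)$. For $p,q\ge 0$ let $C_{CC}^{p,q}(A)$ be $0$ if $p=0$, $\mathrm{Coder}(A)$ if $(p,q)=(1,0)$, and $\mathrm{Hom}(A,H^{\otimes q}\otimes A^{\otimes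 p})$ otherwise. Let $\rho^p\colon A^{\otimes p}\to H\otimes A^{\otimes p}$ be $\rho^{\otimes p}$ followed by multiplying the $p$ factors in $H$, and for $q\ge 1$ let $\mu_l^q\colon x\otimes(y_1\otimes\cdots\otimes y_q)\mapsto\sum x_{(1)}y_1\otimes\cdots\otimes x_{(q)}y_q$ and $\mu_r^q\colon (y_1\otimes\cdots\otimes y_q)\otimes x\mapsto\sum y_1x_{(1)}\otimes\cdots\otimes y_qx_{(q)}$ be the actions of $H$ on $H^{\otimes q}$. For $p\ge1$ put $$b^{p,q}\varphi=(\mathrm{Id}_{H^{\otimes q}}\otimes\rho^p)\varphi+\sum_{i=1}^{q}(-1)^i(\mathrm{Id}_{H^{\otimes(q-i)}}\otimes\Delta_H\otimes \mathrm{Id}_{H^{\otimes(i-1)}\otimes A^{\otimes p}})\varphi+(-1)^{q+1}(\mathrm{Id}_H\otimes\varphi)\rho,$$ $$d^{p,q}\varphi=d_0\varphi+\sum_{i=1}^{p}(-1)^i(\mathrm{Id}_{H^{\otimes q}\otimes A^{\otimes(i-1)}}\otimes\Delta_A\otimes \mathrm{Id}_{A^{\otimes(p-i)}})\varphi+(-1)^{p+1}d_{p+1}\varphi,$$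 where, for $q\ge1$, $d_0\varphi=(\mu_l^q\otimes \mathrm{Id}_{A^{\otimes(p+1)}})(\mathrm{Id}_H\otimes\tau\otimes \mathrm{Id}_{A^{\otimes p}})(\rho\otimes\varphi)\Delta_A$ and $d_{p+1}\varphi=(\mu_r^q\otimes \mathrm{Id}_{A^{\otimes(p+1)}})(\mathrm{Id}_{H^{\otimes q}}\otimes\tau\otimes \mathrm{Id}_A)(\varphi\otimes\rho)\Delta_A$, and, for $q=0$, $d_0\varphi=(\mathrm{Id}_A\otimes\varphi)\Delta_A$ and $d_{p+1}\varphi=(\varphi\otimes \mathrm{Id}_A)\Delta_A$. On $C_{CC}^{0,q}(A)=0$ all maps are zero. The horizontal differential is $d_{\mathrm{hor}}=d^{p,q}$ and the vertical differential is $d_{\mathrm{vert}}=(-1)^{p+1}b^{p,q}$. The total complex $C_{CC}^*(A)$ has $C_{CC}^n(A)=\bigoplus_{p+q=n}C_{CC}^{p,q}(A)$ and differential $D=d_{\mathrm{vert}}-d_{\mathrm{hor}}$ (isomorphic, by multiplication with $(-1)^p$ on $C_{CC}^{p,q}(A)$, to the one with $d_{\mathrm{vert}}+d_{\mathrm{hor}}$);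 $H_{CC}^n(A)$ is its cohomology. *Deformations.* A deformation of $A$ is a pair $\Theta=(R,\mathcal D)$ of formal power series $R=\sum_{n\ge0}\rho_nt^n$ and $\mathcal D=\sum_{n\ge0}\Delta_nt^n$ with $\rho_n\in\mathrm{Hom}(A,H\otimes A)$, $\Delta_n\in\mathrm{Hom}(A,A\otimes A)$, $\rho_0=\rho$, $\Delta_0=\Delta_A$, such that $(\mathrm{Id}_H\otimes R)R=(\Delta_H\otimes \mathrm{Id}_A)R$, $(\mathrm{Id}_H\otimes \mathcal D)R=(\mu_H\otimes \mathrm{Id}_{A^{\otimes2}})(\mathrm{Id}_H\otimes\tau\otimes \mathrm{Id}_A)R^{\otimes2}\mathcal D$ and $(\mathcal D\otimes \mathrm{Id}_A)\mathcal D=(\mathrm{Id}_A\otimes \mathcal D)\mathcal D$, coefficientwise in $t$. Its infinitesimal is $\theta_1=(\rho_1,\Delta_1)\in C^{1,1}_{CC}(A)\oplus C^{2,0}_{CC}(A)=C_{CC}^2(A)$. The trivial deformation is $(\rho,\Delta_A)$. A formal automorphism is a power series $\Phi=\sum_{n\ge0}\phi_nt^n$ in $\mathrm{End}(A)$ with $\phi_0=\mathrm{Id}_A$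 whose first nonzero $\phi_n$ with $n\ge1$, if any, is a coderivation. Deformations $(R,\mathcal D)$ and $(\overline R,\overline{\mathcal D})$ are equivalent if $\overline R=(\mathrm{Id}_H\otimes\Phi^{-1})R\,\Phi$ and $\overline{\mathcal D}=(\Phi^{-1})^{\otimes2}\mathcal D\,\Phi$ for some formal automorphism $\Phi$. $A$ is rigid if every deformation of $A$ is equivalent to the trivial one. **Theorem.** Let $A$ be an $H$-comodule-coalgebra. (0) $C_{CC}^{**}(A)$ is a bicomplex: $d_{\mathrm{hor}}^2=0$, $d_{\mathrm{vert}}^2=0$, $d_{\mathrm{hor}}d_{\mathrm{vert}}+d_{\mathrm{vert}}d_{\mathrm{hor}}=0$; hence $D^2=0$. (1) The infinitesimal of every deformation of $A$ is a $2$-cocycle in $C_{CC}^*(A)$, and the infinitesimals of equivalent deformations have the same class in $H_{CC}^2(A)$. (2) If $H_{CC}^2(A)=0$, then $A$ is rigid. -/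

import Mathlib

open scoped TensorProduct

universe u v

namespace ComodCoalg

/-! ### Right-nested tensor powers -/

section TensorPowers

variable {K : Type u} [Field K]
variable {V X Y : Type v} [AddCommGroup V] [Module K V] [AddCommGroup X] [Module K X]
  [AddCommGroup Y] [Module K Y]

variable (K V X) in
/-- `tpow K V X n` is `V^{⊗ n} ⊗ X`, bracketed to the right: `V ⊗ (V ⊗ (⋯ ⊗ (V ⊗ X)))`, with
`n` factors `V`; for `n = 0` it is `X`. In particular `tpow K V V n` is `V^{⊗ (n + 1)}`. -/
noncomputable abbrev tpow : ℕ → ModuleCat.{v} K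
  | 0 => ModuleCat.of K X
  | n + 1 => ModuleCat.of K (V ⊗[K] (tpow n))

/-- `Id_{V^{⊗ n}} ⊗ f : V^{⊗ n} ⊗ X → V^{⊗ n} ⊗ Y`. -/
noncomputable def mapLast (f : X →ₗ[K] Y) : (n : ℕ) → (tpow K V X n →ₗ[K] tpow K V Y n)
  | 0 => f
  | n + 1 => LinearMap.lTensor V (mapLast f n)

/-- `Id_{V^{⊗ n}} ⊗ f : V^{⊗ n} ⊗ X → V^{⊗ (n + 1)} ⊗ X` for a map `f : X → V ⊗ X`. -/
noncomputable def coactLast (f : X →ₗ[K] V ⊗[K] X) :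
    (n : ℕ) → (tpow K V X n →ₗ[K] tpow K V X (n + 1))
  | 0 => f
  | n + 1 => LinearMap.lTensor V (coactLast f n)

/-- `Id_{V^{⊗ i}} ⊗ δ ⊗ Id_{V^{⊗ (n - i - 1)} ⊗ X} : V^{⊗ n} ⊗ X → V^{⊗ (n + 1)} ⊗ X` for a map
`δ : V → V ⊗ V`: the map `δ` is applied to the factor `V` in position `i`, counted from `0`. -/
noncomputable def comulAt (δ : V →ₗ[K] V ⊗[K] V) :
    (n : ℕ) → Fin n → (tpow K V X n →ₗ[K] tpow K V X (n + 1))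
  | _ + 1, ⟨0, _⟩ => (TensorProduct.assoc K V V _).toLinearMap ∘ₗ LinearMap.rTensor _ δ
  | n + 1, ⟨i + 1, h⟩ => LinearMap.lTensor V (comulAt δ n ⟨i, Nat.lt_of_succ_lt_succ h⟩)

/-- `Id_{V^{⊗ i}} ⊗ δ ⊗ Id_{V^{⊗ (n - i)}} : V^{⊗ (n + 1)} → V^{⊗ (n + 2)}` for a map
`δ : V → V ⊗ V`: the map `δ` is applied to the factor in position `i`, counted from `0`. -/
noncomputable def powComulAt (δ : V →ₗ[K] V ⊗[K] V) :
    (n : ℕ) → Fin (n + 1) → (tpow K V V n →ₗ[K] tpow K V V (n + 1))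
  | 0, _ => δ
  | _ + 1, ⟨0, _⟩ => (TensorProduct.assoc K V V _).toLinearMap ∘ₗ LinearMap.rTensor _ δ
  | n + 1, ⟨i + 1, h⟩ => LinearMap.lTensor V (powComulAt δ n ⟨i, Nat.lt_of_succ_lt_succ h⟩)

variable (K V) in
/-- The rebracketing `V^{⊗ (n + 1)} ⊗ V ≅ V^{⊗ (n + 2)}`. -/
noncomputable def snoc : (n : ℕ) → ((tpow K V V n) ⊗[K] V →ₗ[K] tpow K V V (n + 1))
  | 0 => LinearMap.id
  | n + 1 => LinearMap.lTensor V (snoc n) ∘ₗ (TensorProduct.assoc K V _ V).toLinearMap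

variable (K V X Y) in
/-- The twist `Y ⊗ V^{⊗ n} ⊗ X ≅ V^{⊗ n} ⊗ Y ⊗ X` that moves `Y` past `V^{⊗ n}`. -/
noncomputable def moveRight : (n : ℕ) → (Y ⊗[K] (tpow K V X n) →ₗ[K] tpow K V (Y ⊗[K] X) n)
  | 0 => LinearMap.id
  | n + 1 => LinearMap.lTensor V (moveRight n) ∘ₗ
      (TensorProduct.leftComm K Y V _).toLinearMap

variable (K V X Y) in
/-- The rebracketing `(V^{⊗ n} ⊗ X) ⊗ Y ≅ V^{⊗ n} ⊗ (X ⊗ Y)`. -/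
noncomputable def assocRight : (n : ℕ) → ((tpow K V X n) ⊗[K] Y →ₗ[K] tpow K V (X ⊗[K] Y) n)
  | 0 => LinearMap.id
  | n + 1 => LinearMap.lTensor V (assocRight n) ∘ₗ (TensorProduct.assoc K V _ Y).toLinearMap

end TensorPowers

/-! ### Bialgebras and comodule-coalgebras -/

/-- A bialgebra `(H, μ_H, Δ_H)`: an associative multiplication and a coassociative comultiplication
that is multiplicative. Neither a unit nor a counit is required. -/
structure Bialg (K : Type u) [Field K] (H : Type v) [AddCommGroup H] [Module K H] where
  mul : H ⊗[K] H →ₗ[K] H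
  comul : H →ₗ[K] H ⊗[K] H
  mul_assoc : mul ∘ₗ LinearMap.rTensor H mul =
    mul ∘ₗ LinearMap.lTensor H mul ∘ₗ (TensorProduct.assoc K H H H).toLinearMap
  comul_coassoc : (TensorProduct.assoc K H H H).toLinearMap ∘ₗ LinearMap.rTensor H comul ∘ₗ comul =
    LinearMap.lTensor H comul ∘ₗ comul
  comul_mul : comul ∘ₗ mul = TensorProduct.map mul mul ∘ₗ
    (TensorProduct.tensorTensorTensorComm K H H H H).toLinearMap ∘ₗ TensorProduct.map comul comul

namespace Bialg

variable {K : Type u} [Field K] {H : Type v} [AddCommGroup H] [Module K H] (B : Bialg K H)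

section
variable (X Y : Type v) [AddCommGroup X] [Module K X] [AddCommGroup Y] [Module K Y]

/-- `(μ_H ⊗ Id_{X ⊗ Y}) ∘ (Id_H ⊗ τ_{(X,H)} ⊗ Id_Y) : (H ⊗ X) ⊗ (H ⊗ Y) → H ⊗ (X ⊗ Y)`. -/
noncomputable def mulShuffle : (H ⊗[K] X) ⊗[K] (H ⊗[K] Y) →ₗ[K] H ⊗[K] (X ⊗[K] Y) :=
  LinearMap.rTensor (X ⊗[K] Y) B.mul ∘ₗ
    (TensorProduct.tensorTensorTensorComm K H X H Y).toLinearMap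

/-- `actLeft X n` is `μ_{l,H}^q ⊗ Id_X` for `q = n + 1`, that is, the left action
`x · (y₁ ⊗ ⋯ ⊗ y_q) = ∑ x₍₁₎ y₁ ⊗ ⋯ ⊗ x₍q₎ y_q`. -/
noncomputable def actLeft : (n : ℕ) → (H ⊗[K] (tpow K H X (n + 1)) →ₗ[K] tpow K H X (n + 1))
  | 0 => (LinearMap.rTensor X B.mul ∘ₗ (TensorProduct.assoc K H H X).symm.toLinearMap :
      H ⊗[K] (H ⊗[K] X) →ₗ[K] H ⊗[K] X)
  | n + 1 => TensorProduct.map B.mul (actLeft n) ∘ₗ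
      (TensorProduct.tensorTensorTensorComm K H H H (tpow K H X (n + 1))).toLinearMap ∘ₗ
        LinearMap.rTensor (H ⊗[K] (tpow K H X (n + 1))) B.comul

/-- `actRight X n` is `μ_{r,H}^q` for `q = n + 1` on the factor `H^{⊗ q}` of `H^{⊗ q} ⊗ X`, that is,
the right action `(y₁ ⊗ ⋯ ⊗ y_q) · x = ∑ y₁ x₍₁₎ ⊗ ⋯ ⊗ y_q x₍q₎`; here `x` is written last. -/
noncomputable def actRight : (n : ℕ) → ((tpow K H X (n + 1)) ⊗[K] H →ₗ[K] tpow K H X (n + 1))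
  | 0 => (LinearMap.rTensor X B.mul ∘ₗ (TensorProduct.rightComm K H X H).toLinearMap :
      (H ⊗[K] X) ⊗[K] H →ₗ[K] H ⊗[K] X)
  | n + 1 => TensorProduct.map B.mul (actRight n) ∘ₗ
      (TensorProduct.tensorTensorTensorComm K H (tpow K H X (n + 1)) H H).toLinearMap ∘ₗ
        LinearMap.lTensor (H ⊗[K] (tpow K H X (n + 1))) B.comul

end

end Bialg

/-- An `H`-comodule-coalgebra: a coassociative coalgebra `(A, Δ_A)` with an `H`-comodule structure
`ρ : A → H ⊗ A` such that `Δ_A` is a morphism of `H`-comodules. -/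
structure ComoduleCoalgebra {K : Type u} [Field K] {H : Type v} [AddCommGroup H] [Module K H]
    (B : Bialg K H) (A : Type v) [AddCommGroup A] [Module K A] where
  comul : A →ₗ[K] A ⊗[K] A
  coact : A →ₗ[K] H ⊗[K] A
  comul_coassoc : (TensorProduct.assoc K A A A).toLinearMap ∘ₗ LinearMap.rTensor A comul ∘ₗ comul =
    LinearMap.lTensor A comul ∘ₗ comul
  coact_coassoc : LinearMap.lTensor H coact ∘ₗ coact =
    (TensorProduct.assoc K H H A).toLinearMap ∘ₗ LinearMap.rTensor A B.comul ∘ₗ coact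
  coact_comul : LinearMap.lTensor H comul ∘ₗ coact =
    B.mulShuffle A A ∘ₗ TensorProduct.map coact coact ∘ₗ comul

/-- The Cauchy product of two formal power series with respect to a pairing `op` of their
coefficients: the coefficient of `t^n` is `∑_{i + j = n} op (f i) (g j)`. -/
def cauchy {M N P : Type*} [AddCommMonoid P] (op : M → N → P) (f : ℕ → M) (g : ℕ → N) : ℕ → P :=
  fun n => ∑ ij ∈ Finset.HasAntidiagonal.antidiagonal n, op (f ij.1) (g ij.2)

/-- The power series with constant term `x` and no other terms. -/
def constSeries {M : Type*} [Zero M] (x : M) : ℕ → M := fun n => if n = 0 then x else 0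

theorem cauchy_constSeries {M N P : Type*} [Zero M] [Zero N] [AddCommMonoid P] (op : M → N → P)
    (hl : ∀ y, op 0 y = 0) (hr : ∀ x, op x 0 = 0) (x : M) (y : N) :
    cauchy op (constSeries x) (constSeries y) = constSeries (op x y) := by
  funext n
  unfold cauchy constSeries
  rcases Nat.eq_zero_or_pos n with rfl | hn
  · simp
  · rw [if_neg hn.ne']
    refine Finset.sum_eq_zero fun ij hij => ?_
    have h := Finset.HasAntidiagonal.mem_antidiagonal.1 hij
    by_cases h1 : ij.1 = 0
    · rw [if_neg (by omega : ¬ ij.2 = 0), hr]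
    · rw [if_neg h1, hl]

namespace ComoduleCoalgebra

variable {K : Type u} [Field K] {H : Type v} [AddCommGroup H] [Module K H] {B : Bialg K H}
  {A : Type v} [AddCommGroup A] [Module K A] (C : ComoduleCoalgebra B A)

/-! ### The deformation bicomplex -/

/-- The module of coderivations on `A`. -/
noncomputable def coder : Submodule K (A →ₗ[K] A) where
  carrier := {φ | C.comul ∘ₗ φ = (LinearMap.lTensor A φ + LinearMap.rTensor A φ) ∘ₗ C.comul}
  zero_mem' := by simp
  add_mem' := by
    intro φ ψ hφ hψ
    simp only [Set.mem_ofPred_eq, LinearMap.comp_add, LinearMap.lTensor_add, LinearMap.rTensor_add,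
      LinearMap.add_comp] at *
    rw [hφ, hψ]
    abel
  smul_mem' := by
    intro c φ hφ
    simp only [Set.mem_ofPred_eq, LinearMap.comp_smul, LinearMap.lTensor_smul,
      LinearMap.rTensor_smul, LinearMap.add_comp, LinearMap.smul_comp] at *
    rw [hφ, smul_add]

/-- The `H`-comodule structure map `ρ^p : A^{⊗ p} → H ⊗ A^{⊗ p}` for `p = n + 1`. -/
noncomputable def coactPow : (n : ℕ) → (tpow K A A n →ₗ[K] H ⊗[K] (tpow K A A n))
  | 0 => C.coact
  | n + 1 => B.mulShuffle A (tpow K A A n) ∘ₗ TensorProduct.map C.coact (coactPow n)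

variable (K H A) in
/-- `Coch K H A n q` is `Hom(A, H^{⊗ q} ⊗ A^{⊗ p})` for `p = n + 1`. -/
abbrev Coch (n q : ℕ) : Type v := A →ₗ[K] tpow K H (tpow K A A n) q

/-- The summand `d^{p,q}[0]` of the horizontal differential, `p = n + 1`. -/
noncomputable def dFirst (n : ℕ) : (q : ℕ) → (Coch K H A n q → Coch K H A (n + 1) q)
  | 0, φ => LinearMap.lTensor A (φ : A →ₗ[K] tpow K A A n) ∘ₗ C.comul
  | q + 1, φ => B.actLeft (A ⊗[K] (tpow K A A n)) q ∘ₗ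
      LinearMap.lTensor H (moveRight K H (tpow K A A n) A (q + 1)) ∘ₗ
      (TensorProduct.assoc K H A (tpow K H (tpow K A A n) (q + 1))).toLinearMap ∘ₗ
      TensorProduct.map C.coact φ ∘ₗ C.comul

/-- The summand `d^{p,q}[p + 1]` of the horizontal differential, `p = n + 1`. -/
noncomputable def dLast (n : ℕ) : (q : ℕ) → (Coch K H A n q → Coch K H A (n + 1) q)
  | 0, φ => snoc K A n ∘ₗ LinearMap.rTensor A (φ : A →ₗ[K] tpow K A A n) ∘ₗ C.comul
  | q + 1, φ => B.actRight (tpow K A A (n + 1)) q ∘ₗ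
      LinearMap.rTensor H (mapLast (snoc K A n) (q + 1) ∘ₗ
        assocRight K H (tpow K A A n) A (q + 1)) ∘ₗ
      (TensorProduct.assoc K (tpow K H (tpow K A A n) (q + 1)) A H).symm.toLinearMap ∘ₗ
      LinearMap.lTensor (tpow K H (tpow K A A n) (q + 1))
        (TensorProduct.comm K H A).toLinearMap ∘ₗ
      TensorProduct.map φ C.coact ∘ₗ C.comul

theorem dFirst_add (n q : ℕ) (φ ψ : Coch K H A n q) :
    C.dFirst n q (φ + ψ) = C.dFirst n q φ + C.dFirst n q ψ := by
  cases q with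
  | zero =>
    exact (congrArg (· ∘ₗ C.comul) (LinearMap.lTensor_add A
      (φ : A →ₗ[K] tpow K A A n) (ψ : A →ₗ[K] tpow K A A n))).trans (LinearMap.add_comp _ _ _)
  | succ q =>
    simp only [dFirst, TensorProduct.map_add_right, LinearMap.add_comp, LinearMap.comp_add]

theorem dFirst_smul (n q : ℕ) (c : K) (φ : Coch K H A n q) :
    C.dFirst n q (c • φ) = c • C.dFirst n q φ := by
  cases q with
  | zero =>
    exact (congrArg (· ∘ₗ C.comul) (LinearMap.lTensor_smul A c
      (φ : A →ₗ[K] tpow K A A n))).trans (LinearMap.smul_comp _ _ _)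
  | succ q =>
    simp only [dFirst, TensorProduct.map_smul_right, LinearMap.smul_comp, LinearMap.comp_smul]

theorem dLast_add (n q : ℕ) (φ ψ : Coch K H A n q) :
    C.dLast n q (φ + ψ) = C.dLast n q φ + C.dLast n q ψ := by
  cases q with
  | zero =>
    refine (congrArg (fun f => snoc K A n ∘ₗ f ∘ₗ C.comul) (LinearMap.rTensor_add A
      (φ : A →ₗ[K] tpow K A A n) (ψ : A →ₗ[K] tpow K A A n))).trans ?_
    rw [LinearMap.add_comp, LinearMap.comp_add]
    rfl
  | succ q =>
    simp only [dLast, TensorProduct.map_add_left, LinearMap.add_comp, LinearMap.comp_add]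

theorem dLast_smul (n q : ℕ) (c : K) (φ : Coch K H A n q) :
    C.dLast n q (c • φ) = c • C.dLast n q φ := by
  cases q with
  | zero =>
    refine (congrArg (fun f => snoc K A n ∘ₗ f ∘ₗ C.comul) (LinearMap.rTensor_smul A c
      (φ : A →ₗ[K] tpow K A A n))).trans ?_
    rw [LinearMap.smul_comp, LinearMap.comp_smul]
    rfl
  | succ q =>
    simp only [dLast, TensorProduct.map_smul_left, LinearMap.smul_comp, LinearMap.comp_smul]

/-- The horizontal differential
`d^{p,q} : Hom(A, H^{⊗ q} ⊗ A^{⊗ p}) → Hom(A, H^{⊗ q} ⊗ A^{⊗ (p + 1)})`, `p = n + 1`. The summand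
with index `i : Fin (n + 1)` is `d^{p,q}[i + 1]`. -/
noncomputable def d (n q : ℕ) : Coch K H A n q →ₗ[K] Coch K H A (n + 1) q where
  toFun φ := C.dFirst n q φ +
    ∑ i : Fin (n + 1), (-1 : K) ^ ((i : ℕ) + 1) • (mapLast (powComulAt C.comul n i) q ∘ₗ φ) +
    (-1 : K) ^ (n + 2) • C.dLast n q φ
  map_add' φ ψ := by
    simp only [dFirst_add, dLast_add, LinearMap.comp_add, smul_add, Finset.sum_add_distrib]
    abel
  map_smul' c φ := by
    simp only [dFirst_smul, dLast_smul, LinearMap.comp_smul, RingHom.id_apply, smul_add,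
      Finset.smul_sum, smul_comm c]

/-- The summand `b^{p,q}[q + 1](φ) = (Id_H ⊗ φ) ∘ ρ`, `p = n + 1`. -/
noncomputable def bLast (n q : ℕ) (φ : Coch K H A n q) : Coch K H A n (q + 1) :=
  LinearMap.lTensor H φ ∘ₗ C.coact

theorem bLast_add (n q : ℕ) (φ ψ : Coch K H A n q) :
    C.bLast n q (φ + ψ) = C.bLast n q φ + C.bLast n q ψ :=
  (congrArg (· ∘ₗ C.coact) (LinearMap.lTensor_add H φ ψ)).trans (LinearMap.add_comp _ _ _)

theorem bLast_smul (n q : ℕ) (c : K) (φ : Coch K H A n q) :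
    C.bLast n q (c • φ) = c • C.bLast n q φ :=
  (congrArg (· ∘ₗ C.coact) (LinearMap.lTensor_smul H c φ)).trans (LinearMap.smul_comp _ _ _)

/-- The map `b^{p,q} : Hom(A, H^{⊗ q} ⊗ A^{⊗ p}) → Hom(A, H^{⊗ (q + 1)} ⊗ A^{⊗ p})`, `p = n + 1`.
The summand with index `i : Fin q` is `b^{p,q}[i + 1]`, which applies `Δ_H` to the factor `H` in
position `q - (i + 1)`, counted from `0`. -/
noncomputable def b (n q : ℕ) : Coch K H A n q →ₗ[K] Coch K H A n (q + 1) where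
  toFun φ := coactLast (C.coactPow n) q ∘ₗ φ +
    ∑ i : Fin q, (-1 : K) ^ ((i : ℕ) + 1) • (comulAt B.comul q i.rev ∘ₗ φ) +
    (-1 : K) ^ (q + 1) • C.bLast n q φ
  map_add' φ ψ := by
    simp only [bLast_add, LinearMap.comp_add, smul_add, Finset.sum_add_distrib]
    abel
  map_smul' c φ := by
    simp only [bLast_smul, LinearMap.comp_smul, RingHom.id_apply, smul_add,
      Finset.smul_sum, smul_comm c]

/-- `C_CC^{p,q}(A)` for `p = n + 1`, as a submodule of `Hom(A, H^{⊗ q} ⊗ A^{⊗ p})`: the module of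
coderivations for `(p, q) = (1, 0)`, and the whole module otherwise. -/
noncomputable def entrySub : (n q : ℕ) → Submodule K (Coch K H A n q)
  | 0, 0 => C.coder
  | 0, _ + 1 => ⊤
  | _ + 1, _ => ⊤

theorem mem_entrySub_succ_left (n q : ℕ) (φ : Coch K H A (n + 1) q) :
    φ ∈ C.entrySub (n + 1) q := by
  unfold entrySub
  exact Submodule.mem_top

theorem mem_entrySub_succ_right (n q : ℕ) (φ : Coch K H A n (q + 1)) :
    φ ∈ C.entrySub n (q + 1) := by
  cases n <;> exact Submodule.mem_top

/-- The entry `C_CC^{p,q}(A)` of the deformation bicomplex; it is zero for `p = 0`. -/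
noncomputable abbrev entry : ℕ → ℕ → ModuleCat.{v} K
  | 0, _ => ModuleCat.of K PUnit
  | n + 1, q => ModuleCat.of K (C.entrySub n q)

/-- The horizontal differential `d^{p,q} : C_CC^{p,q}(A) → C_CC^{p+1,q}(A)`. -/
noncomputable def dHor : (p q : ℕ) → (C.entry p q →ₗ[K] C.entry (p + 1) q)
  | 0, _ => 0
  | n + 1, q => (C.d n q).restrict fun φ _ => C.mem_entrySub_succ_left n q (C.d n q φ)

/-- The vertical differential `(-1)^{p+1} b^{p,q} : C_CC^{p,q}(A) → C_CC^{p,q+1}(A)`. -/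
noncomputable def dVert : (p q : ℕ) → (C.entry p q →ₗ[K] C.entry p (q + 1))
  | 0, _ => 0
  | n + 1, q => ((-1 : K) ^ (n + 2) • C.b n q).restrict
      fun φ _ => C.mem_entrySub_succ_right n q (((-1 : K) ^ (n + 2) • C.b n q) φ)

/-! ### The deformation complex -/

/-- The degree `n` part `⨁_{p + q = n} C_CC^{p,q}(A)` of the total complex. -/
abbrev Tot (n : ℕ) : Type v := (s : {s : ℕ × ℕ // s.1 + s.2 = n}) → C.entry s.1.1 s.1.2

/-- The component in `C_CC^{p,q}(A)`, `p + q = n + 1`, of the image of `x` under the horizontal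
differentials. -/
noncomputable def totHor (n : ℕ) (x : C.Tot n) :
    (p q : ℕ) → p + q = n + 1 → C.entry p q
  | 0, _, _ => 0
  | p + 1, q, h => C.dHor p q (x ⟨(p, q), by simp only; omega⟩)

/-- The component in `C_CC^{p,q}(A)`, `p + q = n + 1`, of the image of `x` under the vertical
differentials. -/
noncomputable def totVert (n : ℕ) (x : C.Tot n) :
    (p q : ℕ) → p + q = n + 1 → C.entry p q
  | _, 0, _ => 0
  | p, q + 1, h => C.dVert p q (x ⟨(p, q), by simp only; omega⟩)

/-- The total differential of the deformation complex `C_CC^*(A)`: the vertical differential minus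
the horizontal one. -/
noncomputable def totD (n : ℕ) : C.Tot n →ₗ[K] C.Tot (n + 1) where
  toFun x s := C.totVert n x s.1.1 s.1.2 s.2 - C.totHor n x s.1.1 s.1.2 s.2
  map_add' x y := by
    funext ⟨⟨p, q⟩, h⟩
    cases p <;> cases q <;> simp [totVert, totHor] <;> abel
  map_smul' c x := by
    funext ⟨⟨p, q⟩, h⟩
    cases p <;> cases q <;> simp [totVert, totHor, smul_sub]

/-- The module of `n`-cocycles of the deformation complex. -/
noncomputable def cocycles (n : ℕ) : Submodule K (C.Tot n) := LinearMap.ker (C.totD n)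

/-- The module of `n`-coboundaries of the deformation complex. -/
noncomputable def coboundaries : (n : ℕ) → Submodule K (C.Tot n)
  | 0 => ⊥
  | n + 1 => LinearMap.range (C.totD n)

/-- The cohomology module `H_CC^n(A)` of the deformation complex. -/
abbrev Cohomology (n : ℕ) : Type v := C.cocycles n ⧸ (C.coboundaries n).submoduleOf (C.cocycles n)

/-- The cohomology class of a cocycle. -/
noncomputable def cohomologyClass (n : ℕ) : C.cocycles n →ₗ[K] C.Cohomology n :=
  Submodule.mkQ _

/-- The element `(r, δ)` of
`C_CC^2(A) = C_CC^{1,1}(A) ⊕ C_CC^{2,0}(A) = Hom(A, H ⊗ A) ⊕ Hom(A, A ⊗ A)`. -/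
noncomputable def twoCochain (r : A →ₗ[K] H ⊗[K] A) (δ : A →ₗ[K] A ⊗[K] A) : C.Tot 2
  | ⟨(1, 1), _⟩ => (⟨r, Submodule.mem_top⟩ : C.entrySub 0 1)
  | ⟨(2, 0), _⟩ => (⟨δ, Submodule.mem_top⟩ : C.entrySub 1 0)
  | _ => 0

/-! ### Deformations -/

/-- A deformation `Θ = (R, D)` of `A`: formal power series `R = ∑ ρ_n t^n` and `D = ∑ Δ_n t^n` with
`ρ_0 = ρ` and `Δ_0 = Δ_A` which satisfy the axioms of a comodule-coalgebra. A power series with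
coefficients in a module is given by its sequence of coefficients. -/
structure Deformation where
  R : ℕ → (A →ₗ[K] H ⊗[K] A)
  D : ℕ → (A →ₗ[K] A ⊗[K] A)
  R_zero : R 0 = C.coact
  D_zero : D 0 = C.comul
  /-- `(Id_H ⊗ R) ∘ R = (Δ_H ⊗ Id_A) ∘ R` -/
  R_coassoc : cauchy (fun r r' => LinearMap.lTensor H r ∘ₗ r') R R =
    fun n => (TensorProduct.assoc K H H A).toLinearMap ∘ₗ LinearMap.rTensor A B.comul ∘ₗ R n
  /-- `(Id_H ⊗ D) ∘ R = (μ_H ⊗ Id_{A ⊗ A}) ∘ (Id_H ⊗ τ_{(A,H)} ⊗ Id_A) ∘ R^{⊗ 2} ∘ D` -/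
  R_D : cauchy (fun δ r => LinearMap.lTensor H δ ∘ₗ r) D R =
    cauchy (fun s δ => B.mulShuffle A A ∘ₗ s ∘ₗ δ)
      (cauchy (fun r r' => TensorProduct.map r r') R R) D
  /-- `(D ⊗ Id_A) ∘ D = (Id_A ⊗ D) ∘ D` -/
  D_coassoc :
    cauchy (fun δ δ' => (TensorProduct.assoc K A A A).toLinearMap ∘ₗ
      LinearMap.rTensor A δ ∘ₗ δ') D D =
    cauchy (fun δ δ' => LinearMap.lTensor A δ ∘ₗ δ') D D

/-- The infinitesimal `θ_1 = (ρ_1, Δ_1) ∈ C_CC^2(A)` of a deformation. -/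
noncomputable def Deformation.infinitesimal {C : ComoduleCoalgebra B A} (Θ : C.Deformation) :
    C.Tot 2 :=
  C.twoCochain (Θ.R 1) (Θ.D 1)

/-- The trivial deformation `Θ = (ρ, Δ_A)`. -/
noncomputable def trivialDeformation : C.Deformation where
  R := constSeries C.coact
  D := constSeries C.comul
  R_zero := rfl
  D_zero := rfl
  R_coassoc := by
    rw [cauchy_constSeries _ (by simp) (by simp), C.coact_coassoc]
    funext n
    by_cases h : n = 0 <;> simp [constSeries, h]
  R_D := by
    rw [cauchy_constSeries _ (by simp) (by simp), cauchy_constSeries _ (by simp) (by simp),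
      cauchy_constSeries _ (by simp) (by simp), C.coact_comul]
  D_coassoc := by
    rw [cauchy_constSeries _ (by simp) (by simp), cauchy_constSeries _ (by simp) (by simp),
      C.comul_coassoc]

/-- A formal automorphism of `A`: a formal power series `Φ = ∑ φ_n t^n` in `End(A)` with
`φ_0 = Id_A` whose first non-zero coefficient `φ_n` with `n ≥ 1`, if there is one, is a
coderivation. -/
def IsFormalAutomorphism (Φ : PowerSeries (Module.End K A)) : Prop :=
  PowerSeries.coeff 0 Φ = 1 ∧
    ∀ n, 1 ≤ n → PowerSeries.coeff n Φ ≠ 0 →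
      (∀ m, 1 ≤ m → m < n → PowerSeries.coeff m Φ = 0) → PowerSeries.coeff n Φ ∈ C.coder

/-- `Θ = (R, D)` and `Θ' = (R', D')` are equivalent if there is a formal automorphism `Φ` such that
`R' = (Id_H ⊗ Φ⁻¹) ∘ R ∘ Φ` and `D' = (Φ⁻¹)^{⊗ 2} ∘ D ∘ Φ`. The product of power series in `End(A)`
is the composition; each formal automorphism is a unit, and `Φ⁻¹` is its inverse. -/
def Deformation.Equivalent {C : ComoduleCoalgebra B A} (Θ Θ' : C.Deformation) : Prop :=
  ∃ Φ : (PowerSeries (Module.End K A))ˣ, C.IsFormalAutomorphism Φ.val ∧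
    Θ'.R = cauchy (fun (ψ : Module.End K A) r => LinearMap.lTensor H ψ ∘ₗ r)
      (fun n => PowerSeries.coeff n Φ⁻¹.val)
      (cauchy (fun r (φ : Module.End K A) => r ∘ₗ φ) Θ.R (fun n => PowerSeries.coeff n Φ.val)) ∧
    Θ'.D = cauchy (fun s δ => s ∘ₗ δ)
      (cauchy (fun (ψ ψ' : Module.End K A) => TensorProduct.map ψ ψ')
        (fun n => PowerSeries.coeff n Φ⁻¹.val) (fun n => PowerSeries.coeff n Φ⁻¹.val))
      (cauchy (fun δ (φ : Module.End K A) => δ ∘ₗ φ) Θ.D (fun n => PowerSeries.coeff n Φ.val))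

/-- `A` is rigid if every deformation of `A` is equivalent to the trivial deformation. -/
def IsRigid : Prop := ∀ Θ : C.Deformation, Θ.Equivalent C.trivialDeformation

end ComoduleCoalgebra

end ComodCoalg

/-! The horizontal differential is of Cartier type: its outer faces split off a factor `A` whose
coaction multiplies into `H^{⊗ q}` from the left or right, and its inner faces apply `Δ_A`. The
vertical differential is the cobar-type differential for the coaction. Everything in part (0)
follows from cosimplicial identities, and each comes from one axiom: coassociativity of `Δ_A`, of
`Δ_H` or of `ρ`, associativity of `μ_H`, multiplicativity of `Δ_H`, or colinearity of `Δ_A`. To make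
these identities inductive in `q`, the diagonal action is rewritten. Instead of iterating `Δ_H` on
the `H`-part of `ρ(a)`, the maps `pushLeft` and `pushRight` coact once for each factor `H`; the two
agree because `ρ` is coassociative (`actLeft_moveRight`, `actRight_assocRight`). The alternating
sums are likewise replaced by the recursive maps `altComul` and `altCoface`. This splits `d` into
first face, inner part and last face, and `b` into initial part and last face. Then `d_d` and `b_d`
are short expansions, and the sign `(-1)^{p+1}` makes the commuting differentials anticommute. For
parts (1) and (2), the coefficient of `t^n` in the deformation equations, when all coefficients
strictly between `0` and `n` vanish, is their linearization at `(ρ, Δ_A)`. That is exactly the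
cocycle condition for `(ρ_n, Δ_n)`. Conjugation by `Φ = 1 + φ t^n + ⋯` adds `b φ` to `ρ_n` and
subtracts `d φ` from `Δ_n` (`conj_R_apply`, `conj_D_apply`). Degree one of the complex consists of
coderivations, on which `d` vanishes, so the `2`-coboundaries are the pairs `(b φ, 0)`. With `n = 1`
this gives part (1). If `H²` vanishes, the first nonzero coefficients form a pair `(b φ, 0)`, and
conjugation by `1 - φ t^n` removes them. The successive corrections change only higher and higher
coefficients, so their product converges `t`-adically. Its first nonzero coefficient of positive
degree is introduced at one stage and never changed later, so it is a coderivation and the limit is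
a formal automorphism. -/

namespace ComodCoalg

open TensorProduct

/-! ### Comultiplication on the first tensor factor -/

section TensorLemmas

variable {K : Type u} [Field K]
variable {X Y Z W V : Type v} [AddCommGroup X] [Module K X] [AddCommGroup Y] [Module K Y]
  [AddCommGroup Z] [Module K Z] [AddCommGroup W] [Module K W] [AddCommGroup V] [Module K V]

/-- Apply `δ : V → V ⊗ V` to the first factor of `V ⊗ X`. -/
noncomputable def comulFirst (δ : V →ₗ[K] V ⊗[K] V) (X : Type v) [AddCommGroup X] [Module K X] :
    V ⊗[K] X →ₗ[K] V ⊗[K] (V ⊗[K] X) :=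
  (TensorProduct.assoc K V V X).toLinearMap ∘ₗ LinearMap.rTensor X δ

theorem comulFirst_tmul (δ : V →ₗ[K] V ⊗[K] V) (v : V) (x : X) :
    comulFirst δ X (v ⊗ₜ x) = TensorProduct.assoc K V V X (δ v ⊗ₜ x) := rfl

theorem comulFirst_eq_comp (δ : V →ₗ[K] V ⊗[K] V) (X : Type v) [AddCommGroup X] [Module K X] :
    comulFirst δ X = (TensorProduct.assoc K V V X).toLinearMap ∘ₗ LinearMap.rTensor X δ := rfl

theorem comulFirst_lTensor (δ : V →ₗ[K] V ⊗[K] V) (f : X →ₗ[K] Y) (t : V ⊗[K] X) :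
    comulFirst δ Y (LinearMap.lTensor V f t) =
      LinearMap.lTensor V (LinearMap.lTensor V f) (comulFirst δ X t) := by
  induction t with
  | zero => simp
  | add a b ha hb => simp only [map_add, ha, hb]
  | tmul v x =>
    simp only [comulFirst_tmul, LinearMap.lTensor_tmul]
    induction δ v with
    | zero => simp
    | add a b ha hb => simp only [map_add, add_tmul, ha, hb]
    | tmul a b => simp

/-- Coassociativity of `δ` on the first factor. -/
theorem comulFirst_comulFirst (δ : V →ₗ[K] V ⊗[K] V)
    (h : (TensorProduct.assoc K V V V).toLinearMap ∘ₗ LinearMap.rTensor V δ ∘ₗ δ =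
      LinearMap.lTensor V δ ∘ₗ δ) (t : V ⊗[K] X) :
    comulFirst δ (V ⊗[K] X) (comulFirst δ X t) =
      LinearMap.lTensor V (comulFirst δ X) (comulFirst δ X t) := by
  induction t with
  | zero => simp
  | add a b ha hb => simp only [map_add, ha, hb]
  | tmul v x =>
    -- `h1` and `h2` write the two sides as the same rebracketing applied to `(δ ⊗ Id) s` and `(Id ⊗
    -- δ) s`; coassociativity then applies at `s = δ v`.
    have h1 : ∀ s : V ⊗[K] V, comulFirst δ (V ⊗[K] X) (TensorProduct.assoc K V V X (s ⊗ₜ x)) =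
        LinearMap.lTensor V (TensorProduct.assoc K V V X).toLinearMap
          (TensorProduct.assoc K V (V ⊗[K] V) X
            (TensorProduct.assoc K V V V (LinearMap.rTensor V δ s) ⊗ₜ x)) := by
      intro s
      induction s with
      | zero => simp
      | add a b ha hb => simp only [map_add, add_tmul, ha, hb]
      | tmul a b =>
        simp only [assoc_tmul, comulFirst_tmul, LinearMap.rTensor_tmul]
        induction δ a with
        | zero => simp
        | add a b ha hb => simp only [map_add, add_tmul, ha, hb]
        | tmul a b => simp
    have h2 : ∀ s : V ⊗[K] V, LinearMap.lTensor V (comulFirst δ X)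
          (TensorProduct.assoc K V V X (s ⊗ₜ x)) =
        LinearMap.lTensor V (TensorProduct.assoc K V V X).toLinearMap
          (TensorProduct.assoc K V (V ⊗[K] V) X (LinearMap.lTensor V δ s ⊗ₜ x)) := by
      intro s
      induction s with
      | zero => simp
      | add a b ha hb => simp only [map_add, add_tmul, ha, hb]
      | tmul a b => simp [comulFirst_tmul]
    rw [comulFirst_tmul, h1, h2]
    have h3 := LinearMap.congr_fun h v
    simp only [LinearMap.comp_apply, LinearEquiv.coe_coe] at h3
    rw [h3]

end TensorLemmas

/-! ### Multiplying the `H`-parts of tensors -/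

namespace Bialg

variable {K : Type u} [Field K] {H : Type v} [AddCommGroup H] [Module K H] (B : Bialg K H)
variable {X Y Z W : Type v} [AddCommGroup X] [Module K X] [AddCommGroup Y] [Module K Y]
  [AddCommGroup Z] [Module K Z] [AddCommGroup W] [Module K W]

theorem mulShuffle_tmul (h k : H) (x : X) (y : Y) :
    B.mulShuffle X Y ((h ⊗ₜ x) ⊗ₜ (k ⊗ₜ y)) = B.mul (h ⊗ₜ k) ⊗ₜ (x ⊗ₜ y) := rfl

theorem mulShuffle_lTensor (f : X →ₗ[K] Z) (g : Y →ₗ[K] W) (s : H ⊗[K] X) (t : H ⊗[K] Y) :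
    B.mulShuffle Z W (LinearMap.lTensor H f s ⊗ₜ LinearMap.lTensor H g t) =
      LinearMap.lTensor H (TensorProduct.map f g) (B.mulShuffle X Y (s ⊗ₜ t)) := by
  induction s with
  | zero => simp
  | add a b ha hb => simp only [map_add, add_tmul, ha, hb]
  | tmul h x =>
    induction t with
    | zero => simp
    | add a b ha hb => simp only [map_add, tmul_add, ha, hb]
    | tmul k y => simp [mulShuffle_tmul]

theorem mulShuffle_lTensor_left (f : X →ₗ[K] Z) (s : H ⊗[K] X) (t : H ⊗[K] Y) :
    B.mulShuffle Z Y (LinearMap.lTensor H f s ⊗ₜ t) =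
      LinearMap.lTensor H (LinearMap.rTensor Y f) (B.mulShuffle X Y (s ⊗ₜ t)) := by
  have h := B.mulShuffle_lTensor f (LinearMap.id : Y →ₗ[K] Y) s t
  rwa [LinearMap.lTensor_id, LinearMap.id_apply] at h

theorem mulShuffle_lTensor_right (g : Y →ₗ[K] W) (s : H ⊗[K] X) (t : H ⊗[K] Y) :
    B.mulShuffle X W (s ⊗ₜ LinearMap.lTensor H g t) =
      LinearMap.lTensor H (LinearMap.lTensor X g) (B.mulShuffle X Y (s ⊗ₜ t)) := by
  have h := B.mulShuffle_lTensor (LinearMap.id : X →ₗ[K] X) g s t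
  rwa [LinearMap.lTensor_id, LinearMap.id_apply] at h

theorem mulShuffle_assoc (s : H ⊗[K] X) (t : H ⊗[K] Y) (r : H ⊗[K] Z) :
    LinearMap.lTensor H (TensorProduct.assoc K X Y Z).toLinearMap
      (B.mulShuffle (X ⊗[K] Y) Z (B.mulShuffle X Y (s ⊗ₜ t) ⊗ₜ r)) =
      B.mulShuffle X (Y ⊗[K] Z) (s ⊗ₜ B.mulShuffle Y Z (t ⊗ₜ r)) := by
  induction s with
  | zero => simp
  | add a b ha hb => simp only [map_add, add_tmul, ha, hb]
  | tmul h x =>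
    induction t with
    | zero => simp
    | add a b ha hb => simp only [map_add, tmul_add, add_tmul, ha, hb]
    | tmul k y =>
      induction r with
      | zero => simp
      | add a b ha hb => simp only [map_add, tmul_add, ha, hb]
      | tmul l z =>
        have := LinearMap.congr_fun B.mul_assoc ((h ⊗ₜ k) ⊗ₜ l)
        simp only [LinearMap.comp_apply, LinearMap.rTensor_tmul, LinearEquiv.coe_coe, assoc_tmul,
          LinearMap.lTensor_tmul] at this
        simp [mulShuffle_tmul, this]

/-- The comultiplication of `H` is multiplicative, with coefficients. -/
theorem comulFirst_mulShuffle (s : H ⊗[K] X) (t : H ⊗[K] Y) :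
    comulFirst B.comul (X ⊗[K] Y) (B.mulShuffle X Y (s ⊗ₜ t)) =
      LinearMap.lTensor H (B.mulShuffle X Y) (B.mulShuffle (H ⊗[K] X) (H ⊗[K] Y)
        (comulFirst B.comul X s ⊗ₜ comulFirst B.comul Y t)) := by
  induction s with
  | zero => simp
  | add a b ha hb => simp only [map_add, add_tmul, ha, hb]
  | tmul h x =>
    induction t with
    | zero => simp
    | add a b ha hb => simp only [map_add, tmul_add, ha, hb]
    | tmul k y =>
      have := LinearMap.congr_fun B.comul_mul (h ⊗ₜ k)
      simp only [LinearMap.comp_apply, LinearEquiv.coe_coe, map_tmul] at this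
      rw [mulShuffle_tmul, comulFirst_tmul, this, comulFirst_tmul, comulFirst_tmul]
      induction B.comul h with
      | zero => simp
      | add a b ha hb => simp only [map_add, add_tmul, ha, hb]
      | tmul h1 h2 =>
        induction B.comul k with
        | zero => simp
        | add a b ha hb => simp only [map_add, add_tmul, tmul_add, ha, hb]
        | tmul k1 k2 => simp [mulShuffle_tmul]

end Bialg

namespace ComoduleCoalgebra

variable {K : Type u} [Field K] {H : Type v} [AddCommGroup H] [Module K H] {B : Bialg K H}
  {A : Type v} [AddCommGroup A] [Module K A] (C : ComoduleCoalgebra B A)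

/-! ### The induction step: adding one factor `H` -/

section Steps

variable {M N M' N' L L' : Type v} [AddCommGroup M] [Module K M] [AddCommGroup N] [Module K N]
  [AddCommGroup M'] [Module K M'] [AddCommGroup N'] [Module K N']
  [AddCommGroup L] [Module K L] [AddCommGroup L'] [Module K L']

theorem coact_comul_apply (a : A) : LinearMap.lTensor H C.comul (C.coact a) =
    B.mulShuffle A A (TensorProduct.map C.coact C.coact (C.comul a)) :=
  LinearMap.congr_fun C.coact_comul a

theorem coact_coassoc_apply (a : A) : LinearMap.lTensor H C.coact (C.coact a) =
    comulFirst B.comul A (C.coact a) :=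
  LinearMap.congr_fun C.coact_coassoc a

/-- Extend `A ⊗ M → N` to `A ⊗ (H ⊗ M) → H ⊗ N` by the coaction of `A`. -/
noncomputable def stepLeft (f : A ⊗[K] M →ₗ[K] N) : A ⊗[K] (H ⊗[K] M) →ₗ[K] H ⊗[K] N :=
  LinearMap.lTensor H f ∘ₗ B.mulShuffle A M ∘ₗ LinearMap.rTensor (H ⊗[K] M) C.coact

/-- Extend `M ⊗ A → N` to `(H ⊗ M) ⊗ A → H ⊗ N` by the coaction of `A`. -/
noncomputable def stepRight (f : M ⊗[K] A →ₗ[K] N) : (H ⊗[K] M) ⊗[K] A →ₗ[K] H ⊗[K] N :=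
  LinearMap.lTensor H f ∘ₗ B.mulShuffle M A ∘ₗ LinearMap.lTensor (H ⊗[K] M) C.coact

/-- Apply the comultiplication of `A` to the last factor of `M ⊗ A`. -/
noncomputable def comulLast (M : Type v) [AddCommGroup M] [Module K M] :
    M ⊗[K] A →ₗ[K] (M ⊗[K] A) ⊗[K] A :=
  (TensorProduct.assoc K M A A).symm.toLinearMap ∘ₗ LinearMap.lTensor M C.comul

theorem stepLeft_tmul (f : A ⊗[K] M →ₗ[K] N) (a : A) (t : H ⊗[K] M) :
    C.stepLeft f (a ⊗ₜ t) = LinearMap.lTensor H f (B.mulShuffle A M (C.coact a ⊗ₜ t)) := rfl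

theorem stepRight_tmul (f : M ⊗[K] A →ₗ[K] N) (t : H ⊗[K] M) (a : A) :
    C.stepRight f (t ⊗ₜ a) = LinearMap.lTensor H f (B.mulShuffle M A (t ⊗ₜ C.coact a)) := rfl

theorem comulLast_tmul (m : M) (a : A) :
    C.comulLast M (m ⊗ₜ a) = (TensorProduct.assoc K M A A).symm (m ⊗ₜ C.comul a) := rfl

theorem comulLast_eq_comp (M : Type v) [AddCommGroup M] [Module K M] : C.comulLast M =
    (TensorProduct.assoc K M A A).symm.toLinearMap ∘ₗ LinearMap.lTensor M C.comul := rfl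

/-- An identity satisfied by `f` is inherited by `stepLeft f`. The modules are arbitrary because
they later stand for tensor powers with `q` factors `H`, with `f` equal to `pushLeft`; the other
lemmas of this section serve the same kind of induction. -/
theorem stepLeft_natural {f : A ⊗[K] M →ₗ[K] N} {f' : A ⊗[K] M' →ₗ[K] N'} {u : M →ₗ[K] M'}
    {w : N →ₗ[K] N'} (h : f' ∘ₗ LinearMap.lTensor A u = w ∘ₗ f) :
    C.stepLeft f' ∘ₗ LinearMap.lTensor A (LinearMap.lTensor H u) =
      LinearMap.lTensor H w ∘ₗ C.stepLeft f := by
  refine TensorProduct.ext' fun a t => ?_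
  simp only [LinearMap.comp_apply, LinearMap.lTensor_tmul, stepLeft_tmul,
    Bialg.mulShuffle_lTensor_right]
  rw [← LinearMap.lTensor_comp_apply, h, LinearMap.lTensor_comp_apply]

theorem stepRight_natural {f : M ⊗[K] A →ₗ[K] N} {f' : M' ⊗[K] A →ₗ[K] N'} {u : M →ₗ[K] M'}
    {w : N →ₗ[K] N'} (h : f' ∘ₗ LinearMap.rTensor A u = w ∘ₗ f) :
    C.stepRight f' ∘ₗ LinearMap.rTensor A (LinearMap.lTensor H u) =
      LinearMap.lTensor H w ∘ₗ C.stepRight f := by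
  refine TensorProduct.ext' fun t a => ?_
  simp only [LinearMap.comp_apply, LinearMap.rTensor_tmul, stepRight_tmul,
    Bialg.mulShuffle_lTensor_left]
  rw [← LinearMap.lTensor_comp_apply, h, LinearMap.lTensor_comp_apply]

/-- Colinearity of `Δ_A` is the point: letting `a` act and then splitting it has the same effect as
splitting it and letting both halves act in turn, the two actions being combined by associativity of
`μ_H`. -/
theorem stepLeft_comulFirst {f₁ : A ⊗[K] M →ₗ[K] N} {f₂ : A ⊗[K] N →ₗ[K] N'}
    {f : A ⊗[K] M →ₗ[K] L} {w : L →ₗ[K] N'}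
    (h : f₂ ∘ₗ LinearMap.lTensor A f₁ ∘ₗ comulFirst C.comul M = w ∘ₗ f) :
    C.stepLeft f₂ ∘ₗ LinearMap.lTensor A (C.stepLeft f₁) ∘ₗ comulFirst C.comul (H ⊗[K] M) =
      LinearMap.lTensor H w ∘ₗ C.stepLeft f := by
  refine TensorProduct.ext' fun a t => ?_
  simp only [LinearMap.comp_apply, stepLeft_tmul]
  rw [← LinearMap.lTensor_comp_apply, ← h, comulFirst_eq_comp C.comul M, LinearMap.lTensor_comp_apply,
    LinearMap.lTensor_comp_apply, LinearMap.lTensor_comp_apply, ← Bialg.mulShuffle_lTensor_left,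
    coact_comul_apply, comulFirst_tmul]
  induction C.comul a with
  | zero => simp
  | add x y hx hy => simp only [map_add, add_tmul, hx, hy]
  | tmul x y =>
    simp only [assoc_tmul, LinearMap.lTensor_tmul, stepLeft_tmul, map_tmul,
      Bialg.mulShuffle_lTensor_right, Bialg.mulShuffle_assoc]

theorem stepRight_comulLast {f₁ : M ⊗[K] A →ₗ[K] N} {f₂ : N ⊗[K] A →ₗ[K] N'}
    {f : M ⊗[K] A →ₗ[K] L} {w : L →ₗ[K] N'}
    (h : f₂ ∘ₗ LinearMap.rTensor A f₁ ∘ₗ C.comulLast M = w ∘ₗ f) :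
    C.stepRight f₂ ∘ₗ LinearMap.rTensor A (C.stepRight f₁) ∘ₗ C.comulLast (H ⊗[K] M) =
      LinearMap.lTensor H w ∘ₗ C.stepRight f := by
  refine TensorProduct.ext' fun t a => ?_
  simp only [LinearMap.comp_apply, stepRight_tmul]
  rw [← LinearMap.lTensor_comp_apply, ← h, C.comulLast_eq_comp M, LinearMap.lTensor_comp_apply,
    LinearMap.lTensor_comp_apply, LinearMap.lTensor_comp_apply, ← Bialg.mulShuffle_lTensor_right,
    coact_comul_apply, comulLast_tmul]
  induction C.comul a with
  | zero => simp
  | add x y hx hy => simp only [map_add, tmul_add, hx, hy]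
  | tmul x y =>
    simp only [assoc_symm_tmul, LinearMap.rTensor_tmul, stepRight_tmul, map_tmul,
      Bialg.mulShuffle_lTensor_left, ← Bialg.mulShuffle_assoc]
    rw [← LinearMap.lTensor_comp_apply H (TensorProduct.assoc K M A A).symm.toLinearMap]
    simp

/-- Left and right multiplications on `H` commute, by associativity. -/
theorem stepRight_stepLeft {f : A ⊗[K] M →ₗ[K] N} {g : N ⊗[K] A →ₗ[K] N'}
    {g' : M ⊗[K] A →ₗ[K] L} {f' : A ⊗[K] L →ₗ[K] L'} {w : L' →ₗ[K] N'}
    (h : g ∘ₗ LinearMap.rTensor A f = w ∘ₗ f' ∘ₗ LinearMap.lTensor A g' ∘ₗ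
      (TensorProduct.assoc K A M A).toLinearMap) :
    C.stepRight g ∘ₗ LinearMap.rTensor A (C.stepLeft f) =
      LinearMap.lTensor H w ∘ₗ C.stepLeft f' ∘ₗ LinearMap.lTensor A (C.stepRight g') ∘ₗ
        (TensorProduct.assoc K A (H ⊗[K] M) A).toLinearMap := by
  refine TensorProduct.ext_threefold fun a t a' => ?_
  simp only [LinearMap.comp_apply, LinearEquiv.coe_coe, assoc_tmul, LinearMap.rTensor_tmul,
    LinearMap.lTensor_tmul, stepRight_tmul, stepLeft_tmul, Bialg.mulShuffle_lTensor_left,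
    Bialg.mulShuffle_lTensor_right, ← Bialg.mulShuffle_assoc]
  simp only [← LinearMap.lTensor_comp_apply, h]

/-- Multiplicativity of `Δ_H` distributes it over the product `a₍₋₁₎ h`, and coassociativity of `ρ`
turns `Δ_H(a₍₋₁₎)` into a second coaction. This is why one step on one side becomes two on the
other. -/
theorem comulFirst_stepLeft (f : A ⊗[K] M →ₗ[K] N) :
    comulFirst B.comul N ∘ₗ C.stepLeft f =
      C.stepLeft (C.stepLeft f) ∘ₗ LinearMap.lTensor A (comulFirst B.comul M) := by
  refine TensorProduct.ext' fun a t => ?_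
  simp only [LinearMap.comp_apply, LinearMap.lTensor_tmul, stepLeft_tmul, comulFirst_lTensor,
    Bialg.comulFirst_mulShuffle, ← coact_coassoc_apply, Bialg.mulShuffle_lTensor_left]
  simp only [← LinearMap.lTensor_comp_apply, stepLeft]

theorem comulFirst_stepRight (f : M ⊗[K] A →ₗ[K] N) :
    comulFirst B.comul N ∘ₗ C.stepRight f =
      C.stepRight (C.stepRight f) ∘ₗ LinearMap.rTensor A (comulFirst B.comul M) := by
  refine TensorProduct.ext' fun t a => ?_
  simp only [LinearMap.comp_apply, LinearMap.rTensor_tmul, stepRight_tmul, comulFirst_lTensor,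
    Bialg.comulFirst_mulShuffle, ← coact_coassoc_apply, Bialg.mulShuffle_lTensor_right]
  simp only [← LinearMap.lTensor_comp_apply, stepRight]

/-- Colinearity of `Δ_A` again: coacting before comultiplying equals coacting on both factors
afterwards and multiplying in `H`. -/
theorem stepLeft_coact (f : A ⊗[K] M →ₗ[K] N) (φ : A →ₗ[K] M) :
    LinearMap.lTensor H (f ∘ₗ LinearMap.lTensor A φ ∘ₗ C.comul) ∘ₗ C.coact =
      C.stepLeft f ∘ₗ LinearMap.lTensor A (LinearMap.lTensor H φ ∘ₗ C.coact) ∘ₗ C.comul := by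
  refine LinearMap.ext fun a => ?_
  simp only [LinearMap.comp_apply, LinearMap.lTensor_comp, coact_comul_apply]
  induction C.comul a with
  | zero => simp
  | add x y hx hy => simp only [map_add, hx, hy]
  | tmul x y =>
    simp only [map_tmul, LinearMap.lTensor_tmul, stepLeft_tmul,
      Bialg.mulShuffle_lTensor_right]

theorem stepRight_coact (f : M ⊗[K] A →ₗ[K] N) (φ : A →ₗ[K] M) :
    LinearMap.lTensor H (f ∘ₗ LinearMap.rTensor A φ ∘ₗ C.comul) ∘ₗ C.coact =
      C.stepRight f ∘ₗ LinearMap.rTensor A (LinearMap.lTensor H φ ∘ₗ C.coact) ∘ₗ C.comul := by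
  refine LinearMap.ext fun a => ?_
  simp only [LinearMap.comp_apply, LinearMap.lTensor_comp, coact_comul_apply]
  induction C.comul a with
  | zero => simp
  | add x y hx hy => simp only [map_add, hx, hy]
  | tmul x y =>
    simp only [map_tmul, LinearMap.rTensor_tmul, LinearMap.comp_apply, stepRight_tmul,
      Bialg.mulShuffle_lTensor_left]

/-- The two summands are intertwined separately, so the scalar `s` is free; in the induction it is
the sign `(-1)^{q+1}`. -/
theorem coface_stepLeft {β : M →ₗ[K] H ⊗[K] M} {β' : N →ₗ[K] H ⊗[K] N} {f : A ⊗[K] M →ₗ[K] N}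
    (h : β' ∘ₗ f = C.stepLeft f ∘ₗ LinearMap.lTensor A β) (s : K) :
    (LinearMap.lTensor H β' + s • comulFirst B.comul N) ∘ₗ C.stepLeft f =
      C.stepLeft (C.stepLeft f) ∘ₗ
        LinearMap.lTensor A (LinearMap.lTensor H β + s • comulFirst B.comul M) := by
  rw [LinearMap.lTensor_add, LinearMap.lTensor_smul, LinearMap.add_comp, LinearMap.comp_add,
    LinearMap.smul_comp, LinearMap.comp_smul, comulFirst_stepLeft, C.stepLeft_natural h.symm]

theorem coface_stepRight {β : M →ₗ[K] H ⊗[K] M} {β' : N →ₗ[K] H ⊗[K] N} {f : M ⊗[K] A →ₗ[K] N}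
    (h : β' ∘ₗ f = C.stepRight f ∘ₗ LinearMap.rTensor A β) (s : K) :
    (LinearMap.lTensor H β' + s • comulFirst B.comul N) ∘ₗ C.stepRight f =
      C.stepRight (C.stepRight f) ∘ₗ
        LinearMap.rTensor A (LinearMap.lTensor H β + s • comulFirst B.comul M) := by
  rw [LinearMap.rTensor_add, LinearMap.rTensor_smul, LinearMap.add_comp, LinearMap.comp_add,
    LinearMap.smul_comp, LinearMap.comp_smul, comulFirst_stepRight, C.stepRight_natural h.symm]

end Steps
end ComoduleCoalgebra

/-! ### Alternating sums of cofaces, in recursive form -/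

section TensorPowers

variable {K : Type u} [Field K]
variable {V X Y Z : Type v} [AddCommGroup V] [Module K V] [AddCommGroup X] [Module K X]
  [AddCommGroup Y] [Module K Y] [AddCommGroup Z] [Module K Z]

theorem comp_sum {ι : Type*} (s : Finset ι) (f : ι → X →ₗ[K] Y) (g : Y →ₗ[K] Z) :
    g ∘ₗ (∑ i ∈ s, f i) = ∑ i ∈ s, g ∘ₗ f i := by
  refine LinearMap.ext fun x => ?_
  simp [LinearMap.sum_apply]

theorem sum_comp {ι : Type*} (s : Finset ι) (f : ι → Y →ₗ[K] Z) (g : X →ₗ[K] Y) :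
    (∑ i ∈ s, f i) ∘ₗ g = ∑ i ∈ s, f i ∘ₗ g := by
  refine LinearMap.ext fun x => ?_
  simp [LinearMap.sum_apply]

theorem mapLast_comp (g : Y →ₗ[K] Z) (f : X →ₗ[K] Y) :
    ∀ q, mapLast (V := V) (g ∘ₗ f) q = mapLast g q ∘ₗ mapLast f q
  | 0 => rfl
  | q + 1 => (congrArg (LinearMap.lTensor V) (mapLast_comp g f q)).trans
      (LinearMap.lTensor_comp V (mapLast g q) (mapLast f q))

theorem mapLast_add (f g : X →ₗ[K] Y) :
    ∀ q, mapLast (V := V) (f + g) q = mapLast f q + mapLast g q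
  | 0 => rfl
  | q + 1 => (congrArg (LinearMap.lTensor V) (mapLast_add f g q)).trans
      (LinearMap.lTensor_add V (mapLast f q) (mapLast g q))

theorem mapLast_smul (c : K) (f : X →ₗ[K] Y) :
    ∀ q, mapLast (V := V) (c • f) q = c • mapLast f q
  | 0 => rfl
  | q + 1 => (congrArg (LinearMap.lTensor V) (mapLast_smul c f q)).trans
      (LinearMap.lTensor_smul V c (mapLast f q))

variable (V) in
/-- `mapLast` as a linear map. -/
noncomputable def mapLastHom (q : ℕ) :
    (X →ₗ[K] Y) →ₗ[K] (tpow K V X q →ₗ[K] tpow K V Y q) where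
  toFun f := mapLast f q
  map_add' f g := mapLast_add f g q
  map_smul' c f := mapLast_smul c f q

variable (V) in
theorem mapLastHom_apply (q : ℕ) (f : X →ₗ[K] Y) : mapLastHom V q f = mapLast f q := rfl

/-- The alternating sum of the maps `powComulAt δ n i`, with signs `(-1)^{i + 1}`. -/
noncomputable def altComul (δ : V →ₗ[K] V ⊗[K] V) (n : ℕ) : tpow K V V n →ₗ[K] tpow K V V (n + 1) :=
  ∑ i : Fin (n + 1), (-1 : K) ^ ((i : ℕ) + 1) • powComulAt δ n i

theorem altComul_zero (δ : V →ₗ[K] V ⊗[K] V) : altComul δ 0 = -δ := by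
  have h : altComul δ 0 = (-1 : K) • δ := by simp [altComul, powComulAt]
  exact h.trans (neg_one_smul K δ)

/-- Position `0` is split off; the remaining positions move up by one, which reverses their signs.
-/
theorem altComul_succ (δ : V →ₗ[K] V ⊗[K] V) (n : ℕ) :
    altComul δ (n + 1) = -comulFirst δ (tpow K V V n) - LinearMap.lTensor V (altComul δ n) := by
  have h : LinearMap.lTensor V (altComul δ n) =
      ∑ i : Fin (n + 1), (-1 : K) ^ ((i : ℕ) + 1) • LinearMap.lTensor V (powComulAt δ n i) := by
    unfold altComul
    rw [← LinearMap.coe_lTensorHom, map_sum]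
    simp only [map_smul]
  rw [h, altComul, Fin.sum_univ_succ, sub_eq_add_neg, ← Finset.sum_neg_distrib]
  congr 1
  · simp only [Fin.val_zero, zero_add, pow_one]
    exact neg_one_smul K (comulFirst δ (tpow K V V n))
  · refine Finset.sum_congr rfl fun i _ => ?_
    rw [Fin.val_succ, pow_succ _ ((i : ℕ) + 1), mul_neg_one]
    exact neg_smul _ (LinearMap.lTensor V (powComulAt δ n i))

/-- Of the four terms of the product, the one with two inner maps vanishes by `h` under `lTensor`.
The rest cancel by coassociativity of `δ` and by naturality of `comulFirst`. -/
theorem altComul_comp_step (δ : V →ₗ[K] V ⊗[K] V)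
    (hδ : (TensorProduct.assoc K V V V).toLinearMap ∘ₗ LinearMap.rTensor V δ ∘ₗ δ =
      LinearMap.lTensor V δ ∘ₗ δ) (f : X →ₗ[K] V ⊗[K] X)
    (h : (-comulFirst δ X - LinearMap.lTensor V f) ∘ₗ f = 0) :
    (-comulFirst δ (V ⊗[K] X) - LinearMap.lTensor V (-comulFirst δ X - LinearMap.lTensor V f)) ∘ₗ
      (-comulFirst δ X - LinearMap.lTensor V f) = 0 := by
  refine LinearMap.ext fun t => ?_
  have h' : LinearMap.lTensor V (-comulFirst δ X - LinearMap.lTensor V f)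
      (LinearMap.lTensor V f t) = 0 := by
    rw [← LinearMap.lTensor_comp_apply, h]; simp
  rw [LinearMap.lTensor_sub, LinearMap.lTensor_neg] at h' ⊢
  simp only [LinearMap.comp_apply, LinearMap.sub_apply, LinearMap.neg_apply, map_sub, map_neg,
    LinearMap.zero_apply, comulFirst_lTensor, comulFirst_comulFirst δ hδ] at h' ⊢
  rw [← sub_eq_zero.2 h']
  abel

theorem altComul_comp_altComul (δ : V →ₗ[K] V ⊗[K] V)
    (hδ : (TensorProduct.assoc K V V V).toLinearMap ∘ₗ LinearMap.rTensor V δ ∘ₗ δ =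
      LinearMap.lTensor V δ ∘ₗ δ) : ∀ n, altComul δ (n + 1) ∘ₗ altComul δ n = 0
  | 0 => by
    have h : (-comulFirst δ V - LinearMap.lTensor V (-δ)) ∘ₗ (-δ) = 0 := by
      rw [LinearMap.lTensor_neg, LinearMap.comp_neg, LinearMap.sub_comp, LinearMap.neg_comp,
        LinearMap.neg_comp, ← hδ]
      simp [comulFirst, LinearMap.comp_assoc]
    rw [altComul_succ, altComul_zero]
    exact h
  | n + 1 => by
    have h := altComul_comp_altComul δ hδ n
    rw [altComul_succ] at h
    have := altComul_comp_step δ hδ (altComul δ n) h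
    rw [altComul_succ δ (n + 1), altComul_succ δ n]
    exact this

/-- For a map `f : X → V ⊗ X`, the alternating sum of `Id_{V^{⊗ q}} ⊗ f` and of the maps that apply
`δ` to one factor `V` of `V^{⊗ q} ⊗ X`. -/
noncomputable def altCoface (δ : V →ₗ[K] V ⊗[K] V) (f : X →ₗ[K] V ⊗[K] X) :
    (q : ℕ) → (tpow K V X q →ₗ[K] tpow K V X (q + 1))
  | 0 => f
  | q + 1 => LinearMap.lTensor V (altCoface δ f q) +
      (-1 : K) ^ (q + 1) • comulFirst δ (tpow K V X q)

/-- The cofaces are numbered from the right, hence `i.rev`. A new factor on the left therefore keeps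
all earlier signs and contributes only the sign `(-1)^{q+1}`, in contrast to `altComul_succ`. -/
theorem altCoface_eq_sum (δ : V →ₗ[K] V ⊗[K] V) (f : X →ₗ[K] V ⊗[K] X) : ∀ q, altCoface δ f q =
    coactLast f q + ∑ i : Fin q, (-1 : K) ^ ((i : ℕ) + 1) • comulAt δ q i.rev
  | 0 => by simp [altCoface, coactLast]
  | q + 1 => by
    have h : LinearMap.lTensor V (altCoface δ f q) = LinearMap.lTensor V (coactLast f q) +
        ∑ i : Fin q, (-1 : K) ^ ((i : ℕ) + 1) • LinearMap.lTensor V (comulAt δ q i.rev) := by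
      rw [altCoface_eq_sum δ f q, LinearMap.lTensor_add]
      congr 1
      rw [← LinearMap.coe_lTensorHom, map_sum]
      simp only [map_smul]
    rw [Fin.sum_univ_castSucc, ← add_assoc]
    refine congrArg₂ (· + ·) (h.trans (congrArg₂ (· + ·) rfl (Finset.sum_congr rfl fun i _ => ?_))) ?_
    · rw [Fin.rev_castSucc]
      rfl
    · rw [Fin.rev_last]
      rfl

theorem altCoface_natural_step (δ : V →ₗ[K] V ⊗[K] V) {f : X →ₗ[K] V ⊗[K] X}
    {g : Y →ₗ[K] V ⊗[K] Y} {w : X →ₗ[K] Y} (h : g ∘ₗ w = LinearMap.lTensor V w ∘ₗ f) (s : K) :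
    (LinearMap.lTensor V g + s • comulFirst δ Y) ∘ₗ LinearMap.lTensor V w =
      LinearMap.lTensor V (LinearMap.lTensor V w) ∘ₗ
        (LinearMap.lTensor V f + s • comulFirst δ X) := by
  refine LinearMap.ext fun t => ?_
  simp only [LinearMap.comp_apply, LinearMap.add_apply, LinearMap.smul_apply, map_add, map_smul,
    comulFirst_lTensor]
  rw [← LinearMap.lTensor_comp_apply, h, LinearMap.lTensor_comp_apply]

theorem altCoface_natural (δ : V →ₗ[K] V ⊗[K] V) {f : X →ₗ[K] V ⊗[K] X}
    {g : Y →ₗ[K] V ⊗[K] Y} {w : X →ₗ[K] Y} (h : g ∘ₗ w = LinearMap.lTensor V w ∘ₗ f) :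
    ∀ q, altCoface δ g q ∘ₗ mapLast w q = mapLast w (q + 1) ∘ₗ altCoface δ f q
  | 0 => h
  | q + 1 => altCoface_natural_step δ (altCoface_natural δ h q) _

/-- Same cancellation as in `altComul_comp_step`; here `s' = -s` supplies the sign that makes the
coassociativity and naturality terms cancel. -/
theorem altCoface_comp_step (δ : V →ₗ[K] V ⊗[K] V)
    (hδ : (TensorProduct.assoc K V V V).toLinearMap ∘ₗ LinearMap.rTensor V δ ∘ₗ δ =
      LinearMap.lTensor V δ ∘ₗ δ) (f : X →ₗ[K] V ⊗[K] X) (s s' : K) (hs : s' = -s)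
    (h : (LinearMap.lTensor V f + s • comulFirst δ X) ∘ₗ f = 0) :
    (LinearMap.lTensor V (LinearMap.lTensor V f + s • comulFirst δ X) +
      s' • comulFirst δ (V ⊗[K] X)) ∘ₗ (LinearMap.lTensor V f + s • comulFirst δ X) = 0 := by
  refine LinearMap.ext fun t => ?_
  have h' : LinearMap.lTensor V (LinearMap.lTensor V f + s • comulFirst δ X)
      (LinearMap.lTensor V f t) = 0 := by
    rw [← LinearMap.lTensor_comp_apply, h]; simp
  subst hs
  rw [LinearMap.lTensor_add, LinearMap.lTensor_smul] at h' ⊢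
  simp only [LinearMap.comp_apply, LinearMap.add_apply, LinearMap.smul_apply, map_add, map_smul,
    LinearMap.zero_apply, comulFirst_lTensor, comulFirst_comulFirst δ hδ, neg_smul] at h' ⊢
  rw [← h']
  module

theorem altCoface_comp_altCoface (δ : V →ₗ[K] V ⊗[K] V)
    (hδ : (TensorProduct.assoc K V V V).toLinearMap ∘ₗ LinearMap.rTensor V δ ∘ₗ δ =
      LinearMap.lTensor V δ ∘ₗ δ) (f : X →ₗ[K] V ⊗[K] X)
    (hf : LinearMap.lTensor V f ∘ₗ f = comulFirst δ X ∘ₗ f) :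
    ∀ q, altCoface δ f (q + 1) ∘ₗ altCoface δ f q = 0
  | 0 => by
    have h : (LinearMap.lTensor V f + (-1 : K) ^ (0 + 1) • comulFirst δ X) ∘ₗ f = 0 := by
      rw [LinearMap.add_comp, hf, LinearMap.smul_comp]
      module
    exact h
  | q + 1 => altCoface_comp_step δ hδ (altCoface δ f q) _ _ (by ring)
      (altCoface_comp_altCoface δ hδ f hf q)

end TensorPowers

namespace ComoduleCoalgebra

variable {K : Type u} [Field K] {H : Type v} [AddCommGroup H] [Module K H] {B : Bialg K H}
  {A : Type v} [AddCommGroup A] [Module K A] (C : ComoduleCoalgebra B A)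

/-! ### Moving `A` past `H^{⊗ q}` by iterated coaction -/

section Push

variable (X : Type v) {Y : Type v} [AddCommGroup X] [Module K X] [AddCommGroup Y] [Module K Y]

/-- Move `A` past `H^{⊗ q}` from the left; the coaction of `A` acts on `H^{⊗ q}`. -/
noncomputable def pushLeft : (q : ℕ) → (A ⊗[K] (tpow K H X q) →ₗ[K] tpow K H (A ⊗[K] X) q)
  | 0 => LinearMap.id
  | q + 1 => C.stepLeft (pushLeft q)

/-- Reassociate `(H^{⊗ q} ⊗ X) ⊗ A` while the coaction of `A` acts on `H^{⊗ q}` from the right. -/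
noncomputable def pushRight : (q : ℕ) → ((tpow K H X q) ⊗[K] A →ₗ[K] tpow K H (X ⊗[K] A) q)
  | 0 => LinearMap.id
  | q + 1 => C.stepRight (pushRight q)

variable {X}

theorem pushLeft_natural (f : X →ₗ[K] Y) : ∀ q,
    C.pushLeft Y q ∘ₗ LinearMap.lTensor A (mapLast f q) =
      mapLast (LinearMap.lTensor A f) q ∘ₗ C.pushLeft X q
  | 0 => rfl
  | q + 1 => C.stepLeft_natural (pushLeft_natural f q)

theorem pushRight_natural (f : X →ₗ[K] Y) : ∀ q,
    C.pushRight Y q ∘ₗ LinearMap.rTensor A (mapLast f q) =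
      mapLast (LinearMap.rTensor A f) q ∘ₗ C.pushRight X q
  | 0 => rfl
  | q + 1 => C.stepRight_natural (pushRight_natural f q)

variable (X)

theorem pushLeft_comulFirst : ∀ q,
    C.pushLeft (A ⊗[K] X) q ∘ₗ LinearMap.lTensor A (C.pushLeft X q) ∘ₗ
      comulFirst C.comul (tpow K H X q) = mapLast (comulFirst C.comul X) q ∘ₗ C.pushLeft X q
  | 0 => by
    change LinearMap.id ∘ₗ LinearMap.lTensor A (LinearMap.id : A ⊗[K] X →ₗ[K] A ⊗[K] X) ∘ₗ
      comulFirst C.comul X = comulFirst C.comul X ∘ₗ LinearMap.id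
    rw [LinearMap.lTensor_id]
    rfl
  | q + 1 => C.stepLeft_comulFirst (pushLeft_comulFirst q)

theorem pushRight_comulLast : ∀ q,
    C.pushRight (X ⊗[K] A) q ∘ₗ LinearMap.rTensor A (C.pushRight X q) ∘ₗ
      C.comulLast (tpow K H X q) = mapLast (C.comulLast X) q ∘ₗ C.pushRight X q
  | 0 => by
    change LinearMap.id ∘ₗ LinearMap.rTensor A (LinearMap.id : X ⊗[K] A →ₗ[K] X ⊗[K] A) ∘ₗ
      C.comulLast X = C.comulLast X ∘ₗ LinearMap.id
    rw [LinearMap.rTensor_id]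
    rfl
  | q + 1 => C.stepRight_comulLast (pushRight_comulLast q)

theorem pushRight_pushLeft : ∀ q,
    C.pushRight (A ⊗[K] X) q ∘ₗ LinearMap.rTensor A (C.pushLeft X q) =
      mapLast (TensorProduct.assoc K A X A).symm.toLinearMap q ∘ₗ C.pushLeft (X ⊗[K] A) q ∘ₗ
        LinearMap.lTensor A (C.pushRight X q) ∘ₗ
          (TensorProduct.assoc K A (tpow K H X q) A).toLinearMap
  | 0 => by
    change LinearMap.id ∘ₗ LinearMap.rTensor A (LinearMap.id : A ⊗[K] X →ₗ[K] A ⊗[K] X) =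
      (TensorProduct.assoc K A X A).symm.toLinearMap ∘ₗ LinearMap.id ∘ₗ
        LinearMap.lTensor A (LinearMap.id : X ⊗[K] A →ₗ[K] X ⊗[K] A) ∘ₗ
          (TensorProduct.assoc K A X A).toLinearMap
    refine LinearMap.ext fun t => ?_
    simp
  | q + 1 => C.stepRight_stepLeft (pushRight_pushLeft q)

variable {X}

/-- The coaction used on `A ⊗ X` is the diagonal one built from `ρ` and `f`. This is the source of
the commutation of the first horizontal face with all vertical cofaces but the last. -/
theorem altCoface_pushLeft (f : X →ₗ[K] H ⊗[K] X) : ∀ q,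
    altCoface B.comul (B.mulShuffle A X ∘ₗ TensorProduct.map C.coact f) q ∘ₗ C.pushLeft X q =
      C.pushLeft X (q + 1) ∘ₗ LinearMap.lTensor A (altCoface B.comul f q)
  | 0 => by
    change (B.mulShuffle A X ∘ₗ TensorProduct.map C.coact f) ∘ₗ LinearMap.id =
      C.stepLeft (LinearMap.id : A ⊗[K] X →ₗ[K] A ⊗[K] X) ∘ₗ LinearMap.lTensor A f
    refine TensorProduct.ext' fun a x => ?_
    simp [stepLeft_tmul]
  | q + 1 => C.coface_stepLeft (altCoface_pushLeft f q) _

theorem altCoface_pushRight (f : X →ₗ[K] H ⊗[K] X) : ∀ q,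
    altCoface B.comul (B.mulShuffle X A ∘ₗ TensorProduct.map f C.coact) q ∘ₗ C.pushRight X q =
      C.pushRight X (q + 1) ∘ₗ LinearMap.rTensor A (altCoface B.comul f q)
  | 0 => by
    change (B.mulShuffle X A ∘ₗ TensorProduct.map f C.coact) ∘ₗ LinearMap.id =
      C.stepRight (LinearMap.id : X ⊗[K] A →ₗ[K] X ⊗[K] A) ∘ₗ LinearMap.rTensor A f
    refine TensorProduct.ext' fun a x => ?_
    simp [stepRight_tmul]
  | q + 1 => C.coface_stepRight (altCoface_pushRight f q) _

end Push

/-! ### Agreement with the diagonal actions of `H` on `H^{⊗ q}` -/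

section Agreement

variable {M N : Type v} [AddCommGroup M] [Module K M] [AddCommGroup N] [Module K N]

/-- The diagonal action applies `Δ_H` to the `H`-part of `ρ(a)`, while `stepLeft` coacts a second
time; `(Δ_H ⊗ Id) ρ = (Id ⊗ ρ) ρ` exchanges the two for one factor `H`. -/
theorem actLeft_step (act : H ⊗[K] N →ₗ[K] N) (move : A ⊗[K] M →ₗ[K] N) (f : A ⊗[K] M →ₗ[K] N)
    (h : (act ∘ₗ LinearMap.lTensor H move ∘ₗ (TensorProduct.assoc K H A M).toLinearMap) ∘ₗ
      LinearMap.rTensor M C.coact = f) :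
    ((TensorProduct.map B.mul act ∘ₗ (TensorProduct.tensorTensorTensorComm K H H H N).toLinearMap ∘ₗ
      LinearMap.rTensor (H ⊗[K] N) B.comul) ∘ₗ
      LinearMap.lTensor H (LinearMap.lTensor H move ∘ₗ
        (TensorProduct.leftComm K A H M).toLinearMap) ∘ₗ
      (TensorProduct.assoc K H A (H ⊗[K] M)).toLinearMap) ∘ₗ
      LinearMap.rTensor (H ⊗[K] M) C.coact = C.stepLeft f := by
  -- With an arbitrary `s` in place of `ρ(a)` the claim is pure reshuffling; coassociativity of `ρ`
  -- enters only at `s = ρ(a)`.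
  have key : ∀ (s : H ⊗[K] A) (t : H ⊗[K] M),
      (TensorProduct.map B.mul act ∘ₗ
        (TensorProduct.tensorTensorTensorComm K H H H N).toLinearMap ∘ₗ
        LinearMap.rTensor (H ⊗[K] N) B.comul) (LinearMap.lTensor H (LinearMap.lTensor H move ∘ₗ
        (TensorProduct.leftComm K A H M).toLinearMap)
          (TensorProduct.assoc K H A (H ⊗[K] M) (s ⊗ₜ t))) =
      LinearMap.lTensor H (act ∘ₗ LinearMap.lTensor H move ∘ₗ
        (TensorProduct.assoc K H A M).toLinearMap)
        (B.mulShuffle (H ⊗[K] A) M (comulFirst B.comul A s ⊗ₜ t)) := by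
    intro s t
    induction s with
    | zero => simp
    | add x y hx hy => simp only [map_add, add_tmul, hx, hy]
    | tmul x a =>
      induction t with
      | zero => simp
      | add x y hx hy => simp only [map_add, tmul_add, hx, hy]
      | tmul y m =>
        simp only [assoc_tmul, LinearMap.lTensor_tmul, LinearMap.comp_apply, LinearEquiv.coe_coe,
          leftComm_tmul, LinearMap.rTensor_tmul, comulFirst_tmul]
        induction B.comul x with
        | zero => simp
        | add x y hx hy => simp only [map_add, add_tmul, hx, hy]
        | tmul x₁ x₂ => simp [Bialg.mulShuffle_tmul]
  refine TensorProduct.ext' fun a t => ?_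
  refine (key (C.coact a) t).trans ?_
  rw [stepLeft_tmul, ← h, ← coact_coassoc_apply, Bialg.mulShuffle_lTensor_left,
    LinearMap.lTensor_comp_apply _ _ (LinearMap.rTensor M C.coact)]

theorem actRight_step (act : N ⊗[K] H →ₗ[K] N) (move : M ⊗[K] A →ₗ[K] N) (f : M ⊗[K] A →ₗ[K] N)
    (h : (act ∘ₗ LinearMap.rTensor H move ∘ₗ (TensorProduct.assoc K M A H).symm.toLinearMap ∘ₗ
      LinearMap.lTensor M (TensorProduct.comm K H A).toLinearMap) ∘ₗ
      LinearMap.lTensor M C.coact = f) :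
    ((TensorProduct.map B.mul act ∘ₗ (TensorProduct.tensorTensorTensorComm K H N H H).toLinearMap ∘ₗ
      LinearMap.lTensor (H ⊗[K] N) B.comul) ∘ₗ
      LinearMap.rTensor H (LinearMap.lTensor H move ∘ₗ
        (TensorProduct.assoc K H M A).toLinearMap) ∘ₗ
      (TensorProduct.assoc K (H ⊗[K] M) A H).symm.toLinearMap ∘ₗ
      LinearMap.lTensor (H ⊗[K] M) (TensorProduct.comm K H A).toLinearMap) ∘ₗ
      LinearMap.lTensor (H ⊗[K] M) C.coact = C.stepRight f := by
  have key : ∀ (s : H ⊗[K] A) (t : H ⊗[K] M),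
      (TensorProduct.map B.mul act ∘ₗ
        (TensorProduct.tensorTensorTensorComm K H N H H).toLinearMap ∘ₗ
        LinearMap.lTensor (H ⊗[K] N) B.comul) (LinearMap.rTensor H (LinearMap.lTensor H move ∘ₗ
        (TensorProduct.assoc K H M A).toLinearMap)
          ((TensorProduct.assoc K (H ⊗[K] M) A H).symm
            (LinearMap.lTensor (H ⊗[K] M) (TensorProduct.comm K H A).toLinearMap (t ⊗ₜ s)))) =
      LinearMap.lTensor H (act ∘ₗ LinearMap.rTensor H move ∘ₗ
        (TensorProduct.assoc K M A H).symm.toLinearMap ∘ₗ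
          LinearMap.lTensor M (TensorProduct.comm K H A).toLinearMap)
        (B.mulShuffle M (H ⊗[K] A) (t ⊗ₜ comulFirst B.comul A s)) := by
    intro s t
    induction s with
    | zero => simp
    | add x y hx hy => simp only [map_add, tmul_add, hx, hy]
    | tmul x a =>
      induction t with
      | zero => simp
      | add x y hx hy => simp only [map_add, add_tmul, hx, hy]
      | tmul y m =>
        simp only [assoc_symm_tmul, assoc_tmul, LinearMap.lTensor_tmul, LinearMap.comp_apply,
          LinearEquiv.coe_coe, comm_tmul, LinearMap.rTensor_tmul, comulFirst_tmul]
        induction B.comul x with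
        | zero => simp
        | add x y hx hy => simp only [map_add, tmul_add, add_tmul, hx, hy]
        | tmul x₁ x₂ => simp [Bialg.mulShuffle_tmul]
  refine TensorProduct.ext' fun t a => ?_
  refine (key (C.coact a) t).trans ?_
  rw [stepRight_tmul, ← h, ← coact_coassoc_apply, Bialg.mulShuffle_lTensor_right,
    LinearMap.lTensor_comp_apply _ _ (LinearMap.lTensor M C.coact)]

variable (X : Type v) {Y : Type v} [AddCommGroup X] [Module K X] [AddCommGroup Y] [Module K Y]

theorem actLeft_moveRight : ∀ q,
    (B.actLeft (A ⊗[K] X) q ∘ₗ LinearMap.lTensor H (moveRight K H X A (q + 1)) ∘ₗ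
      (TensorProduct.assoc K H A (tpow K H X (q + 1))).toLinearMap) ∘ₗ
      LinearMap.rTensor (tpow K H X (q + 1)) C.coact = C.pushLeft X (q + 1)
  | 0 => by
    change ((LinearMap.rTensor (A ⊗[K] X) B.mul ∘ₗ
      (TensorProduct.assoc K H H (A ⊗[K] X)).symm.toLinearMap) ∘ₗ
      LinearMap.lTensor H (LinearMap.lTensor H (LinearMap.id : A ⊗[K] X →ₗ[K] A ⊗[K] X) ∘ₗ
      (TensorProduct.leftComm K A H X).toLinearMap) ∘ₗ
      (TensorProduct.assoc K H A (H ⊗[K] X)).toLinearMap) ∘ₗ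
      LinearMap.rTensor (H ⊗[K] X) C.coact =
      C.stepLeft (LinearMap.id : A ⊗[K] X →ₗ[K] A ⊗[K] X)
    refine TensorProduct.ext_threefold' fun a h x => ?_
    simp only [LinearMap.comp_apply, LinearMap.rTensor_tmul, stepLeft_tmul, LinearMap.lTensor_id,
      LinearMap.id_apply]
    induction C.coact a with
    | zero => simp
    | add x y hx hy => simp only [map_add, add_tmul, hx, hy]
    | tmul k b => simp [Bialg.mulShuffle_tmul]
  | q + 1 => C.actLeft_step _ _ _ (actLeft_moveRight q)

variable {X}

theorem actRight_assocRight (g : X ⊗[K] A →ₗ[K] Y) : ∀ q,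
    (B.actRight Y q ∘ₗ LinearMap.rTensor H (mapLast g (q + 1) ∘ₗ assocRight K H X A (q + 1)) ∘ₗ
      (TensorProduct.assoc K (tpow K H X (q + 1)) A H).symm.toLinearMap ∘ₗ
      LinearMap.lTensor (tpow K H X (q + 1)) (TensorProduct.comm K H A).toLinearMap) ∘ₗ
      LinearMap.lTensor (tpow K H X (q + 1)) C.coact =
        mapLast g (q + 1) ∘ₗ C.pushRight X (q + 1)
  | 0 => by
    change ((LinearMap.rTensor Y B.mul ∘ₗ (TensorProduct.rightComm K H Y H).toLinearMap) ∘ₗ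
      LinearMap.rTensor H (LinearMap.lTensor H g ∘ₗ
        LinearMap.lTensor H (LinearMap.id : X ⊗[K] A →ₗ[K] X ⊗[K] A) ∘ₗ
          (TensorProduct.assoc K H X A).toLinearMap) ∘ₗ
      (TensorProduct.assoc K (H ⊗[K] X) A H).symm.toLinearMap ∘ₗ
      LinearMap.lTensor (H ⊗[K] X) (TensorProduct.comm K H A).toLinearMap) ∘ₗ
      LinearMap.lTensor (H ⊗[K] X) C.coact =
      LinearMap.lTensor H g ∘ₗ C.stepRight (LinearMap.id : X ⊗[K] A →ₗ[K] X ⊗[K] A)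
    refine TensorProduct.ext_threefold fun h x a => ?_
    simp only [LinearMap.comp_apply, LinearMap.lTensor_tmul, stepRight_tmul, LinearMap.lTensor_id,
      LinearMap.id_apply]
    induction C.coact a with
    | zero => simp
    | add x y hx hy => simp only [map_add, tmul_add, hx, hy]
    | tmul k b => simp [Bialg.mulShuffle_tmul]
  | q + 1 => by
    have h := C.actRight_step _ _ _ (actRight_assocRight g q)
    rw [LinearMap.lTensor_comp, LinearMap.comp_assoc] at h
    refine h.trans ?_
    change C.stepRight _ = LinearMap.lTensor H (mapLast g (q + 1)) ∘ₗ
      C.stepRight (C.pushRight X (q + 1))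
    rw [stepRight, stepRight, LinearMap.lTensor_comp, LinearMap.comp_assoc]

end Agreement
end ComoduleCoalgebra

/-! ### Rebracketing identities -/

section Snoc

variable {K : Type u} [Field K]
variable {V X Y Y' : Type v} [AddCommGroup V] [Module K V] [AddCommGroup X] [Module K X]
  [AddCommGroup Y] [Module K Y] [AddCommGroup Y'] [Module K Y']

theorem comulFirst_assoc (δ : V →ₗ[K] V ⊗[K] V) (t : (V ⊗[K] X) ⊗[K] Y) :
    comulFirst δ (X ⊗[K] Y) (TensorProduct.assoc K V X Y t) =
      LinearMap.lTensor V (TensorProduct.assoc K V X Y).toLinearMap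
        (TensorProduct.assoc K V (V ⊗[K] X) Y (LinearMap.rTensor Y (comulFirst δ X) t)) := by
  induction t with
  | zero => simp
  | add a b ha hb => simp only [map_add, ha, hb]
  | tmul t y =>
    induction t with
    | zero => simp
    | add a b ha hb => simp only [map_add, add_tmul, ha, hb]
    | tmul v x =>
      simp only [assoc_tmul, LinearMap.rTensor_tmul, comulFirst_tmul]
      induction δ v with
      | zero => simp
      | add a b ha hb => simp only [map_add, add_tmul, ha, hb]
      | tmul a b => simp

theorem lTensor_rTensor_assoc (f : X →ₗ[K] Y') (t : (V ⊗[K] X) ⊗[K] Y) :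
    LinearMap.lTensor V (LinearMap.rTensor Y f) (TensorProduct.assoc K V X Y t) =
      TensorProduct.assoc K V Y' Y (LinearMap.rTensor Y (LinearMap.lTensor V f) t) := by
  induction t with
  | zero => simp
  | add a b ha hb => simp only [map_add, ha, hb]
  | tmul t y =>
    induction t with
    | zero => simp
    | add a b ha hb => simp only [map_add, add_tmul, ha, hb]
    | tmul v x => simp

end Snoc

namespace ComoduleCoalgebra

variable {K : Type u} [Field K] {H : Type v} [AddCommGroup H] [Module K H] {B : Bialg K H}
  {A : Type v} [AddCommGroup A] [Module K A] (C : ComoduleCoalgebra B A)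

/-! ### `A^{⊗ p}` as an `H`-comodule, and maps between tensor powers -/

section Comodules

variable {X Y : Type v} [AddCommGroup X] [Module K X] [AddCommGroup Y] [Module K Y]

/-- A tensor product of comodules is a comodule because `Δ_H` is multiplicative. -/
theorem coassoc_step {f : X →ₗ[K] H ⊗[K] X}
    (h : LinearMap.lTensor H f ∘ₗ f = comulFirst B.comul X ∘ₗ f) :
    LinearMap.lTensor H (B.mulShuffle A X ∘ₗ TensorProduct.map C.coact f) ∘ₗ
      B.mulShuffle A X ∘ₗ TensorProduct.map C.coact f =
      comulFirst B.comul (A ⊗[K] X) ∘ₗ B.mulShuffle A X ∘ₗ TensorProduct.map C.coact f := by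
  refine TensorProduct.ext' fun a x => ?_
  have hx : LinearMap.lTensor H f (f x) = comulFirst B.comul X (f x) := LinearMap.congr_fun h x
  simp only [LinearMap.comp_apply, map_tmul, LinearMap.lTensor_comp, ← Bialg.mulShuffle_lTensor,
    Bialg.comulFirst_mulShuffle, hx, coact_coassoc_apply]

theorem coactPow_coassoc : ∀ n, LinearMap.lTensor H (C.coactPow n) ∘ₗ C.coactPow n =
    comulFirst B.comul (tpow K A A n) ∘ₗ C.coactPow n
  | 0 => C.coact_coassoc
  | n + 1 => C.coassoc_step (coactPow_coassoc n)

theorem comulFirst_coact (f : X →ₗ[K] H ⊗[K] X) :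
    (B.mulShuffle A (A ⊗[K] X) ∘ₗ
      TensorProduct.map C.coact (B.mulShuffle A X ∘ₗ TensorProduct.map C.coact f)) ∘ₗ
      comulFirst C.comul X =
      LinearMap.lTensor H (comulFirst C.comul X) ∘ₗ B.mulShuffle A X ∘ₗ
        TensorProduct.map C.coact f := by
  refine TensorProduct.ext' fun a x => ?_
  simp only [LinearMap.comp_apply, map_tmul]
  rw [comulFirst_eq_comp C.comul X, LinearMap.lTensor_comp_apply, ← Bialg.mulShuffle_lTensor_left,
    coact_comul_apply, ← comulFirst_eq_comp, comulFirst_tmul]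
  induction C.comul a with
  | zero => simp
  | add x y hx hy => simp only [map_add, add_tmul, hx, hy]
  | tmul x y => simp only [assoc_tmul, LinearMap.comp_apply, map_tmul, Bialg.mulShuffle_assoc]

theorem lTensor_coact {f : X →ₗ[K] H ⊗[K] X} {g : Y →ₗ[K] H ⊗[K] Y} {w : X →ₗ[K] Y}
    (h : g ∘ₗ w = LinearMap.lTensor H w ∘ₗ f) :
    (B.mulShuffle A Y ∘ₗ TensorProduct.map C.coact g) ∘ₗ LinearMap.lTensor A w =
      LinearMap.lTensor H (LinearMap.lTensor A w) ∘ₗ B.mulShuffle A X ∘ₗ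
        TensorProduct.map C.coact f := by
  refine TensorProduct.ext' fun a x => ?_
  have hx : g (w x) = LinearMap.lTensor H w (f x) := LinearMap.congr_fun h x
  simp only [LinearMap.comp_apply, map_tmul, LinearMap.lTensor_tmul, hx,
    Bialg.mulShuffle_lTensor_right]

theorem altComul_coact_step {f : X →ₗ[K] H ⊗[K] X} {w : X →ₗ[K] A ⊗[K] X}
    (h : (B.mulShuffle A X ∘ₗ TensorProduct.map C.coact f) ∘ₗ w = LinearMap.lTensor H w ∘ₗ f) :
    (B.mulShuffle A (A ⊗[K] X) ∘ₗ
      TensorProduct.map C.coact (B.mulShuffle A X ∘ₗ TensorProduct.map C.coact f)) ∘ₗ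
      (-comulFirst C.comul X - LinearMap.lTensor A w) =
      LinearMap.lTensor H (-comulFirst C.comul X - LinearMap.lTensor A w) ∘ₗ B.mulShuffle A X ∘ₗ
        TensorProduct.map C.coact f := by
  rw [LinearMap.comp_sub, LinearMap.comp_neg, comulFirst_coact, C.lTensor_coact h,
    LinearMap.lTensor_sub, LinearMap.lTensor_neg, LinearMap.sub_comp, LinearMap.neg_comp]

theorem coactPow_altComul : ∀ n, C.coactPow (n + 1) ∘ₗ altComul C.comul n =
    LinearMap.lTensor H (altComul C.comul n) ∘ₗ C.coactPow n
  | 0 => by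
    have h : (B.mulShuffle A A ∘ₗ TensorProduct.map C.coact C.coact) ∘ₗ (-C.comul) =
        LinearMap.lTensor H (-C.comul) ∘ₗ C.coact := by
      rw [LinearMap.lTensor_neg, LinearMap.neg_comp, coact_comul, LinearMap.comp_neg,
        LinearMap.comp_assoc]
    rw [altComul_zero]
    exact h
  | n + 1 => by
    have h := C.altComul_coact_step (coactPow_altComul n)
    rw [altComul_succ]
    exact h

/-- The recursion for `coactPow` attaches factors on the left, `snoc` on the right; the two orders
of multiplying in `H` agree by associativity. -/
theorem snoc_coact_step {f : X →ₗ[K] H ⊗[K] X} {g : Y →ₗ[K] H ⊗[K] Y} {σ : X ⊗[K] A →ₗ[K] Y}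
    (h : g ∘ₗ σ = LinearMap.lTensor H σ ∘ₗ B.mulShuffle X A ∘ₗ TensorProduct.map f C.coact) :
    (B.mulShuffle A Y ∘ₗ TensorProduct.map C.coact g) ∘ₗ LinearMap.lTensor A σ ∘ₗ
        (TensorProduct.assoc K A X A).toLinearMap =
      LinearMap.lTensor H (LinearMap.lTensor A σ ∘ₗ (TensorProduct.assoc K A X A).toLinearMap) ∘ₗ
        B.mulShuffle (A ⊗[K] X) A ∘ₗ
          TensorProduct.map (B.mulShuffle A X ∘ₗ TensorProduct.map C.coact f) C.coact := by
  refine TensorProduct.ext_threefold fun a x a' => ?_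
  have hx : g (σ (x ⊗ₜ a')) = LinearMap.lTensor H σ (B.mulShuffle X A (f x ⊗ₜ C.coact a')) :=
    LinearMap.congr_fun h (x ⊗ₜ a')
  simp only [LinearMap.comp_apply, map_tmul, LinearMap.lTensor_tmul, LinearMap.lTensor_comp, hx,
    Bialg.mulShuffle_lTensor_right, Bialg.mulShuffle_assoc, LinearEquiv.coe_coe, assoc_tmul]

theorem coactPow_snoc : ∀ n, C.coactPow (n + 1) ∘ₗ snoc K A n =
    LinearMap.lTensor H (snoc K A n) ∘ₗ B.mulShuffle (tpow K A A n) A ∘ₗ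
      TensorProduct.map (C.coactPow n) C.coact
  | 0 => by
    change (B.mulShuffle A A ∘ₗ TensorProduct.map C.coact C.coact) ∘ₗ LinearMap.id =
      LinearMap.lTensor H (LinearMap.id : A ⊗[K] A →ₗ[K] A ⊗[K] A) ∘ₗ B.mulShuffle A A ∘ₗ
        TensorProduct.map C.coact C.coact
    rw [LinearMap.lTensor_id]
    rfl
  | n + 1 => C.snoc_coact_step (coactPow_snoc n)

theorem lTensor_comulLast_assoc (t : (A ⊗[K] X) ⊗[K] A) :
    LinearMap.lTensor A (C.comulLast X) (TensorProduct.assoc K A X A t) =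
      TensorProduct.assoc K A (X ⊗[K] A) A
        (LinearMap.rTensor A (TensorProduct.assoc K A X A).toLinearMap
          (C.comulLast (A ⊗[K] X) t)) := by
  induction t with
  | zero => simp
  | add a b ha hb => simp only [map_add, ha, hb]
  | tmul t y =>
    induction t with
    | zero => simp
    | add a b ha hb => simp only [map_add, add_tmul, ha, hb]
    | tmul v x =>
      simp only [assoc_tmul, LinearMap.lTensor_tmul, comulLast_tmul]
      induction C.comul y with
      | zero => simp
      | add a b ha hb => simp only [map_add, tmul_add, ha, hb]
      | tmul a b => simp

/-- The inner sums grow on the left whereas `snoc` adds the last factor. In the induction `σ` and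
`τ` are instances of `snoc`, and the term with `comulLast` is the summand at the last position; its
sign flips each time a factor is added on the left. -/
theorem altComul_snoc_step {δX : X →ₗ[K] A ⊗[K] X} {σ : X ⊗[K] A →ₗ[K] Y}
    {τ : X ⊗[K] A →ₗ[K] A ⊗[K] X} {δY : Y →ₗ[K] A ⊗[K] Y} {s s' : K} (hs : s' = -s)
    (h : δY ∘ₗ σ = (LinearMap.lTensor A σ ∘ₗ (TensorProduct.assoc K A X A).toLinearMap) ∘ₗ
      (LinearMap.rTensor A δX + s • (LinearMap.rTensor A τ ∘ₗ C.comulLast X))) :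
    (-comulFirst C.comul Y - LinearMap.lTensor A δY) ∘ₗ LinearMap.lTensor A σ ∘ₗ
        (TensorProduct.assoc K A X A).toLinearMap =
      (LinearMap.lTensor A (LinearMap.lTensor A σ ∘ₗ (TensorProduct.assoc K A X A).toLinearMap) ∘ₗ
        (TensorProduct.assoc K A (A ⊗[K] X) A).toLinearMap) ∘ₗ
      (LinearMap.rTensor A (-comulFirst C.comul X - LinearMap.lTensor A δX) +
        s' • (LinearMap.rTensor A (LinearMap.lTensor A τ ∘ₗ
          (TensorProduct.assoc K A X A).toLinearMap) ∘ₗ C.comulLast (A ⊗[K] X))) := by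
  subst hs
  refine LinearMap.ext fun t => ?_
  have h' : LinearMap.lTensor A δY (LinearMap.lTensor A σ (TensorProduct.assoc K A X A t)) =
      LinearMap.lTensor A (LinearMap.lTensor A σ ∘ₗ (TensorProduct.assoc K A X A).toLinearMap)
        (TensorProduct.assoc K A (A ⊗[K] X) A (LinearMap.rTensor A (LinearMap.lTensor A δX) t +
          s • LinearMap.rTensor A (LinearMap.lTensor A τ ∘ₗ
          (TensorProduct.assoc K A X A).toLinearMap) (C.comulLast (A ⊗[K] X) t))) := by
    rw [← LinearMap.lTensor_comp_apply, h, LinearMap.lTensor_comp_apply]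
    congr 1
    rw [LinearMap.lTensor_add, LinearMap.lTensor_smul, map_add, map_smul, LinearMap.add_apply,
      LinearMap.smul_apply, lTensor_rTensor_assoc, LinearMap.rTensor_comp_apply,
      LinearMap.lTensor_comp_apply, lTensor_comulLast_assoc, lTensor_rTensor_assoc]
  simp only [LinearMap.comp_apply, LinearMap.sub_apply, LinearMap.neg_apply, LinearMap.add_apply,
    LinearMap.rTensor_sub, LinearMap.rTensor_neg, LinearEquiv.coe_coe, h', comulFirst_lTensor,
    comulFirst_assoc, LinearMap.smul_apply, map_add, map_sub, map_neg, map_smul,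
    LinearMap.lTensor_comp]
  module

/-- Of the `n + 2` positions the first `n + 1` belong to `A^{⊗ (n + 1)}`, and the last one, with
sign `(-1)^{n+2} = (-1)^n`, to the appended factor. -/
theorem altComul_snoc : ∀ n, altComul C.comul (n + 1) ∘ₗ snoc K A n =
    snoc K A (n + 1) ∘ₗ (LinearMap.rTensor A (altComul C.comul n) +
      (-1 : K) ^ n • (LinearMap.rTensor A (snoc K A n) ∘ₗ C.comulLast (tpow K A A n)))
  | 0 => by
    have h : (-comulFirst C.comul A - LinearMap.lTensor A (-C.comul)) ∘ₗ LinearMap.id =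
        (LinearMap.lTensor A LinearMap.id ∘ₗ (TensorProduct.assoc K A A A).toLinearMap) ∘ₗ
          (LinearMap.rTensor A (-C.comul) + (-1 : K) ^ 0 • (LinearMap.rTensor A LinearMap.id ∘ₗ
            C.comulLast A)) := by
      refine LinearMap.ext fun t => ?_
      simp [comulFirst, comulLast]
    rw [altComul_succ, altComul_zero]
    exact h
  | n + 1 => by
    have h := C.altComul_snoc_step (s' := (-1 : K) ^ (n + 1)) (by ring) (altComul_snoc n)
    rw [altComul_succ C.comul (n + 1), altComul_succ C.comul n]
    rw [altComul_succ C.comul n] at h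
    exact h

end Comodules

end ComoduleCoalgebra

namespace ComoduleCoalgebra

variable {K : Type u} [Field K] {H : Type v} [AddCommGroup H] [Module K H] {B : Bialg K H}
  {A : Type v} [AddCommGroup A] [Module K A] (C : ComoduleCoalgebra B A)

/-! ### Cosimplicial relations between the faces -/

section Faces

variable {M N L : Type v} [AddCommGroup M] [Module K M] [AddCommGroup N] [Module K N]
  [AddCommGroup L] [Module K L]

/-- Coassociativity of `Δ_A` moves the second comultiplication off the argument of `φ`. Together
with its two variants below, this reduces relations between iterated faces to identities of the push
maps. -/
theorem comp_lTensor_lTensor_comul (f : A ⊗[K] M →ₗ[K] N) (g : A ⊗[K] N →ₗ[K] L) (φ : A →ₗ[K] M) :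
    g ∘ₗ LinearMap.lTensor A (f ∘ₗ LinearMap.lTensor A φ ∘ₗ C.comul) ∘ₗ C.comul =
      (g ∘ₗ LinearMap.lTensor A f ∘ₗ comulFirst C.comul M) ∘ₗ LinearMap.lTensor A φ ∘ₗ C.comul := by
  have h : comulFirst C.comul A ∘ₗ C.comul = LinearMap.lTensor A C.comul ∘ₗ C.comul :=
    C.comul_coassoc
  refine LinearMap.ext fun a => ?_
  have ha := LinearMap.congr_fun h a
  simp only [LinearMap.comp_apply, LinearMap.lTensor_comp, comulFirst_lTensor] at ha ⊢
  rw [ha]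

theorem comulLast_rTensor (f : M →ₗ[K] N) (t : M ⊗[K] A) :
    C.comulLast N (LinearMap.rTensor A f t) =
      LinearMap.rTensor A (LinearMap.rTensor A f) (C.comulLast M t) := by
  induction t with
  | zero => simp
  | add a b ha hb => simp only [map_add, ha, hb]
  | tmul m a =>
    simp only [LinearMap.rTensor_tmul, comulLast_tmul]
    induction C.comul a with
    | zero => simp
    | add a b ha hb => simp only [map_add, tmul_add, ha, hb]
    | tmul a b => simp

theorem comp_rTensor_rTensor_comul (f : M ⊗[K] A →ₗ[K] N) (g : N ⊗[K] A →ₗ[K] L) (φ : A →ₗ[K] M) :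
    g ∘ₗ LinearMap.rTensor A (f ∘ₗ LinearMap.rTensor A φ ∘ₗ C.comul) ∘ₗ C.comul =
      (g ∘ₗ LinearMap.rTensor A f ∘ₗ C.comulLast M) ∘ₗ LinearMap.rTensor A φ ∘ₗ C.comul := by
  refine LinearMap.ext fun a => ?_
  have ha : C.comulLast A (C.comul a) = LinearMap.rTensor A C.comul (C.comul a) :=
    (LinearEquiv.symm_apply_eq _).2 (LinearMap.congr_fun C.comul_coassoc a).symm
  simp only [LinearMap.comp_apply, LinearMap.rTensor_comp, comulLast_rTensor, ha]

theorem comp_rTensor_lTensor_comul (f : A ⊗[K] M →ₗ[K] N) (g : N ⊗[K] A →ₗ[K] L) (φ : A →ₗ[K] M) :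
    g ∘ₗ LinearMap.rTensor A (f ∘ₗ LinearMap.lTensor A φ ∘ₗ C.comul) ∘ₗ C.comul =
      (g ∘ₗ LinearMap.rTensor A f ∘ₗ (TensorProduct.assoc K A M A).symm.toLinearMap) ∘ₗ
        LinearMap.lTensor A (LinearMap.rTensor A φ ∘ₗ C.comul) ∘ₗ C.comul := by
  refine LinearMap.ext fun a => ?_
  have ha : TensorProduct.assoc K A A A (LinearMap.rTensor A C.comul (C.comul a)) =
    LinearMap.lTensor A C.comul (C.comul a) := LinearMap.congr_fun C.comul_coassoc a
  simp only [LinearMap.comp_apply, LinearMap.rTensor_comp, LinearMap.lTensor_comp, ← ha,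
    lTensor_rTensor_assoc, LinearEquiv.coe_coe, LinearEquiv.symm_apply_apply]

variable (X : Type v) {Y : Type v} [AddCommGroup X] [Module K X] [AddCommGroup Y] [Module K Y]

/-- The first coface `(A ⊗ φ) ∘ Δ_A`, where the coaction of `A` acts on `H^{⊗ q}`. -/
noncomputable def faceLeft (q : ℕ) (φ : A →ₗ[K] tpow K H X q) : A →ₗ[K] tpow K H (A ⊗[K] X) q :=
  C.pushLeft X q ∘ₗ LinearMap.lTensor A φ ∘ₗ C.comul

/-- The last coface `(φ ⊗ A) ∘ Δ_A`, where the coaction of `A` acts on `H^{⊗ q}`. -/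
noncomputable def faceRight (q : ℕ) (φ : A →ₗ[K] tpow K H X q) : A →ₗ[K] tpow K H (X ⊗[K] A) q :=
  C.pushRight X q ∘ₗ LinearMap.rTensor A φ ∘ₗ C.comul

/-- The last coface `(H ⊗ φ) ∘ ρ` in the vertical direction. -/
noncomputable def faceCoact (q : ℕ) (φ : A →ₗ[K] tpow K H X q) : A →ₗ[K] tpow K H X (q + 1) :=
  LinearMap.lTensor H φ ∘ₗ C.coact

variable {X}
variable (q : ℕ) (φ : A →ₗ[K] tpow K H X q)

theorem faceLeft_mapLast (f : X →ₗ[K] Y) : C.faceLeft Y q (mapLast f q ∘ₗ φ) =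
    mapLast (LinearMap.lTensor A f) q ∘ₗ C.faceLeft X q φ := by
  rw [faceLeft, faceLeft, LinearMap.lTensor_comp, ← LinearMap.comp_assoc, ← LinearMap.comp_assoc,
    pushLeft_natural]
  rfl

theorem faceRight_mapLast (f : X →ₗ[K] Y) : C.faceRight Y q (mapLast f q ∘ₗ φ) =
    mapLast (LinearMap.rTensor A f) q ∘ₗ C.faceRight X q φ := by
  rw [faceRight, faceRight, LinearMap.rTensor_comp, ← LinearMap.comp_assoc, ← LinearMap.comp_assoc,
    pushRight_natural]
  rfl

theorem faceCoact_mapLast (f : X →ₗ[K] Y) : C.faceCoact Y q (mapLast f q ∘ₗ φ) =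
    mapLast f (q + 1) ∘ₗ C.faceCoact X q φ := by
  rw [faceCoact, faceCoact, LinearMap.lTensor_comp]
  rfl

theorem faceLeft_faceLeft : C.faceLeft (A ⊗[K] X) q (C.faceLeft X q φ) =
    mapLast (comulFirst C.comul X) q ∘ₗ C.faceLeft X q φ := by
  rw [faceLeft, faceLeft, comp_lTensor_lTensor_comul, pushLeft_comulFirst]
  rfl

theorem faceRight_faceRight : C.faceRight (X ⊗[K] A) q (C.faceRight X q φ) =
    mapLast (C.comulLast X) q ∘ₗ C.faceRight X q φ := by
  rw [faceRight, faceRight, comp_rTensor_rTensor_comul, pushRight_comulLast]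
  rfl

theorem faceRight_faceLeft : C.faceRight (A ⊗[K] X) q (C.faceLeft X q φ) =
    mapLast (TensorProduct.assoc K A X A).symm.toLinearMap q ∘ₗ
      C.faceLeft (X ⊗[K] A) q (C.faceRight X q φ) := by
  rw [faceRight, faceLeft, comp_rTensor_lTensor_comul,
    ← LinearMap.comp_assoc _ _ (C.pushRight (A ⊗[K] X) q), pushRight_pushLeft]
  rw [faceLeft, faceRight, LinearMap.lTensor_comp A (C.pushRight X q)]
  refine LinearMap.ext fun a => ?_
  simp only [LinearMap.comp_apply, LinearEquiv.coe_coe, LinearEquiv.apply_symm_apply]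

theorem altCoface_faceLeft (f : X →ₗ[K] H ⊗[K] X) :
    altCoface B.comul (B.mulShuffle A X ∘ₗ TensorProduct.map C.coact f) q ∘ₗ C.faceLeft X q φ =
      C.faceLeft X (q + 1) (altCoface B.comul f q ∘ₗ φ) := by
  rw [faceLeft, faceLeft, LinearMap.lTensor_comp, ← LinearMap.comp_assoc, altCoface_pushLeft]
  rfl

theorem altCoface_faceRight (f : X →ₗ[K] H ⊗[K] X) :
    altCoface B.comul (B.mulShuffle X A ∘ₗ TensorProduct.map f C.coact) q ∘ₗ C.faceRight X q φ =
      C.faceRight X (q + 1) (altCoface B.comul f q ∘ₗ φ) := by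
  rw [faceRight, faceRight, LinearMap.rTensor_comp, ← LinearMap.comp_assoc, altCoface_pushRight]
  rfl

theorem faceCoact_faceLeft : C.faceCoact (A ⊗[K] X) q (C.faceLeft X q φ) =
    C.faceLeft X (q + 1) (C.faceCoact X q φ) :=
  C.stepLeft_coact (C.pushLeft X q) φ

theorem faceCoact_faceRight : C.faceCoact (X ⊗[K] A) q (C.faceRight X q φ) =
    C.faceRight X (q + 1) (C.faceCoact X q φ) :=
  C.stepRight_coact (C.pushRight X q) φ

/-- The vertical differential with coefficients in an `H`-comodule `(X, f)`. -/
noncomputable def vert (f : X →ₗ[K] H ⊗[K] X) : A →ₗ[K] tpow K H X (q + 1) :=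
  altCoface B.comul f q ∘ₗ φ + (-1 : K) ^ (q + 1) • C.faceCoact X q φ

/-- The term `g f φ` vanishes by `h`. Since `s' = -s`, the terms with one `f` cancel, and those with
two coactions cancel by coassociativity of `ρ`. -/
theorem vert_step {f : M →ₗ[K] H ⊗[K] M} {g : H ⊗[K] M →ₗ[K] H ⊗[K] (H ⊗[K] M)} {s s' : K}
    (hs : s' = -s) (hg : g = LinearMap.lTensor H f + s • comulFirst B.comul M) (h : g ∘ₗ f = 0) (φ : A →ₗ[K] M) :
    g ∘ₗ (f ∘ₗ φ + s • (LinearMap.lTensor H φ ∘ₗ C.coact)) +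
      s' • (LinearMap.lTensor H (f ∘ₗ φ + s • (LinearMap.lTensor H φ ∘ₗ C.coact)) ∘ₗ C.coact) =
      0 := by
  subst hs
  refine LinearMap.ext fun a => ?_
  have ha : g (f (φ a)) = 0 := LinearMap.congr_fun h (φ a)
  simp only [LinearMap.comp_apply, LinearMap.add_apply, LinearMap.smul_apply, map_add, map_smul, ha,
    LinearMap.lTensor_add, LinearMap.lTensor_smul, LinearMap.lTensor_comp, coact_coassoc_apply,
    LinearMap.zero_apply, zero_add]
  simp only [hg, LinearMap.add_apply, LinearMap.smul_apply, comulFirst_lTensor]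
  module

theorem vert_vert (f : X →ₗ[K] H ⊗[K] X)
    (hf : LinearMap.lTensor H f ∘ₗ f = comulFirst B.comul X ∘ₗ f) :
    C.vert (q + 1) (C.vert q φ f) f = 0 :=
  C.vert_step (M := tpow K H X q) (by ring) rfl
    (altCoface_comp_altCoface B.comul B.comul_coassoc f hf q) φ

end Faces

section Bicomplex

variable (n q : ℕ) (φ : Coch K H A n q)

/-- With its companion `dLast_eq`, this transfers the recursive face relations to the actual
differential. -/
theorem dFirst_eq : C.dFirst n q φ = C.faceLeft (tpow K A A n) q φ := by
  cases q with
  | zero => rfl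
  | succ q =>
    rw [faceLeft, ← actLeft_moveRight, LinearMap.comp_assoc,
      ← LinearMap.comp_assoc _ _ (LinearMap.rTensor _ C.coact), LinearMap.rTensor_comp_lTensor]
    rfl

theorem dLast_eq : C.dLast n q φ = mapLast (snoc K A n) q ∘ₗ C.faceRight (tpow K A A n) q φ := by
  cases q with
  | zero => rfl
  | succ q =>
    rw [faceRight, ← LinearMap.comp_assoc, ← actRight_assocRight, LinearMap.comp_assoc,
      ← LinearMap.comp_assoc _ _ (LinearMap.lTensor _ C.coact), LinearMap.lTensor_comp_rTensor]
    rfl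

theorem d_eq : C.d n q φ = C.faceLeft (tpow K A A n) q φ + mapLast (altComul C.comul n) q ∘ₗ φ +
    (-1 : K) ^ n • (mapLast (snoc K A n) q ∘ₗ C.faceRight (tpow K A A n) q φ) := by
  rw [← dFirst_eq, ← dLast_eq, ← mapLastHom_apply, altComul, map_sum, sum_comp]
  simp only [map_smul, LinearMap.smul_comp, mapLastHom_apply]
  -- The sign of the last face is `(-1)^{p+1}` with `p = n + 1`.
  rw [show (-1 : K) ^ n = (-1 : K) ^ (n + 2) by ring]
  rfl

theorem b_eq : C.b n q φ = C.vert q φ (C.coactPow n) := by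
  rw [vert, altCoface_eq_sum, LinearMap.add_comp, sum_comp]
  simp only [LinearMap.smul_comp]
  rfl

theorem b_b : C.b n (q + 1) (C.b n q φ) = 0 := by
  rw [b_eq, b_eq]
  exact C.vert_vert q φ _ (C.coactPow_coassoc n)

end Bicomplex
end ComoduleCoalgebra

namespace ComoduleCoalgebra

variable {K : Type u} [Field K] {H : Type v} [AddCommGroup H] [Module K H] {B : Bialg K H}
  {A : Type v} [AddCommGroup A] [Module K A] (C : ComoduleCoalgebra B A)

/-! ### The bicomplex identities -/

section Bicomplex

variable (n q : ℕ) (φ : Coch K H A n q)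

/-- The sum of the inner summands of the horizontal differential. -/
noncomputable def dMid : Coch K H A (n + 1) q := mapLast (altComul C.comul n) q ∘ₗ φ

/-- The sum of all summands of `b` but the last. -/
noncomputable def bInit : Coch K H A n (q + 1) := altCoface B.comul (C.coactPow n) q ∘ₗ φ

theorem d_eq_add : C.d n q φ = C.dFirst n q φ + C.dMid n q φ + (-1 : K) ^ n • C.dLast n q φ := by
  rw [d_eq, dFirst_eq, dLast_eq]
  rfl

theorem b_eq_add : C.b n q φ = C.bInit n q φ + (-1 : K) ^ (q + 1) • C.bLast n q φ :=
  C.b_eq n q φ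

theorem dMid_add (φ ψ : Coch K H A n q) :
    C.dMid n q (φ + ψ) = C.dMid n q φ + C.dMid n q ψ := LinearMap.comp_add _ _ _

theorem dMid_smul (c : K) : C.dMid n q (c • φ) = c • C.dMid n q φ := LinearMap.comp_smul _ _ _

theorem bInit_add (φ ψ : Coch K H A n q) :
    C.bInit n q (φ + ψ) = C.bInit n q φ + C.bInit n q ψ := LinearMap.comp_add _ _ _

theorem bInit_smul (c : K) : C.bInit n q (c • φ) = c • C.bInit n q φ := LinearMap.comp_smul _ _ _

theorem dFirst_dFirst : C.dFirst (n + 1) q (C.dFirst n q φ) =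
    mapLast (comulFirst C.comul (tpow K A A n)) q ∘ₗ C.dFirst n q φ := by
  rw [dFirst_eq, dFirst_eq]
  exact C.faceLeft_faceLeft q φ

theorem dFirst_dMid : C.dFirst (n + 1) q (C.dMid n q φ) =
    mapLast (LinearMap.lTensor A (altComul C.comul n)) q ∘ₗ C.dFirst n q φ := by
  rw [dFirst_eq, dFirst_eq]
  exact C.faceLeft_mapLast q φ (altComul C.comul n)

/-- After a first face, `Δ_A` acts either on the new leading factor, which amounts to a second first
face, or on an old factor, which amounts to applying it before the face. -/
theorem dMid_dFirst : C.dMid (n + 1) q (C.dFirst n q φ) =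
    -C.dFirst (n + 1) q (C.dFirst n q φ) - C.dFirst (n + 1) q (C.dMid n q φ) := by
  have h : mapLast (V := H) (altComul C.comul (n + 1)) q =
      -mapLast (comulFirst C.comul (tpow K A A n)) q -
        mapLast (LinearMap.lTensor A (altComul C.comul n)) q := by
    rw [altComul_succ]
    refine (map_sub (mapLastHom (V := H) (K := K) (X := tpow K A A (n + 1))
      (Y := tpow K A A (n + 2)) q) (-comulFirst C.comul (tpow K A A n))
        (LinearMap.lTensor A (altComul C.comul n))).trans ?_
    exact congrArg (· - _) (map_neg (mapLastHom (V := H) (K := K) (X := tpow K A A (n + 1))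
      (Y := tpow K A A (n + 2)) q) (comulFirst C.comul (tpow K A A n)))
  rw [dFirst_dFirst, dFirst_dMid, dMid, h, LinearMap.sub_comp, LinearMap.neg_comp]

theorem dMid_dMid : C.dMid (n + 1) q (C.dMid n q φ) = 0 := by
  rw [dMid, dMid, ← LinearMap.comp_assoc, ← mapLast_comp,
    altComul_comp_altComul C.comul C.comul_coassoc, ← mapLastHom_apply, map_zero,
    LinearMap.zero_comp]

theorem dLast_dFirst : C.dLast (n + 1) q (C.dFirst n q φ) =
    C.dFirst (n + 1) q (C.dLast n q φ) := by
  rw [dFirst_eq, dFirst_eq, dLast_eq, dLast_eq]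
  refine (congrArg (mapLast (snoc K A (n + 1)) q ∘ₗ ·) (C.faceRight_faceLeft q φ)).trans ?_
  refine Eq.trans ?_ (C.faceLeft_mapLast q (C.faceRight (tpow K A A n) q φ) (snoc K A n)).symm
  rw [← LinearMap.comp_assoc, ← mapLast_comp]
  have h : snoc K A (n + 1) ∘ₗ (TensorProduct.assoc K A (tpow K A A n) A).symm.toLinearMap =
      LinearMap.lTensor A (snoc K A n) := by
    refine LinearMap.ext fun t => ?_
    exact congrArg (LinearMap.lTensor A (snoc K A n)) (LinearEquiv.apply_symm_apply _ _)
  rw [h]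

theorem dLast_dMid : C.dLast (n + 1) q (C.dMid n q φ) =
    mapLast (snoc K A (n + 1) ∘ₗ LinearMap.rTensor A (altComul C.comul n)) q ∘ₗ
      C.faceRight (tpow K A A n) q φ := by
  rw [dLast_eq, dMid, faceRight_mapLast, ← LinearMap.comp_assoc, ← mapLast_comp]

theorem dLast_dLast : C.dLast (n + 1) q (C.dLast n q φ) =
    mapLast (snoc K A (n + 1) ∘ₗ LinearMap.rTensor A (snoc K A n) ∘ₗ
      C.comulLast (tpow K A A n)) q ∘ₗ C.faceRight (tpow K A A n) q φ := by
  rw [dLast_eq, dLast_eq, faceRight_mapLast, faceRight_faceRight, mapLast_comp, mapLast_comp]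
  rfl

/-- Mirror image of `dMid_dFirst`: by `altComul_snoc`, `Δ_A` acts on an old factor or on the new
last one. -/
theorem dMid_dLast : C.dMid (n + 1) q (C.dLast n q φ) =
    C.dLast (n + 1) q (C.dMid n q φ) + (-1 : K) ^ n • C.dLast (n + 1) q (C.dLast n q φ) := by
  rw [dLast_dMid, dLast_dLast, dLast_eq, dMid, ← LinearMap.comp_assoc, ← mapLast_comp,
    altComul_snoc, LinearMap.comp_add, LinearMap.comp_smul, mapLast_add, mapLast_smul,
    LinearMap.add_comp, LinearMap.smul_comp]

theorem d_d : C.d (n + 1) q (C.d n q φ) = 0 := by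
  have h : (-1 : K) ^ n * (-1 : K) ^ n = 1 := by rw [← mul_pow]; simp
  -- Of the nine terms, those without a last face cancel by `dMid_dFirst` and `dMid_dMid`, the two
  -- mixed outer ones by `dLast_dFirst`, the remaining three by `dMid_dLast`.
  rw [d_eq_add, d_eq_add, dFirst_add, dFirst_add, dMid_add, dMid_add, dLast_add, dLast_add,
    dFirst_smul, dMid_smul, dLast_smul, dMid_dFirst, dMid_dMid, dMid_dLast, dLast_dFirst, pow_succ]
  module

theorem bInit_dFirst : C.bInit (n + 1) q (C.dFirst n q φ) = C.dFirst n (q + 1) (C.bInit n q φ) := by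
  rw [dFirst_eq, dFirst_eq]
  exact C.altCoface_faceLeft q φ (C.coactPow n)

theorem bInit_dMid : C.bInit (n + 1) q (C.dMid n q φ) = C.dMid n (q + 1) (C.bInit n q φ) := by
  rw [bInit, dMid, ← LinearMap.comp_assoc, altCoface_natural B.comul (C.coactPow_altComul n)]
  rfl

theorem bInit_dLast : C.bInit (n + 1) q (C.dLast n q φ) = C.dLast n (q + 1) (C.bInit n q φ) := by
  rw [dLast_eq, dLast_eq, bInit, ← LinearMap.comp_assoc,
    altCoface_natural B.comul (C.coactPow_snoc n), LinearMap.comp_assoc, altCoface_faceRight]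
  rfl

theorem bLast_dFirst : C.bLast (n + 1) q (C.dFirst n q φ) = C.dFirst n (q + 1) (C.bLast n q φ) := by
  rw [dFirst_eq, dFirst_eq]
  exact C.faceCoact_faceLeft q φ

theorem bLast_dMid : C.bLast (n + 1) q (C.dMid n q φ) = C.dMid n (q + 1) (C.bLast n q φ) :=
  C.faceCoact_mapLast q φ (altComul C.comul n)

theorem bLast_dLast : C.bLast (n + 1) q (C.dLast n q φ) = C.dLast n (q + 1) (C.bLast n q φ) := by
  rw [dLast_eq, dLast_eq]
  refine (C.faceCoact_mapLast q _ (snoc K A n)).trans ?_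
  rw [faceCoact_faceRight]
  rfl

theorem b_d : C.b (n + 1) q (C.d n q φ) = C.d n (q + 1) (C.b n q φ) := by
  rw [b_eq_add, b_eq_add, d_eq_add, d_eq_add, bInit_add, bInit_add, bLast_add, bLast_add,
    bInit_smul, bLast_smul, dFirst_add, dFirst_smul, dMid_add, dMid_smul, dLast_add, dLast_smul,
    bInit_dFirst, bInit_dMid, bInit_dLast, bLast_dFirst, bLast_dMid, bLast_dLast]
  module

theorem dHor_dHor (p q : ℕ) : C.dHor (p + 1) q ∘ₗ C.dHor p q = 0 := by
  cases p with
  | zero => exact LinearMap.comp_zero _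
  | succ n => exact LinearMap.ext fun x => Subtype.ext (C.d_d n q x.1)

theorem dVert_dVert (p q : ℕ) : C.dVert p (q + 1) ∘ₗ C.dVert p q = 0 := by
  cases p with
  | zero => exact LinearMap.comp_zero _
  | succ n =>
    refine LinearMap.ext fun x => Subtype.ext ?_
    have h : ((-1 : K) ^ (n + 2) • C.b n (q + 1)) (((-1 : K) ^ (n + 2) • C.b n q) x.1) = 0 := by
      rw [LinearMap.smul_apply, LinearMap.smul_apply, map_smul, b_b, smul_zero, smul_zero]
    exact h

theorem dHor_dVert_add_dVert_dHor (p q : ℕ) :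
    C.dHor p (q + 1) ∘ₗ C.dVert p q + C.dVert (p + 1) q ∘ₗ C.dHor p q = 0 := by
  cases p with
  | zero =>
    refine LinearMap.ext fun x => ?_
    have h : C.dVert (0 + 1) q (0 : C.entry (0 + 1) q) = 0 := map_zero _
    exact (zero_add _).trans h
  | succ n =>
    refine LinearMap.ext fun x => Subtype.ext ?_
    have h : C.d n (q + 1) (((-1 : K) ^ (n + 2) • C.b n q) x.1) +
        ((-1 : K) ^ (n + 1 + 2) • C.b (n + 1) q) (C.d n q x.1) = 0 := by
      rw [LinearMap.smul_apply, map_smul, LinearMap.smul_apply, b_d]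
      module
    exact h

theorem totD_totD (n : ℕ) : C.totD (n + 1) ∘ₗ C.totD n = 0 := by
  refine LinearMap.ext fun x => funext fun ⟨⟨p, q⟩, h⟩ => ?_
  change C.totVert (n + 1) (C.totD n x) p q h - C.totHor (n + 1) (C.totD n x) p q h = 0
  -- Along the edges of the quadrant some incoming components are zero by definition; only the
  -- interior case needs all three bicomplex relations.
  match p, q, h with
  | 0, 0, h => exact sub_zero _
  | 0, q + 1, h => exact sub_zero _
  | 1, 0, h => simp at h
  | p + 2, 0, h =>
    have hh := LinearMap.congr_fun (C.dHor_dHor p 0) (x ⟨(p, 0), by simp only; omega⟩)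
    change 0 - C.dHor (p + 1) 0 (0 - C.dHor p 0 _) = 0
    rw [zero_sub, zero_sub, map_neg, neg_neg]
    exact hh
  | 1, 1, h =>
    change C.dVert 1 0 (0 - 0) - C.dHor 0 1 _ = 0
    rw [sub_zero, map_zero]
    exact sub_zero _
  | 1, q + 2, h =>
    have hv := LinearMap.congr_fun (C.dVert_dVert 1 q) (x ⟨(1, q), by simp only; omega⟩)
    change C.dVert 1 (q + 1) (C.dVert 1 q _ - 0) - 0 = 0
    rw [sub_zero, sub_zero]
    exact hv
  | p + 2, 1, h =>
    have ha := LinearMap.congr_fun (C.dHor_dVert_add_dVert_dHor (p + 1) 0)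
      (x ⟨(p + 1, 0), by simp only; omega⟩)
    have hh := LinearMap.congr_fun (C.dHor_dHor p 1) (x ⟨(p, 1), by simp only; omega⟩)
    change C.dVert (p + 2) 0 (0 - C.dHor (p + 1) 0 _) -
      C.dHor (p + 1) 1 (C.dVert (p + 1) 0 _ - C.dHor p 1 _) = 0
    rw [zero_sub, map_neg, map_sub]
    simp only [LinearMap.add_apply, LinearMap.comp_apply, LinearMap.zero_apply] at ha hh
    rw [hh, ← eq_neg_iff_add_eq_zero.2 ha]
    abel
  | p + 2, q + 2, h =>
    have ha := LinearMap.congr_fun (C.dHor_dVert_add_dVert_dHor (p + 1) (q + 1))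
      (x ⟨(p + 1, q + 1), by simp only; omega⟩)
    have hh := LinearMap.congr_fun (C.dHor_dHor p (q + 2)) (x ⟨(p, q + 2), by simp only; omega⟩)
    have hv := LinearMap.congr_fun (C.dVert_dVert (p + 2) q) (x ⟨(p + 2, q), by simp only; omega⟩)
    change C.dVert (p + 2) (q + 1) (C.dVert (p + 2) q _ - C.dHor (p + 1) (q + 1) _) -
      C.dHor (p + 1) (q + 2) (C.dVert (p + 1) (q + 1) _ - C.dHor p (q + 2) _) = 0
    rw [map_sub, map_sub]
    simp only [LinearMap.add_apply, LinearMap.comp_apply, LinearMap.zero_apply] at ha hh hv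
    rw [hh, hv, zero_sub, sub_zero]
    exact sub_eq_zero.2 (eq_neg_of_add_eq_zero_left ha).symm

end Bicomplex
end ComoduleCoalgebra

/-! ### Cauchy products for arbitrary pairings -/

section Cauchy

open Finset

/-- Both sides are sums over triples of indices with total `n`. Four separate pairings are allowed
so that composition and tensor products of maps are both covered. -/
theorem cauchy_assoc {M N P S T Q : Type*} [AddCommMonoid S] [AddCommMonoid T] [AddCommMonoid Q]
    (op₁ : S → P → Q) (op₂ : M → N → S) (op₃ : M → T → Q) (op₄ : N → P → T)
    (h₁ : ∀ z, op₁ 0 z = 0) (h₁' : ∀ s s' z, op₁ (s + s') z = op₁ s z + op₁ s' z)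
    (h₃ : ∀ x, op₃ x 0 = 0) (h₃' : ∀ x t t', op₃ x (t + t') = op₃ x t + op₃ x t')
    (h : ∀ x y z, op₁ (op₂ x y) z = op₃ x (op₄ y z)) (f : ℕ → M) (g : ℕ → N) (k : ℕ → P) :
    cauchy op₁ (cauchy op₂ f g) k = cauchy op₃ f (cauchy op₄ g k) := by
  funext n
  have e₁ : ∀ (s : Finset (ℕ × ℕ)) (u : ℕ × ℕ → S) (z : P),
      op₁ (∑ i ∈ s, u i) z = ∑ i ∈ s, op₁ (u i) z := fun s u z =>
    map_sum (⟨⟨fun s => op₁ s z, h₁ z⟩, fun a b => h₁' a b z⟩ : S →+ Q) u s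
  have e₃ : ∀ (s : Finset (ℕ × ℕ)) (u : ℕ × ℕ → T) (x : M),
      op₃ x (∑ i ∈ s, u i) = ∑ i ∈ s, op₃ x (u i) := fun s u x =>
    map_sum (⟨⟨fun t => op₃ x t, h₃ x⟩, fun a b => h₃' x a b⟩ : T →+ Q) u s
  simp only [cauchy, e₁, e₃, h, sum_sigma']
  refine sum_nbij' (fun ⟨⟨_, j⟩, ⟨i, l⟩⟩ => ⟨(i, l + j), (l, j)⟩)
    (fun ⟨⟨i, _⟩, ⟨l, j⟩⟩ => ⟨(i + l, j), (i, l)⟩) ?_ ?_ ?_ ?_ ?_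
  · rintro ⟨⟨a, j⟩, ⟨i, l⟩⟩ hm
    simp only [mem_sigma, HasAntidiagonal.mem_antidiagonal] at hm ⊢
    exact ⟨by change i + (l + j) = n; omega, trivial⟩
  · rintro ⟨⟨a, j⟩, ⟨i, l⟩⟩ hm
    simp only [mem_sigma, HasAntidiagonal.mem_antidiagonal] at hm ⊢
    exact ⟨by change a + i + l = n; omega, trivial⟩
  · rintro ⟨⟨a, j⟩, ⟨i, l⟩⟩ hm
    simp only [mem_sigma, HasAntidiagonal.mem_antidiagonal] at hm
    obtain ⟨-, rfl⟩ := hm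
    rfl
  · rintro ⟨⟨a, j⟩, ⟨i, l⟩⟩ hm
    simp only [mem_sigma, HasAntidiagonal.mem_antidiagonal] at hm
    obtain ⟨-, rfl⟩ := hm
    rfl
  · rintro ⟨⟨a, j⟩, ⟨i, l⟩⟩ hm
    rfl

theorem cauchy_constSeries_left {M N P : Type*} [Zero M] [AddCommMonoid P] (op : M → N → P)
    (h : ∀ y, op 0 y = 0) (x : M) (g : ℕ → N) :
    cauchy op (constSeries x) g = fun n => op x (g n) := by
  funext n
  unfold cauchy constSeries
  rw [sum_eq_single (0, n)]
  · simp
  · rintro ⟨i, j⟩ hij hne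
    have := HasAntidiagonal.mem_antidiagonal.1 hij
    rw [if_neg, h]
    rintro rfl
    exact hne (by simp_all)
  · simp

theorem cauchy_constSeries_right {M N P : Type*} [Zero N] [AddCommMonoid P] (op : M → N → P)
    (h : ∀ x, op x 0 = 0) (f : ℕ → M) (y : N) :
    cauchy op f (constSeries y) = fun n => op (f n) y := by
  funext n
  unfold cauchy constSeries
  rw [sum_eq_single (n, 0)]
  · simp
  · rintro ⟨i, j⟩ hij hne
    have := HasAntidiagonal.mem_antidiagonal.1 hij
    rw [if_neg, h]
    rintro rfl
    exact hne (by simp_all)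
  · simp

theorem cauchy_zero {M N P : Type*} [AddCommMonoid P] (op : M → N → P) (f : ℕ → M) (g : ℕ → N) :
    cauchy op f g 0 = op (f 0) (g 0) := by
  simp [cauchy]

/-- If the inner coefficients of the series contribute nothing, the coefficient of the Cauchy
product is the sum of its two outer terms. -/
theorem cauchy_eq_add {M N P : Type*} [AddCommMonoid P] (op : M → N → P) (f : ℕ → M) (g : ℕ → N)
    {n : ℕ} (hn : 1 ≤ n) (h : ∀ i j, 1 ≤ i → 1 ≤ j → i + j = n → op (f i) (g j) = 0) :
    cauchy op f g n = op (f 0) (g n) + op (f n) (g 0) := by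
  unfold cauchy
  rw [← sum_pair (f := fun ij : ℕ × ℕ => op (f ij.1) (g ij.2)) (a := (0, n)) (b := (n, 0))
    (by simp; omega)]
  symm
  refine sum_subset ?_ ?_
  · intro x hx
    simp only [mem_insert, mem_singleton] at hx
    rcases hx with rfl | rfl <;> simp
  · rintro ⟨i, j⟩ hij hne
    have := HasAntidiagonal.mem_antidiagonal.1 hij
    simp only [mem_insert, mem_singleton, Prod.mk.injEq, not_or] at hne this
    exact h i j (by omega) (by omega) this

theorem cauchy_congr {M N P : Type*} [AddCommMonoid P] (op : M → N → P) {f f' : ℕ → M}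
    {g g' : ℕ → N} {n : ℕ} (hf : ∀ m ≤ n, f m = f' m) (hg : ∀ m ≤ n, g m = g' m) :
    cauchy op f g n = cauchy op f' g' n := by
  unfold cauchy
  refine sum_congr rfl fun ij hij => ?_
  have := HasAntidiagonal.mem_antidiagonal.1 hij
  rw [hf _ (by omega), hg _ (by omega)]

end Cauchy

/-! ### Composition and tensor product of series of linear maps -/

section Series

variable {K : Type u} [Field K]
variable {X Y Z W X' Y' Z' X'' Y'' : Type v} [AddCommGroup X] [Module K X] [AddCommGroup Y]
  [Module K Y] [AddCommGroup Z] [Module K Z] [AddCommGroup W] [Module K W] [AddCommGroup X']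
  [Module K X'] [AddCommGroup Y'] [Module K Y'] [AddCommGroup Z'] [Module K Z'] [AddCommGroup X'']
  [Module K X''] [AddCommGroup Y''] [Module K Y'']

/-- Composition of power series of linear maps. -/
noncomputable def sComp (f : ℕ → Y →ₗ[K] Z) (g : ℕ → X →ₗ[K] Y) : ℕ → X →ₗ[K] Z :=
  cauchy (fun a b => a ∘ₗ b) f g

/-- Tensor product of power series of linear maps. -/
noncomputable def sMap (f : ℕ → X →ₗ[K] X') (g : ℕ → Y →ₗ[K] Y') :
    ℕ → X ⊗[K] Y →ₗ[K] X' ⊗[K] Y' :=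
  cauchy (fun a b => TensorProduct.map a b) f g

variable (K X) in
/-- The identity as a power series. -/
noncomputable def sId : ℕ → X →ₗ[K] X := constSeries LinearMap.id

theorem sComp_assoc (f : ℕ → Z →ₗ[K] W) (g : ℕ → Y →ₗ[K] Z) (h : ℕ → X →ₗ[K] Y) :
    sComp (sComp f g) h = sComp f (sComp g h) :=
  cauchy_assoc _ _ _ _ (fun _ => LinearMap.zero_comp _) (fun _ _ _ => LinearMap.add_comp _ _ _)
    (fun _ => LinearMap.comp_zero _) (fun _ _ _ => LinearMap.comp_add _ _ _)
    (fun _ _ _ => LinearMap.comp_assoc _ _ _) f g h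

theorem sId_sComp (f : ℕ → X →ₗ[K] Y) : sComp (sId K Y) f = f :=
  cauchy_constSeries_left _ (fun _ => LinearMap.zero_comp _) _ _

theorem sComp_sId (f : ℕ → X →ₗ[K] Y) : sComp f (sId K X) = f :=
  cauchy_constSeries_right _ (fun _ => LinearMap.comp_zero _) _ _

theorem const_sComp (f : Y →ₗ[K] Z) (g : ℕ → X →ₗ[K] Y) :
    sComp (constSeries f) g = fun n => f ∘ₗ g n :=
  cauchy_constSeries_left _ (fun _ => LinearMap.zero_comp _) _ _

theorem sComp_const (f : ℕ → Y →ₗ[K] Z) (g : X →ₗ[K] Y) :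
    sComp f (constSeries g) = fun n => f n ∘ₗ g :=
  cauchy_constSeries_right _ (fun _ => LinearMap.comp_zero _) _ _

theorem sMap_sId_left (f : ℕ → Y →ₗ[K] Y') :
    sMap (sId K X) f = fun n => LinearMap.lTensor X (f n) :=
  cauchy_constSeries_left _ (fun _ => TensorProduct.map_zero_left _) _ _

theorem sMap_sId_right (f : ℕ → X →ₗ[K] X') :
    sMap f (sId K Y) = fun n => LinearMap.rTensor Y (f n) :=
  cauchy_constSeries_right _ (fun _ => TensorProduct.map_zero_right _) _ _

theorem sMap_sId_sId : sMap (sId K X) (sId K Y) = sId K (X ⊗[K] Y) := by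
  rw [sMap_sId_left]
  funext n
  unfold sId constSeries
  split_ifs <;> simp

theorem sMap_eq_sComp (f : ℕ → X →ₗ[K] X') (g : ℕ → Y →ₗ[K] Y') :
    sMap f g = sComp (sMap f (sId K Y')) (sMap (sId K X) g) := by
  rw [sMap_sId_left, sMap_sId_right]
  funext n
  unfold sMap sComp cauchy
  exact Finset.sum_congr rfl fun _ _ => (LinearMap.rTensor_comp_lTensor _ _ _).symm

theorem sMap_eq_sComp' (f : ℕ → X →ₗ[K] X') (g : ℕ → Y →ₗ[K] Y') :
    sMap f g = sComp (sMap (sId K X') g) (sMap f (sId K Y)) := by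
  rw [sMap_sId_left, sMap_sId_right]
  funext n
  unfold sMap sComp cauchy
  rw [← Finset.Nat.sum_antidiagonal_swap]
  exact Finset.sum_congr rfl fun _ _ => (LinearMap.lTensor_comp_rTensor _ _ _).symm

theorem sMap_sId_sComp (f : ℕ → Y' →ₗ[K] Y'') (g : ℕ → Y →ₗ[K] Y') :
    sMap (sId K X) (sComp f g) = sComp (sMap (sId K X) f) (sMap (sId K X) g) := by
  simp only [sMap_sId_left]
  funext n
  unfold sComp cauchy
  rw [← LinearMap.coe_lTensorHom, map_sum]
  exact Finset.sum_congr rfl fun _ _ => LinearMap.lTensor_comp _ _ _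

theorem sMap_sComp_sId (f : ℕ → X' →ₗ[K] X'') (g : ℕ → X →ₗ[K] X') :
    sMap (sComp f g) (sId K Y) = sComp (sMap f (sId K Y)) (sMap g (sId K Y)) := by
  simp only [sMap_sId_right]
  funext n
  unfold sComp cauchy
  rw [← LinearMap.coe_rTensorHom, map_sum]
  exact Finset.sum_congr rfl fun _ _ => LinearMap.rTensor_comp _ _ _

/-- The interchange law: each tensor product is factored into one-sided ones, and the two middle
factors, acting on different sides, are swapped. -/
theorem sMap_sComp (f : ℕ → X' →ₗ[K] X'') (f' : ℕ → X →ₗ[K] X') (g : ℕ → Y' →ₗ[K] Y'')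
    (g' : ℕ → Y →ₗ[K] Y') :
    sMap (sComp f f') (sComp g g') = sComp (sMap f g) (sMap f' g') := by
  rw [sMap_eq_sComp, sMap_sId_sComp, sMap_sComp_sId, sMap_eq_sComp f g, sMap_eq_sComp f' g',
    sComp_assoc, sComp_assoc, ← sComp_assoc (sMap f' _), ← sComp_assoc (sMap (sId K X') g),
    ← sMap_eq_sComp, ← sMap_eq_sComp']

theorem assoc_sMap (f : ℕ → X →ₗ[K] X') (g : ℕ → Y →ₗ[K] Y') (h : ℕ → Z →ₗ[K] Z') :
    sComp (constSeries (TensorProduct.assoc K X' Y' Z').toLinearMap) (sMap (sMap f g) h) =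
      sComp (sMap f (sMap g h)) (constSeries (TensorProduct.assoc K X Y Z).toLinearMap) := by
  rw [const_sComp, sComp_const]
  have e := cauchy_assoc
    (fun (a : X ⊗[K] Y →ₗ[K] X' ⊗[K] Y') (c : Z →ₗ[K] Z') =>
      (TensorProduct.assoc K X' Y' Z').toLinearMap ∘ₗ TensorProduct.map a c)
    (fun (a : X →ₗ[K] X') (b : Y →ₗ[K] Y') => TensorProduct.map a b)
    (fun (a : X →ₗ[K] X') (b : Y ⊗[K] Z →ₗ[K] Y' ⊗[K] Z') =>
      TensorProduct.map a b ∘ₗ (TensorProduct.assoc K X Y Z).toLinearMap)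
    (fun (b : Y →ₗ[K] Y') (c : Z →ₗ[K] Z') => TensorProduct.map b c)
    (by simp) (by simp [TensorProduct.map_add_left, LinearMap.comp_add]) (by simp)
    (by simp [TensorProduct.map_add_right, LinearMap.add_comp])
    (fun a b c => by ext; simp) f g h
  funext n
  have e' := congrFun e n
  unfold cauchy at e'
  unfold sMap cauchy
  rw [comp_sum, sum_comp]
  exact e'

end Series

namespace ComoduleCoalgebra

variable {K : Type u} [Field K] {H : Type v} [AddCommGroup H] [Module K H] {B : Bialg K H}
  {A : Type v} [AddCommGroup A] [Module K A] (C : ComoduleCoalgebra B A)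

/-! ### The complex in degrees one and two -/

section LowDegrees

theorem b_zero_zero_apply (φ : A →ₗ[K] A) :
    C.b 0 0 φ = C.coact ∘ₗ φ - LinearMap.lTensor H φ ∘ₗ C.coact := by
  have h : C.coact ∘ₗ φ + (-1 : K) ^ (0 + 1) • (LinearMap.lTensor H φ ∘ₗ C.coact) =
      C.coact ∘ₗ φ - LinearMap.lTensor H φ ∘ₗ C.coact := by module
  rw [b_eq_add]
  exact h

theorem b_zero_one_apply (r : A →ₗ[K] H ⊗[K] A) :
    C.b 0 1 r = LinearMap.lTensor H C.coact ∘ₗ r -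
      (TensorProduct.assoc K H H A).toLinearMap ∘ₗ LinearMap.rTensor A B.comul ∘ₗ r +
      LinearMap.lTensor H r ∘ₗ C.coact := by
  have h : (LinearMap.lTensor H C.coact + (-1 : K) ^ (0 + 1) • comulFirst B.comul A) ∘ₗ r +
      (-1 : K) ^ (1 + 1) • (LinearMap.lTensor H r ∘ₗ C.coact) = LinearMap.lTensor H C.coact ∘ₗ r -
      comulFirst B.comul A ∘ₗ r + LinearMap.lTensor H r ∘ₗ C.coact := by
    rw [LinearMap.add_comp, LinearMap.smul_comp]
    module
  rw [b_eq_add]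
  exact h

theorem b_one_zero_apply (δ : A →ₗ[K] A ⊗[K] A) :
    C.b 1 0 δ = B.mulShuffle A A ∘ₗ TensorProduct.map C.coact C.coact ∘ₗ δ -
      LinearMap.lTensor H δ ∘ₗ C.coact := by
  have h : (B.mulShuffle A A ∘ₗ TensorProduct.map C.coact C.coact) ∘ₗ δ +
      (-1 : K) ^ (0 + 1) • (LinearMap.lTensor H δ ∘ₗ C.coact) =
      B.mulShuffle A A ∘ₗ TensorProduct.map C.coact C.coact ∘ₗ δ -
      LinearMap.lTensor H δ ∘ₗ C.coact := by
    rw [LinearMap.comp_assoc]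
    module
  rw [b_eq_add]
  exact h

theorem d_zero_zero_apply (φ : A →ₗ[K] A) :
    C.d 0 0 φ = LinearMap.lTensor A φ ∘ₗ C.comul - C.comul ∘ₗ φ +
      LinearMap.rTensor A φ ∘ₗ C.comul := by
  rw [d_eq_add, pow_zero, one_smul, sub_eq_add_neg, ← LinearMap.neg_comp, ← altComul_zero]
  rfl

theorem d_zero_one_apply (r : A →ₗ[K] H ⊗[K] A) :
    C.d 0 1 r = B.mulShuffle A A ∘ₗ TensorProduct.map C.coact r ∘ₗ C.comul -
      LinearMap.lTensor H C.comul ∘ₗ r +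
        B.mulShuffle A A ∘ₗ TensorProduct.map r C.coact ∘ₗ C.comul := by
  have h₁ : C.faceLeft A 1 r = B.mulShuffle A A ∘ₗ TensorProduct.map C.coact r ∘ₗ C.comul := by
    have h : (LinearMap.lTensor H (LinearMap.id : A ⊗[K] A →ₗ[K] A ⊗[K] A) ∘ₗ B.mulShuffle A A ∘ₗ
        LinearMap.rTensor (H ⊗[K] A) C.coact) ∘ₗ LinearMap.lTensor A r ∘ₗ C.comul =
        B.mulShuffle A A ∘ₗ TensorProduct.map C.coact r ∘ₗ C.comul := by
      rw [LinearMap.lTensor_id, LinearMap.id_comp, LinearMap.comp_assoc,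
        ← LinearMap.comp_assoc _ _ (LinearMap.rTensor _ C.coact), LinearMap.rTensor_comp_lTensor]
    exact h
  have h₂ : mapLast (snoc K A 0) 1 ∘ₗ C.faceRight A 1 r =
      B.mulShuffle A A ∘ₗ TensorProduct.map r C.coact ∘ₗ C.comul := by
    have h : LinearMap.lTensor H (LinearMap.id : A ⊗[K] A →ₗ[K] A ⊗[K] A) ∘ₗ
        (LinearMap.lTensor H (LinearMap.id : A ⊗[K] A →ₗ[K] A ⊗[K] A) ∘ₗ B.mulShuffle A A ∘ₗ
        LinearMap.lTensor (H ⊗[K] A) C.coact) ∘ₗ LinearMap.rTensor A r ∘ₗ C.comul =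
        B.mulShuffle A A ∘ₗ TensorProduct.map r C.coact ∘ₗ C.comul := by
      rw [LinearMap.lTensor_id, LinearMap.id_comp, LinearMap.id_comp, LinearMap.comp_assoc,
        ← LinearMap.comp_assoc _ _ (LinearMap.lTensor _ C.coact), LinearMap.lTensor_comp_rTensor]
    exact h
  have h₃ : C.dMid 0 1 r = -(LinearMap.lTensor H C.comul ∘ₗ r) := by
    rw [dMid, altComul_zero, ← LinearMap.neg_comp, ← LinearMap.lTensor_neg]
    rfl
  rw [d_eq_add, dFirst_eq, dLast_eq, h₃, pow_zero, one_smul, sub_eq_add_neg]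
  exact congrArg₂ (· + ·) (congrArg (· + _) h₁) h₂

theorem d_one_zero_apply (δ : A →ₗ[K] A ⊗[K] A) :
    C.d 1 0 δ = LinearMap.lTensor A δ ∘ₗ C.comul + LinearMap.lTensor A C.comul ∘ₗ δ -
      (TensorProduct.assoc K A A A).toLinearMap ∘ₗ LinearMap.rTensor A C.comul ∘ₗ δ -
      (TensorProduct.assoc K A A A).toLinearMap ∘ₗ LinearMap.rTensor A δ ∘ₗ C.comul := by
  have h : LinearMap.lTensor A δ ∘ₗ C.comul +
      (-comulFirst C.comul A - LinearMap.lTensor A (-C.comul)) ∘ₗ δ +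
      (-1 : K) ^ 1 • ((LinearMap.lTensor A (LinearMap.id : A ⊗[K] A →ₗ[K] A ⊗[K] A) ∘ₗ
        (TensorProduct.assoc K A A A).toLinearMap) ∘ₗ LinearMap.rTensor A δ ∘ₗ C.comul) =
      LinearMap.lTensor A δ ∘ₗ C.comul + LinearMap.lTensor A C.comul ∘ₗ δ -
      comulFirst C.comul A ∘ₗ δ -
      (TensorProduct.assoc K A A A).toLinearMap ∘ₗ LinearMap.rTensor A δ ∘ₗ C.comul := by
    rw [LinearMap.lTensor_id, LinearMap.id_comp, LinearMap.lTensor_neg, LinearMap.sub_comp,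
      LinearMap.neg_comp, LinearMap.neg_comp]
    module
  rw [d_eq_add, dMid, altComul_succ, altComul_zero]
  exact h

theorem d_eq_zero_of_mem_coder {φ : A →ₗ[K] A} (h : φ ∈ C.coder) : C.d 0 0 φ = 0 := by
  have h' : C.comul ∘ₗ φ = (LinearMap.lTensor A φ + LinearMap.rTensor A φ) ∘ₗ C.comul := h
  rw [d_zero_zero_apply, h', LinearMap.add_comp]
  exact (by intro x y; abel : ∀ x y : A →ₗ[K] A ⊗[K] A, x - (x + y) + y = 0) _ _

theorem twoCochain_mem_cocycles {r : A →ₗ[K] H ⊗[K] A} {δ : A →ₗ[K] A ⊗[K] A}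
    (h₁ : C.b 0 1 r = 0) (h₂ : C.b 1 0 δ + C.d 0 1 r = 0) (h₃ : C.d 1 0 δ = 0) :
    C.twoCochain r δ ∈ C.cocycles 2 := by
  refine LinearMap.mem_ker.2 (funext fun ⟨⟨p, q⟩, h⟩ => ?_)
  change p + q = 3 at h
  change C.totVert 2 (C.twoCochain r δ) p q h - C.totHor 2 (C.twoCochain r δ) p q h = 0
  obtain ⟨rfl, rfl⟩ | ⟨rfl, rfl⟩ | ⟨rfl, rfl⟩ | ⟨rfl, rfl⟩ :
      (p = 0 ∧ q = 3) ∨ (p = 1 ∧ q = 2) ∨ (p = 2 ∧ q = 1) ∨ (p = 3 ∧ q = 0) := by omega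
  · exact sub_zero _
  · refine Subtype.ext ?_
    have : ((-1 : K) ^ (0 + 2) • C.b 0 1) r - 0 = 0 := by
      -- For `p = 2` the vertical sign is `-1`, so this component is `-(b δ + d r)`.
      rw [LinearMap.smul_apply, h₁, smul_zero, sub_zero]
    exact this
  · refine Subtype.ext ?_
    have : ((-1 : K) ^ (1 + 2) • C.b 1 0) δ - C.d 0 1 r = 0 := by
      rw [LinearMap.smul_apply, eq_neg_of_add_eq_zero_left h₂]
      module
    exact this
  · refine Subtype.ext ?_
    have : 0 - C.d 1 0 δ = 0 := by rw [h₃, sub_zero]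
    exact this

/-- The element of `C_CC^1(A)` given by a coderivation. -/
noncomputable def oneCochain (φ : C.coder) : C.Tot 1
  | ⟨(1, 0), _⟩ => (φ : C.entrySub 0 0)
  | _ => 0

/-- Only the entry `(1, 0)` contributes in degree one. It consists of coderivations, which `d`
kills, so a coboundary has no component in `Hom(A, A ⊗ A)`. -/
theorem totD_one_apply (x : C.Tot 1) : C.totD 1 x =
    C.twoCochain (C.b 0 0 (x ⟨(1, 0), rfl⟩ : C.entrySub 0 0).1) 0 := by
  funext ⟨⟨p, q⟩, h⟩
  change p + q = 2 at h
  change C.totVert 1 x p q h - C.totHor 1 x p q h = _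
  obtain ⟨rfl, rfl⟩ | ⟨rfl, rfl⟩ | ⟨rfl, rfl⟩ :
      (p = 0 ∧ q = 2) ∨ (p = 1 ∧ q = 1) ∨ (p = 2 ∧ q = 0) := by omega
  · exact sub_zero _
  · refine Subtype.ext ?_
    have : ((-1 : K) ^ (0 + 2) • C.b 0 0) (x ⟨(1, 0), rfl⟩ : C.entrySub 0 0).1 - 0 =
        C.b 0 0 (x ⟨(1, 0), rfl⟩ : C.entrySub 0 0).1 := by
      rw [LinearMap.smul_apply]
      module
    exact this
  · refine Subtype.ext ?_
    have : 0 - C.d 0 0 (x ⟨(1, 0), rfl⟩ : C.entrySub 0 0).1 = 0 := by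
      rw [C.d_eq_zero_of_mem_coder (x ⟨(1, 0), rfl⟩ : C.entrySub 0 0).2, sub_zero]
    exact this

theorem totD_oneCochain (φ : C.coder) :
    C.totD 1 (C.oneCochain φ) = C.twoCochain (C.b 0 0 φ.1) 0 := C.totD_one_apply _

theorem twoCochain_injective {r r' : A →ₗ[K] H ⊗[K] A} {δ δ' : A →ₗ[K] A ⊗[K] A}
    (h : C.twoCochain r δ = C.twoCochain r' δ') : r = r' ∧ δ = δ' :=
  ⟨congrArg Subtype.val (congrFun h ⟨(1, 1), rfl⟩), congrArg Subtype.val (congrFun h ⟨(2, 0), rfl⟩)⟩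

theorem twoCochain_sub (r r' : A →ₗ[K] H ⊗[K] A) (δ δ' : A →ₗ[K] A ⊗[K] A) :
    C.twoCochain r δ - C.twoCochain r' δ' = C.twoCochain (r - r') (δ - δ') := by
  funext ⟨⟨p, q⟩, h⟩
  change p + q = 2 at h
  obtain ⟨rfl, rfl⟩ | ⟨rfl, rfl⟩ | ⟨rfl, rfl⟩ :
      (p = 0 ∧ q = 2) ∨ (p = 1 ∧ q = 1) ∨ (p = 2 ∧ q = 0) := by omega
  · exact sub_zero _
  · rfl
  · rfl

theorem twoCochain_mem_coboundaries_iff {r : A →ₗ[K] H ⊗[K] A} {δ : A →ₗ[K] A ⊗[K] A} :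
    C.twoCochain r δ ∈ C.coboundaries 2 ↔ ∃ φ ∈ C.coder, r = C.b 0 0 φ ∧ δ = 0 := by
  constructor
  · rintro ⟨x, hx⟩
    rw [totD_one_apply] at hx
    obtain ⟨h₁, h₂⟩ := C.twoCochain_injective hx
    exact ⟨_, (x ⟨(1, 0), rfl⟩ : C.entrySub 0 0).2, h₁.symm, h₂.symm⟩
  · rintro ⟨φ, hφ, rfl, rfl⟩
    exact ⟨C.oneCochain ⟨φ, hφ⟩, C.totD_oneCochain ⟨φ, hφ⟩⟩

end LowDegrees

/-! ### Leading coefficients are cocycles -/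

namespace Deformation

variable {C} (Θ : C.Deformation)

/-- The first non-trivial coefficients of a deformation form a `2`-cocycle. -/
theorem twoCochain_mem_cocycles {n : ℕ} (hn : 1 ≤ n) (hR : ∀ m, 1 ≤ m → m < n → Θ.R m = 0)
    (hD : ∀ m, 1 ≤ m → m < n → Θ.D m = 0) :
    C.twoCochain (Θ.R n) (Θ.D n) ∈ C.cocycles 2 := by
  refine C.twoCochain_mem_cocycles ?_ ?_ ?_
  -- In the coefficient of `t^n`, products of two coefficients of positive index vanish; what
  -- remains is the linearized axiom, here `b ρ_n = 0`.
  · have h := congrFun Θ.R_coassoc n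
    rw [cauchy_eq_add _ _ _ hn fun i j hi hj hij => by rw [hR i hi (by omega)]; simp,
      Θ.R_zero] at h
    rw [b_zero_one_apply, ← h]
    abel
  · have h := congrFun Θ.R_D n
    have hs : cauchy (fun r r' => TensorProduct.map r r') Θ.R Θ.R n =
        TensorProduct.map C.coact (Θ.R n) + TensorProduct.map (Θ.R n) C.coact := by
      rw [cauchy_eq_add _ _ _ hn fun i j hi hj hij => by rw [hR i hi (by omega)]; simp,
        Θ.R_zero]
    -- The right-hand side has three factors, so mixed terms are removed twice: here those with
    -- `Δ_j`, and in `hs` those with two coefficients of `R`.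
    rw [cauchy_eq_add _ _ _ hn fun i j hi hj hij => by rw [hD i hi (by omega)]; simp,
      cauchy_eq_add _ _ _ hn fun i j hi hj hij => by rw [hD j hj (by omega)]; simp,
      cauchy_zero, hs, Θ.R_zero, Θ.D_zero, LinearMap.add_comp, LinearMap.comp_add] at h
    rw [b_one_zero_apply, d_zero_one_apply]
    have e : ∀ a b c d e : A →ₗ[K] H ⊗[K] (A ⊗[K] A), a + b = c + (d + e) →
        c - b + (d - a + e) = 0 := by
      intro a b c d e h
      rw [show c - b + (d - a + e) = c + (d + e) - (a + b) by abel, h, sub_self]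
    exact e _ _ _ _ _ h
  · have h := congrFun Θ.D_coassoc n
    rw [cauchy_eq_add _ _ _ hn fun i j hi hj hij => by rw [hD i hi (by omega)]; simp,
      cauchy_eq_add _ _ _ hn fun i j hi hj hij => by rw [hD i hi (by omega)]; simp,
      Θ.D_zero] at h
    rw [d_one_zero_apply, sub_sub, h]
    exact sub_eq_zero.2 (add_comm _ _)

theorem infinitesimal_mem_cocycles : Θ.infinitesimal ∈ C.cocycles 2 :=
  Θ.twoCochain_mem_cocycles le_rfl (fun m h h' => absurd h (by omega))
    (fun m h h' => absurd h (by omega))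

end Deformation
end ComoduleCoalgebra

/-! ### Conjugating a deformation by an invertible series -/

section Series

variable {K : Type u} [Field K]
variable {H X Y Z X' Y' : Type v} [AddCommGroup H] [Module K H] [AddCommGroup X] [Module K X]
  [AddCommGroup Y] [Module K Y] [AddCommGroup X'] [Module K X'] [AddCommGroup Y'] [Module K Y']
  [AddCommGroup Z] [Module K Z]

theorem lTensor_sum {ι : Type*} (s : Finset ι) (f : ι → X →ₗ[K] Y) :
    LinearMap.lTensor H (∑ i ∈ s, f i) = ∑ i ∈ s, LinearMap.lTensor H (f i) := by
  rw [← LinearMap.coe_lTensorHom, map_sum]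

theorem comp_cauchy {M N : Type*} (op : M → N → X →ₗ[K] Y) (g : Y →ₗ[K] Z) (f : ℕ → M) (k : ℕ → N)
    (n : ℕ) : g ∘ₗ cauchy op f k n = cauchy (fun a b => g ∘ₗ op a b) f k n :=
  comp_sum _ _ _

theorem comulFirst_sMap (δ : H →ₗ[K] H ⊗[K] H) (f : ℕ → X →ₗ[K] Y) :
    sComp (constSeries (comulFirst δ Y)) (sMap (sId K H) f) =
      sComp (sMap (sId K H) (sMap (sId K H) f)) (constSeries (comulFirst δ X)) := by
  rw [const_sComp, sComp_const, sMap_sId_left, sMap_sId_left]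
  exact funext fun n => LinearMap.ext fun t => comulFirst_lTensor δ (f n) t

theorem Bialg.mulShuffle_sMap (B : Bialg K H) (f : ℕ → X →ₗ[K] X') (g : ℕ → Y →ₗ[K] Y') :
    sComp (constSeries (B.mulShuffle X' Y')) (sMap (sMap (sId K H) f) (sMap (sId K H) g)) =
      sComp (sMap (sId K H) (sMap f g)) (constSeries (B.mulShuffle X Y)) := by
  rw [const_sComp, sComp_const, sMap_sId_left, sMap_sId_left, sMap_sId_left]
  funext n
  unfold sMap cauchy
  beta_reduce
  rw [comp_sum, lTensor_sum, sum_comp]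
  exact Finset.sum_congr rfl fun ij _ => TensorProduct.ext' fun s t =>
    B.mulShuffle_lTensor (f ij.1) (g ij.2) s t

/-- The coefficients of a power series in `End(X)`. -/
noncomputable def coeffs (Φ : PowerSeries (Module.End K X)) : ℕ → X →ₗ[K] X :=
  fun n => PowerSeries.coeff n Φ

theorem sComp_coeffs (Φ Ψ : PowerSeries (Module.End K X)) :
    sComp (coeffs Φ) (coeffs Ψ) = coeffs (Φ * Ψ) := by
  funext n
  exact (PowerSeries.coeff_mul n Φ Ψ).symm

theorem coeffs_one : coeffs (1 : PowerSeries (Module.End K X)) = sId K X :=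
  funext fun n => PowerSeries.coeff_one n

end Series

namespace ComoduleCoalgebra

variable {K : Type u} [Field K] {H : Type v} [AddCommGroup H] [Module K H] {B : Bialg K H}
  {A : Type v} [AddCommGroup A] [Module K A] {C : ComoduleCoalgebra B A}

namespace Deformation

variable (Θ : C.Deformation)

theorem sComp_R_coassoc : sComp (sMap (sId K H) Θ.R) Θ.R =
    sComp (constSeries (comulFirst B.comul A)) Θ.R := by
  rw [const_sComp, sMap_sId_left]
  exact Θ.R_coassoc

theorem sComp_R_D : sComp (sMap (sId K H) Θ.D) Θ.R =
    sComp (constSeries (B.mulShuffle A A)) (sComp (sMap Θ.R Θ.R) Θ.D) := by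
  rw [const_sComp, sMap_sId_left]
  exact Θ.R_D.trans (funext fun n => (comp_cauchy _ _ _ _ n).symm)

theorem sComp_D_coassoc :
    sComp (constSeries (TensorProduct.assoc K A A A).toLinearMap)
      (sComp (sMap Θ.D (sId K A)) Θ.D) = sComp (sMap (sId K A) Θ.D) Θ.D := by
  rw [const_sComp, sMap_sId_left, sMap_sId_right]
  exact Eq.trans (funext fun n => comp_cauchy _ _ _ _ n) Θ.D_coassoc

variable {P Q : ℕ → A →ₗ[K] A}

/-- Where the two conjugated series meet, `P` and `Q` cancel; the outer `Q` passes through `Δ_H` by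
naturality. Only `P Q = 1` is used, also in the two analogues below. -/
theorem conj_R_coassoc (hPQ : sComp P Q = sId K A) :
    sComp (sMap (sId K H) (sComp (sMap (sId K H) Q) (sComp Θ.R P)))
      (sComp (sMap (sId K H) Q) (sComp Θ.R P)) =
      sComp (constSeries (comulFirst B.comul A)) (sComp (sMap (sId K H) Q) (sComp Θ.R P)) := by
  rw [← sComp_assoc (constSeries _), comulFirst_sMap, sMap_sId_sComp, sMap_sId_sComp, sComp_assoc,
    sComp_assoc, ← sComp_assoc (sMap (sId K H) P), ← sMap_sId_sComp (X := H) P Q, hPQ,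
    sMap_sId_sId, sId_sComp, ← sComp_assoc _ Θ.R P, sComp_R_coassoc]
  simp only [sComp_assoc]

theorem conj_R_D (hPQ : sComp P Q = sId K A) :
    sComp (sMap (sId K H) (sComp (sMap Q Q) (sComp Θ.D P)))
      (sComp (sMap (sId K H) Q) (sComp Θ.R P)) =
      sComp (constSeries (B.mulShuffle A A))
        (sComp (sMap (sComp (sMap (sId K H) Q) (sComp Θ.R P))
          (sComp (sMap (sId K H) Q) (sComp Θ.R P))) (sComp (sMap Q Q) (sComp Θ.D P))) := by
  rw [sMap_sId_sComp, sMap_sId_sComp, sComp_assoc, sComp_assoc, ← sComp_assoc (sMap (sId K H) P),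
    ← sMap_sId_sComp (X := H) P Q, hPQ, sMap_sId_sId, sId_sComp, ← sComp_assoc _ Θ.R P, sComp_R_D,
    sMap_sComp, sMap_sComp, sComp_assoc (sMap (sMap (sId K H) Q) _), sComp_assoc (sMap Θ.R Θ.R),
    ← sComp_assoc (sMap P P), ← sMap_sComp, hPQ, sMap_sId_sId, sId_sComp,
    ← sComp_assoc (constSeries _) (sMap (sMap _ Q) _), B.mulShuffle_sMap]
  simp only [sComp_assoc]

theorem conj_D_coassoc (hPQ : sComp P Q = sId K A) :
    sComp (constSeries (TensorProduct.assoc K A A A).toLinearMap)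
      (sComp (sMap (sComp (sMap Q Q) (sComp Θ.D P)) (sId K A))
        (sComp (sMap Q Q) (sComp Θ.D P))) =
      sComp (sMap (sId K A) (sComp (sMap Q Q) (sComp Θ.D P)))
        (sComp (sMap Q Q) (sComp Θ.D P)) := by
  have h₁ : sComp (sMap (sComp (sMap Q Q) (sComp Θ.D P)) (sId K A)) (sMap Q Q) =
      sComp (sMap (sMap Q Q) Q) (sMap Θ.D (sId K A)) := by
    rw [← sMap_sComp, ← sMap_sComp, sComp_assoc, sComp_assoc, hPQ, sComp_sId, sId_sComp, sComp_sId]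
  have h₂ : sComp (sMap (sId K A) (sComp (sMap Q Q) (sComp Θ.D P))) (sMap Q Q) =
      sComp (sMap Q (sMap Q Q)) (sMap (sId K A) Θ.D) := by
    rw [← sMap_sComp, ← sMap_sComp, sComp_assoc, sComp_assoc, hPQ, sComp_sId, sId_sComp, sComp_sId]
  rw [← sComp_assoc _ (sMap Q Q), h₁, ← sComp_assoc _ (sMap Q Q), h₂, sComp_assoc (sMap Q _),
    ← sComp_assoc (sMap (sId K A) Θ.D), ← sComp_D_coassoc, sComp_assoc (sMap _ Q),
    ← sComp_assoc (constSeries _), assoc_sMap]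
  simp only [sComp_assoc]

theorem sComp_coeffs_inv (Φ : (PowerSeries (Module.End K A))ˣ) :
    sComp (coeffs Φ.val) (coeffs Φ⁻¹.val) = sId K A := by
  rw [sComp_coeffs, Units.mul_inv, coeffs_one]

theorem coeff_zero_inv {Φ : (PowerSeries (Module.End K A))ˣ} (h : PowerSeries.coeff 0 Φ.val = 1) :
    PowerSeries.coeff 0 Φ⁻¹.val = 1 := by
  have h' := congrArg (PowerSeries.coeff 0) (Units.mul_inv Φ)
  rwa [PowerSeries.coeff_mul, Finset.Nat.antidiagonal_zero, Finset.sum_singleton, h, one_mul,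
    PowerSeries.coeff_one, if_pos rfl] at h'

/-- The deformation `((Id_H ⊗ Φ⁻¹) ∘ R ∘ Φ, (Φ⁻¹)^{⊗ 2} ∘ D ∘ Φ)`. -/
noncomputable def conj (Φ : (PowerSeries (Module.End K A))ˣ) (h : PowerSeries.coeff 0 Φ.val = 1) :
    C.Deformation where
  R := sComp (sMap (sId K H) (coeffs Φ⁻¹.val)) (sComp Θ.R (coeffs Φ.val))
  D := sComp (sMap (coeffs Φ⁻¹.val) (coeffs Φ⁻¹.val)) (sComp Θ.D (coeffs Φ.val))
  R_zero := by
    rw [sMap_sId_left, sComp, sComp, cauchy_zero, cauchy_zero, coeffs, coeffs, h, coeff_zero_inv h,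
      Θ.R_zero]
    exact (congrArg (· ∘ₗ _) (LinearMap.lTensor_id H A)).trans (LinearMap.id_comp _)
  D_zero := by
    rw [sMap, sComp, sComp, cauchy_zero, cauchy_zero, cauchy_zero, coeffs, coeffs, h,
      coeff_zero_inv h, Θ.D_zero]
    exact (congrArg (· ∘ₗ _) TensorProduct.map_id).trans (LinearMap.id_comp _)
  R_coassoc := by
    have e := Θ.conj_R_coassoc (sComp_coeffs_inv Φ)
    rw [const_sComp, sMap_sId_left (sComp (sMap (sId K H) _) (sComp Θ.R _))] at e
    exact e
  R_D := by
    have e := Θ.conj_R_D (sComp_coeffs_inv Φ)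
    rw [const_sComp, sMap_sId_left (sComp (sMap (coeffs _) _) (sComp Θ.D _))] at e
    exact e.trans (funext fun n => comp_cauchy _ _ _ _ n)
  D_coassoc := by
    have e := Θ.conj_D_coassoc (sComp_coeffs_inv Φ)
    rw [const_sComp, sMap_sId_left, sMap_sId_right] at e
    exact Eq.trans (funext fun n => (comp_cauchy _ _ _ _ n).symm) e

theorem equivalent_iff (Θ' : C.Deformation) : Θ.Equivalent Θ' ↔
    ∃ (Φ : (PowerSeries (Module.End K A))ˣ) (h : C.IsFormalAutomorphism Φ.val),
      Θ'.R = (Θ.conj Φ h.1).R ∧ Θ'.D = (Θ.conj Φ h.1).D := by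
  have hR : ∀ (Φ : (PowerSeries (Module.End K A))ˣ) (h : PowerSeries.coeff 0 Φ.val = 1),
      (Θ.conj Φ h).R = cauchy (fun (ψ : Module.End K A) r => LinearMap.lTensor H ψ ∘ₗ r)
      (fun n => PowerSeries.coeff n Φ⁻¹.val)
      (cauchy (fun r (φ : Module.End K A) => r ∘ₗ φ) Θ.R (fun n => PowerSeries.coeff n Φ.val)) := by
    intro Φ h
    change sComp (sMap (sId K H) (coeffs Φ⁻¹.val)) (sComp Θ.R (coeffs Φ.val)) = _
    rw [sMap_sId_left]
    rfl
  constructor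
  · rintro ⟨Φ, h, h₁, h₂⟩
    exact ⟨Φ, h, h₁.trans (hR Φ h.1).symm, h₂⟩
  · rintro ⟨Φ, h, h₁, h₂⟩
    exact ⟨Φ, h, h₁.trans (hR Φ h.1), h₂⟩

theorem conj_conj_R (Φ Ω : (PowerSeries (Module.End K A))ˣ) (h : PowerSeries.coeff 0 Φ.val = 1)
    (h' : PowerSeries.coeff 0 Ω.val = 1) (h'' : PowerSeries.coeff 0 (Φ * Ω).val = 1) :
    ((Θ.conj Φ h).conj Ω h').R = (Θ.conj (Φ * Ω) h'').R := by
  simp only [conj, mul_inv_rev, Units.val_mul, ← sComp_coeffs, sMap_sId_sComp, sComp_assoc]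

theorem conj_conj_D (Φ Ω : (PowerSeries (Module.End K A))ˣ) (h : PowerSeries.coeff 0 Φ.val = 1)
    (h' : PowerSeries.coeff 0 Ω.val = 1) (h'' : PowerSeries.coeff 0 (Φ * Ω).val = 1) :
    ((Θ.conj Φ h).conj Ω h').D = (Θ.conj (Φ * Ω) h'').D := by
  simp only [conj, mul_inv_rev, Units.val_mul, ← sComp_coeffs, sMap_sComp, sComp_assoc]

end Deformation
end ComoduleCoalgebra

/-! ### Inverses of power series modulo powers of `t` -/

section Units

variable {R : Type*} [Ring R]

theorem coeff_mul_congr {f f' g g' : PowerSeries R} {n : ℕ}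
    (hf : ∀ m ≤ n, PowerSeries.coeff m f = PowerSeries.coeff m f')
    (hg : ∀ m ≤ n, PowerSeries.coeff m g = PowerSeries.coeff m g') :
    ∀ m ≤ n, PowerSeries.coeff m (f * g) = PowerSeries.coeff m (f' * g') := by
  intro m hm
  rw [PowerSeries.coeff_mul, PowerSeries.coeff_mul]
  refine Finset.sum_congr rfl fun ij hij => ?_
  have := Finset.HasAntidiagonal.mem_antidiagonal.1 hij
  rw [hf _ (by omega), hg _ (by omega)]

/-- Compare `Φ⁻¹ (Ψ Ψ⁻¹)` with `Φ⁻¹ (Φ Ψ⁻¹)`: the two products differ only in a factor whose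
coefficients agree up to `n`. -/
theorem coeff_inv_congr {Φ Ψ : (PowerSeries R)ˣ} {n : ℕ}
    (h : ∀ m ≤ n, PowerSeries.coeff m Φ.val = PowerSeries.coeff m Ψ.val) :
    ∀ m ≤ n, PowerSeries.coeff m Φ⁻¹.val = PowerSeries.coeff m Ψ⁻¹.val := by
  intro m hm
  have h₁ : Φ⁻¹.val * (Ψ.val * Ψ⁻¹.val) = Φ⁻¹.val := by rw [Units.mul_inv, mul_one]
  have h₂ : Φ⁻¹.val * (Φ.val * Ψ⁻¹.val) = Ψ⁻¹.val := by rw [Units.inv_mul_cancel_left]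
  rw [← h₁]
  conv_rhs => rw [← h₂]
  exact coeff_mul_congr (fun _ _ => rfl)
    (coeff_mul_congr (fun i hi => (h i hi).symm) fun _ _ => rfl) m hm

theorem exists_unit_val_eq {f : PowerSeries R} (h : PowerSeries.coeff 0 f = 1) :
    ∃ Φ : (PowerSeries R)ˣ, Φ.val = f := by
  have h' : PowerSeries.constantCoeff f = (1 : Rˣ) := by
    rw [← PowerSeries.coeff_zero_eq_constantCoeff_apply, h, Units.val_one]
  exact ⟨⟨f, PowerSeries.invOfUnit f 1, PowerSeries.mul_invOfUnit f 1 h',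
    PowerSeries.invOfUnit_mul f 1 h'⟩, rfl⟩

theorem coeff_inv_eq_neg {Φ : (PowerSeries R)ˣ} (h : PowerSeries.coeff 0 Φ.val = 1)
    (h' : PowerSeries.coeff 0 Φ⁻¹.val = 1) {n : ℕ} (hn : 1 ≤ n)
    (hΦ : ∀ m, 1 ≤ m → m < n → PowerSeries.coeff m Φ.val = 0) :
    PowerSeries.coeff n Φ⁻¹.val = -PowerSeries.coeff n Φ.val := by
  have e := congrArg (PowerSeries.coeff n) (Units.inv_mul Φ)
  rw [PowerSeries.coeff_mul, PowerSeries.coeff_one, if_neg (by omega)] at e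
  have e' := cauchy_eq_add (fun a b : R => a * b) (fun m => PowerSeries.coeff m Φ⁻¹.val)
    (fun m => PowerSeries.coeff m Φ.val) hn fun i j hi hj hij => by
      change _ * PowerSeries.coeff j Φ.val = 0
      rw [hΦ j hj (by omega), mul_zero]
  have e'' := e'.symm.trans e
  simp only [h, h', one_mul, mul_one] at e''
  exact eq_neg_of_add_eq_zero_right e''

end Units

namespace ComoduleCoalgebra

variable {K : Type u} [Field K] {H : Type v} [AddCommGroup H] [Module K H] {B : Bialg K H}
  {A : Type v} [AddCommGroup A] [Module K A] {C : ComoduleCoalgebra B A}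

namespace Deformation

variable (Θ : C.Deformation)

/-! ### Effect of conjugation in the leading degree -/

section Leading

variable {Φ : (PowerSeries (Module.End K A))ˣ} (h : PowerSeries.coeff 0 Φ.val = 1) {n : ℕ}

/-- Up to order `n`, `Φ` is `1 + φ t^n` and `Φ⁻¹` is `1 - φ t^n`, so the correction is `ρ φ - (Id ⊗
φ) ρ`. The gap in `Φ` keeps the intermediate coefficients of `Θ` from contributing. -/
theorem conj_R_apply (hn : 1 ≤ n)
    (hΦ : ∀ m, 1 ≤ m → m < n → PowerSeries.coeff m Φ.val = 0) :
    (Θ.conj Φ h).R n = Θ.R n + C.b 0 0 (PowerSeries.coeff n Φ.val) := by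
  have hi : ∀ m, 1 ≤ m → m < n → PowerSeries.coeff m Φ⁻¹.val = 0 := fun m hm hm' => by
    rw [coeff_inv_eq_neg h (coeff_zero_inv h) hm fun i hi hi' => hΦ i hi (by omega),
      hΦ m hm hm', neg_zero]
  change sComp (sMap (sId K H) (coeffs Φ⁻¹.val)) (sComp Θ.R (coeffs Φ.val)) n = _
  rw [sMap_sId_left, sComp, cauchy_eq_add _ _ _ hn, sComp, cauchy_zero, cauchy_eq_add _ _ _ hn]
  · simp only [coeffs]
    rw [coeff_zero_inv h, coeff_inv_eq_neg h (coeff_zero_inv h) hn hΦ, h, Θ.R_zero,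
      b_zero_zero_apply, LinearMap.lTensor_neg]
    have h₁ : LinearMap.lTensor H (1 : Module.End K A) = LinearMap.id := LinearMap.lTensor_id H A
    have h₂ : ∀ f : A →ₗ[K] H ⊗[K] A, f ∘ₗ (1 : Module.End K A) = f := LinearMap.comp_id
    rw [h₁, h₂, h₂, LinearMap.id_comp, LinearMap.neg_comp]
    abel
  · intro i j hi' hj hij
    simp only [coeffs]
    rw [hΦ j hj (by omega), LinearMap.comp_zero]
  · intro i j hi' hj hij
    simp only [coeffs]
    rw [hi i hi' (by omega), LinearMap.lTensor_zero, LinearMap.zero_comp]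

theorem conj_D_apply (hn : 1 ≤ n)
    (hΦ : ∀ m, 1 ≤ m → m < n → PowerSeries.coeff m Φ.val = 0) :
    (Θ.conj Φ h).D n = Θ.D n - C.d 0 0 (PowerSeries.coeff n Φ.val) := by
  have hi : ∀ m, 1 ≤ m → m < n → PowerSeries.coeff m Φ⁻¹.val = 0 := fun m hm hm' => by
    rw [coeff_inv_eq_neg h (coeff_zero_inv h) hm fun i hi hi' => hΦ i hi (by omega),
      hΦ m hm hm', neg_zero]
  have hs : ∀ m, 1 ≤ m → m ≤ n → sMap (coeffs Φ⁻¹.val) (coeffs Φ⁻¹.val) m =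
      LinearMap.lTensor A (PowerSeries.coeff m Φ⁻¹.val) +
        LinearMap.rTensor A (PowerSeries.coeff m Φ⁻¹.val) := by
    intro m hm hm'
    rw [sMap, cauchy_eq_add _ _ _ hm]
    · simp only [coeffs]
      rw [coeff_zero_inv h]
      rfl
    · intro i j hi' hj hij
      simp only [coeffs]
      rw [hi i hi' (by omega), TensorProduct.map_zero_left]
  change sComp (sMap (coeffs Φ⁻¹.val) (coeffs Φ⁻¹.val)) (sComp Θ.D (coeffs Φ.val)) n = _
  rw [sComp, cauchy_eq_add _ _ _ hn, sComp, cauchy_zero, cauchy_eq_add _ _ _ hn, hs n hn le_rfl,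
    sMap, cauchy_zero]
  · simp only [coeffs]
    rw [coeff_zero_inv h, coeff_inv_eq_neg h (coeff_zero_inv h) hn hΦ, h, Θ.D_zero,
      d_zero_zero_apply, LinearMap.lTensor_neg, LinearMap.rTensor_neg]
    have h₁ : TensorProduct.map (1 : Module.End K A) (1 : Module.End K A) = LinearMap.id :=
      TensorProduct.map_id
    have h₂ : ∀ f : A →ₗ[K] A ⊗[K] A, f ∘ₗ (1 : Module.End K A) = f := LinearMap.comp_id
    rw [h₁, h₂, h₂, LinearMap.id_comp, LinearMap.add_comp, LinearMap.neg_comp, LinearMap.neg_comp]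
    have e : ∀ a b c d : A →ₗ[K] A ⊗[K] A, a + b + (-c + -d) = b - (c - a + d) := by
      intros
      abel
    exact e _ _ _ _
  · intro i j hi' hj hij
    simp only [coeffs]
    rw [hΦ j hj (by omega), LinearMap.comp_zero]
  · intro i j hi' hj hij
    rw [hs i hi' (by omega), hi i hi' (by omega), LinearMap.lTensor_zero, LinearMap.rTensor_zero,
      add_zero, LinearMap.zero_comp]

end Leading

theorem Equivalent.sub_mem_coboundaries {Θ Θ' : C.Deformation} (h : Θ.Equivalent Θ') :
    Θ.infinitesimal - Θ'.infinitesimal ∈ C.coboundaries 2 := by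
  obtain ⟨Φ, hΦ, hR, hD⟩ := (Θ.equivalent_iff Θ').1 h
  have hc : PowerSeries.coeff 1 Φ.val ∈ C.coder := by
    by_cases h0 : PowerSeries.coeff 1 Φ.val = 0
    · rw [h0]
      exact C.coder.zero_mem
    · exact hΦ.2 1 le_rfl h0 fun m hm hm' => absurd hm (by omega)
  rw [infinitesimal, infinitesimal, twoCochain_sub, twoCochain_mem_coboundaries_iff]
  -- Conjugation adds `b φ_1`, so the difference `ρ_1 - ρ'_1` is `b (-φ_1)`.
  refine ⟨-PowerSeries.coeff 1 Φ.val, C.coder.neg_mem hc, ?_, ?_⟩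
  · rw [hR, Θ.conj_R_apply hΦ.1 le_rfl fun m hm hm' => absurd hm (by omega)]
    exact (sub_add_cancel_left _ _).trans (map_neg (C.b 0 0) _).symm
  · rw [hD, Θ.conj_D_apply hΦ.1 le_rfl fun m hm hm' => absurd hm (by omega)]
    have e := C.d_eq_zero_of_mem_coder hc
    exact sub_eq_zero.2 ((congrArg (Θ.D 1 - ·) e).trans (sub_zero _)).symm

/-! ### Trivialization order by order and passage to the limit -/

theorem conj_congr {Φ Ψ : (PowerSeries (Module.End K A))ˣ} (h : PowerSeries.coeff 0 Φ.val = 1)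
    (h' : PowerSeries.coeff 0 Ψ.val = 1) {n : ℕ}
    (hn : ∀ m ≤ n, PowerSeries.coeff m Φ.val = PowerSeries.coeff m Ψ.val) :
    (Θ.conj Φ h).R n = (Θ.conj Ψ h').R n ∧ (Θ.conj Φ h).D n = (Θ.conj Ψ h').D n := by
  have hi := coeff_inv_congr hn
  exact ⟨cauchy_congr _ (fun m hm => cauchy_congr _ (fun _ _ => rfl) fun i hi' => hi i (by omega))
      fun m hm => cauchy_congr _ (fun _ _ => rfl) fun i hi' => hn i (by omega),
    cauchy_congr _ (fun m hm => cauchy_congr _ (fun i hi' => hi i (by omega))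
      fun i hi' => hi i (by omega))
      fun m hm => cauchy_congr _ (fun _ _ => rfl) fun i hi' => hn i (by omega)⟩

/-- `Φ` is a formal automorphism, either trivial or non-trivial to order `k`, that trivializes `Θ`
to order `k`. -/
structure Trivializes (k : ℕ) (Φ : (PowerSeries (Module.End K A))ˣ) : Prop where
  coeff_zero : PowerSeries.coeff 0 Φ.val = 1
  R_eq_zero : ∀ m, 1 ≤ m → m ≤ k → (Θ.conj Φ coeff_zero).R m = 0
  D_eq_zero : ∀ m, 1 ≤ m → m ≤ k → (Θ.conj Φ coeff_zero).D m = 0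
  leading : Φ = 1 ∨ ∃ j, 1 ≤ j ∧ j ≤ k ∧ PowerSeries.coeff j Φ.val ≠ 0 ∧
    PowerSeries.coeff j Φ.val ∈ C.coder ∧ ∀ m, 1 ≤ m → m < j → PowerSeries.coeff m Φ.val = 0

/-- After conjugation by `Φ`, the coefficients in degree `k + 1` form a cocycle, hence equal `(b φ,
0)` for a coderivation `φ`; a further conjugation by `Ω = 1 - φ t^{k+1}` removes them. The agreement
up to degree `k` is what makes the limit exist. -/
theorem Trivializes.exists_succ (hH : C.cocycles 2 ≤ C.coboundaries 2) {k : ℕ}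
    {Φ : (PowerSeries (Module.End K A))ˣ} (hΦ : Θ.Trivializes k Φ) :
    ∃ Ψ, Θ.Trivializes (k + 1) Ψ ∧
      ∀ m ≤ k, PowerSeries.coeff m Ψ.val = PowerSeries.coeff m Φ.val := by
  have hz := (Θ.conj Φ hΦ.coeff_zero).twoCochain_mem_cocycles (n := k + 1) (by omega)
    (fun m hm hm' => hΦ.R_eq_zero m hm (by omega)) (fun m hm hm' => hΦ.D_eq_zero m hm (by omega))
  obtain ⟨φ, hφ, hR, hD⟩ := C.twoCochain_mem_coboundaries_iff.1 (hH hz)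
  obtain ⟨Ω, hΩ⟩ := exists_unit_val_eq (R := Module.End K A)
    (f := PowerSeries.mk fun m => if m = 0 then 1 else if m = k + 1 then -φ else 0)
    (by rw [PowerSeries.coeff_mk, if_pos rfl])
  have hc : ∀ m, PowerSeries.coeff m Ω.val =
      if m = 0 then 1 else if m = k + 1 then -φ else 0 := fun m => by
    rw [hΩ, PowerSeries.coeff_mk]
  have h0 : PowerSeries.coeff 0 Ω.val = 1 := by rw [hc, if_pos rfl]
  have h1 : PowerSeries.coeff (k + 1) Ω.val = -φ := by rw [hc, if_neg (by omega), if_pos rfl]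
  have hlt : ∀ m, 1 ≤ m → m < k + 1 → PowerSeries.coeff m Ω.val = 0 := fun m hm hm' => by
    rw [hc, if_neg (by omega), if_neg (by omega)]
  have hagree : ∀ m ≤ k, PowerSeries.coeff m (Φ * Ω).val = PowerSeries.coeff m Φ.val := by
    intro m hm
    rw [Units.val_mul]
    conv_rhs => rw [← mul_one Φ.val]
    refine coeff_mul_congr (fun _ _ => rfl) (fun i hi => ?_) m hm
    rw [hc, PowerSeries.coeff_one]
    split_ifs <;> first | rfl | omega
  have h0' : PowerSeries.coeff 0 (Φ * Ω).val = 1 := (hagree 0 (by omega)).trans hΦ.coeff_zero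
  refine ⟨Φ * Ω, ⟨h0', fun m hm hm' => ?_, fun m hm hm' => ?_, ?_⟩, hagree⟩
  · rw [← Θ.conj_conj_R Φ Ω hΦ.coeff_zero h0 h0',
      conj_R_apply _ h0 hm fun i hi hi' => hlt i hi (by omega)]
    rcases Nat.lt_or_ge m (k + 1) with hlt' | hge
    · rw [hlt m hm hlt', hΦ.R_eq_zero m hm (by omega)]
      exact (zero_add _).trans (map_zero (C.b 0 0))
    · obtain rfl : m = k + 1 := le_antisymm hm' hge
      rw [h1, hR]
      exact (congrArg (C.b 0 0 φ + ·) (map_neg (C.b 0 0) φ)).trans (add_neg_cancel _)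
  · rw [← Θ.conj_conj_D Φ Ω hΦ.coeff_zero h0 h0',
      conj_D_apply _ h0 hm fun i hi hi' => hlt i hi (by omega)]
    rcases Nat.lt_or_ge m (k + 1) with hlt' | hge
    · rw [hlt m hm hlt', hΦ.D_eq_zero m hm (by omega)]
      exact (zero_sub _).trans (neg_eq_zero.2 (map_zero (C.d 0 0)))
    · obtain rfl : m = k + 1 := le_antisymm hm' hge
      rw [h1, hD]
      exact (zero_sub _).trans
        (neg_eq_zero.2 (C.d_eq_zero_of_mem_coder (C.coder.neg_mem hφ)))
  -- An existing leading coefficient has degree at most `k` and is untouched by `Ω`. If `Φ = 1`, the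
  -- new leading coefficient is `-φ`, unless `φ = 0` and the product is still `1`.
  · rcases hΦ.leading with rfl | ⟨j, hj, hjk, hj0, hjc, hjm⟩
    · rw [one_mul]
      by_cases hφ0 : φ = 0
      · left
        refine Units.ext (PowerSeries.ext fun m => ?_)
        rw [hc, hφ0, neg_zero, Units.val_one, PowerSeries.coeff_one]
        split_ifs <;> rfl
      · exact Or.inr ⟨k + 1, by omega, le_rfl, by rwa [h1, neg_ne_zero],
          by rw [h1]; exact C.coder.neg_mem hφ, hlt⟩
    · refine Or.inr ⟨j, hj, by omega, by rwa [hagree j hjk], by rwa [hagree j hjk],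
        fun m hm hm' => ?_⟩
      rw [hagree m (by omega), hjm m hm hm']

theorem trivializes_zero_one : Θ.Trivializes 0 1 :=
  ⟨by rw [Units.val_one, PowerSeries.coeff_one, if_pos rfl], fun m hm hm' => absurd hm (by omega),
    fun m hm hm' => absurd hm (by omega), Or.inl rfl⟩

/-- The limit of a sequence of trivializations to all finite orders. -/
theorem exists_equivalent_trivial (hH : C.cocycles 2 ≤ C.coboundaries 2) :
    Θ.Equivalent C.trivialDeformation := by
  have step : ∀ k (Φ : {Φ // Θ.Trivializes k Φ}), ∃ Ψ : {Ψ // Θ.Trivializes (k + 1) Ψ},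
      ∀ m ≤ k, PowerSeries.coeff m Ψ.1.val = PowerSeries.coeff m Φ.1.val := fun k Φ => by
    obtain ⟨Ψ, hΨ, h⟩ := Trivializes.exists_succ Θ hH Φ.2
    exact ⟨⟨Ψ, hΨ⟩, h⟩
  choose F hF using step
  let S : (k : ℕ) → {Φ // Θ.Trivializes k Φ} :=
    fun k => Nat.rec ⟨1, Θ.trivializes_zero_one⟩ (fun k Φ => F k Φ) k
  have hS : ∀ k l, k ≤ l → ∀ m ≤ k,
      PowerSeries.coeff m (S l).1.val = PowerSeries.coeff m (S k).1.val := by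
    intro k l hkl
    induction l, hkl using Nat.le_induction with
    | base => exact fun _ _ => rfl
    | succ l hl ih => exact fun m hm => (hF l (S l) m (by omega)).trans (ih m hm)
  obtain ⟨Φ, hΦ⟩ := exists_unit_val_eq (R := Module.End K A)
    -- The `t`-adic limit: the coefficient in degree `m` is constant from stage `m` on.
    (f := PowerSeries.mk fun m => PowerSeries.coeff m (S m).1.val)
    (by rw [PowerSeries.coeff_mk]; exact (S 0).2.coeff_zero)
  have hc : ∀ k, ∀ m ≤ k, PowerSeries.coeff m Φ.val = PowerSeries.coeff m (S k).1.val := by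
    intro k m hm
    rw [hΦ, PowerSeries.coeff_mk, hS m k hm m le_rfl]
  have hA : C.IsFormalAutomorphism Φ.val := by
    refine ⟨(hc 0 0 le_rfl).trans (S 0).2.coeff_zero, fun n hn hn0 hlt => ?_⟩
    rw [hc n n le_rfl] at hn0 ⊢
    -- Let `n` be the first degree with a nonzero coefficient in the limit. Stage `n` agrees with
    -- the limit up to degree `n`, so it is not `1` and its leading degree `j` cannot be smaller
    -- than `n`.
    rcases (S n).2.leading with h1 | ⟨j, hj, hjn, hj0, hjc, -⟩
    · rw [h1, Units.val_one, PowerSeries.coeff_one, if_neg (by omega)] at hn0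
      exact absurd rfl hn0
    · rcases hjn.lt_or_eq with hlt' | rfl
      · rw [← hc n j hjn] at hj0
        exact absurd (hlt j hj hlt') hj0
      · exact hjc
  refine (Θ.equivalent_iff _).2 ⟨Φ, hA, funext fun n => ?_, funext fun n => ?_⟩
  -- The coefficient of `t^n` in the conjugate depends only on the coefficients of `Φ` up to `n`, so
  -- the limit may be replaced by stage `n`.
  · rw [(Θ.conj_congr hA.1 (S n).2.coeff_zero (hc n)).1]
    rcases Nat.eq_zero_or_pos n with rfl | hn
    · rw [R_zero, R_zero]
    · rw [(S n).2.R_eq_zero n hn le_rfl]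
      exact if_neg hn.ne'
  · rw [(Θ.conj_congr hA.1 (S n).2.coeff_zero (hc n)).2]
    rcases Nat.eq_zero_or_pos n with rfl | hn
    · rw [D_zero, D_zero]
    · rw [(S n).2.D_eq_zero n hn le_rfl]
      exact if_neg hn.ne'

end Deformation

theorem cocycles_le_coboundaries (n : ℕ) (h : Subsingleton (C.Cohomology n)) :
    C.cocycles n ≤ C.coboundaries n := by
  intro x hx
  have e : C.cohomologyClass n ⟨x, hx⟩ = 0 := Subsingleton.elim _ _
  exact (Submodule.Quotient.mk_eq_zero ((C.coboundaries n).submoduleOf (C.cocycles n))).1 e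

end ComoduleCoalgebra

end ComodCoalg

theorem mainTheorem7 {K : Type u} [Field K] {H : Type v} [AddCommGroup H] [Module K H]
    (B : ComodCoalg.Bialg K H) {A : Type v} [AddCommGroup A] [Module K A]
    (C : ComodCoalg.ComoduleCoalgebra B A) :
    -- `C_CC^{**}(A)` is a bicomplex, and its total complex is a complex
    ((∀ p q, C.dHor (p + 1) q ∘ₗ C.dHor p q = 0) ∧
      (∀ p q, C.dVert p (q + 1) ∘ₗ C.dVert p q = 0) ∧
      (∀ p q, C.dHor p (q + 1) ∘ₗ C.dVert p q + C.dVert (p + 1) q ∘ₗ C.dHor p q = 0) ∧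
      (∀ n, C.totD (n + 1) ∘ₗ C.totD n = 0)) ∧
    -- infinitesimals are `2`-cocycles, and those of equivalent deformations are cohomologous
    (∃ h : ∀ Θ : C.Deformation, Θ.infinitesimal ∈ C.cocycles 2,
      ∀ Θ Θ' : C.Deformation, Θ.Equivalent Θ' →
        C.cohomologyClass 2 ⟨Θ.infinitesimal, h Θ⟩ =
          C.cohomologyClass 2 ⟨Θ'.infinitesimal, h Θ'⟩) ∧
    -- vanishing of the second cohomology implies rigidity
    (Subsingleton (C.Cohomology 2) → C.IsRigid) := by
  refine ⟨⟨C.dHor_dHor, C.dVert_dVert, C.dHor_dVert_add_dVert_dHor, C.totD_totD⟩,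
    ⟨fun Θ => Θ.infinitesimal_mem_cocycles, fun Θ Θ' h => ?_⟩,
    fun h Θ => Θ.exists_equivalent_trivial (C.cocycles_le_coboundaries 2 h)⟩
  exact (Submodule.Quotient.eq _).2 h.sub_mem_coboundaries
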